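/- **Setting.** $\lambda$ is the security parameter. Algorithms, adversaries, distinguishers and simulators are families of probabilistic circuits of size polynomial in $\lambda$ (non-uniform PPT); $\approx_c$ is computational indistinguishability. There are $N=N(\lambda)\le \mathrm{poly}(\lambda)$ users $P_1,\dots,P_N$ and a server $\mathcal C$; all parties are honest-but-curious. **MCKKS.** Let $R_Q=\mathbb Z_Q[X]/(X^{\mathcal N}+1)$, $\mathcal N$ a power of two, $Q_\ell=q_0\cdots q_\ell$ with distinct primes $q_i$, initial level $\mathcal L$, initial scale $\Delta$. Real vectors of length $\mathcal N/2$ are encoded by the rounded canonical embedding times the scale ($\mathbf{Ecd}$). User $P_i$ has a uniform ternary share $sk_i$, and $sk=\sum_i sk_i$. From a common random string and broadcast shares the users form ($\mathbf{DKeyGen}$) the collective key $pk=(\sum_i(-a\,sk_i+e_i),a)$, a relinearization key (two-round protocol) and rotation keys, with base-$w$ gadget decomposition. $\mathbf{Enc}(pk,\hat m)=(pk_0u+e_0+\hat m,\;pk_1u+e_1)$ with ternary $u$ and errors from a fixed error distribution; $\mathbf{Add},\mathbf{Sub},\mathbf{Mul}_{pt},\mathbf{Mul}_{ct},\mathbf{Rot},\mathbf{RS}$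 are the usual CKKS operations (in additions the operand of smaller scale is first multiplied by the rounded quotient of the scales). $\mathbf{DBootstrap}(c)$ for $c$ at level $\ell$ and scale $\Delta_c$: each user broadcasts $h_i=c_1sk_i-M_i+e_i \bmod Q_\ell$, with a uniform bounded mask $M_i$ and a uniform bounded smudging error $e_i$, and an encryption under $pk$ of $M_i$ rescaled by $\Delta/\Delta_c$; everybody lifts and rescales $c_0+\sum_ih_i$ to modulus $Q_{\mathcal L}$ and scale $\Delta$ and adds the encrypted masks. $\mathbf{DKeySwitch}(c,pk')$: each user broadcasts an encryption under $pk'$ of $c_1sk_i+e_i$, with a smudging error $e_i$; these are added up and $c_0$ is added to the first component. The smudging bounds may depend on the step of the protocol. $\mathcal C$ has its own one-party MCKKS key pair $(sk',pk')$ for the same parameters. **Hercules.** Public hyperparameters: the number $\mathbb L$ of layers, the matrix size $h$, the number $H$ of iterations, the batch size $\mathcal B$, the learning rate $\eta$, and straight-line polynomial circuits approximating the activation $\varphi$ and its derivative $\varphi'$. $\mathcal C$ encrypts its initial weights $\omega_1,\dots,\omega_{\mathbb L}$ under $pk$ and broadcasts them. In each of $H$ iterations every user encrypts the samples and labels of its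 mini-batch of size $\mathcal B$ and evaluates under encryption, for each sample with matrices $M_0=X$ and $Y$: $E_j=\omega_jM_{j-1}$ and $M_j=\varphi(E_j)$ (then $M_j$ is bootstrapped by all users) for $j=1,\dots,\mathbb L$; $L=(Y-M_{\mathbb L})\odot(Y-M_{\mathbb L})$, $L_{\mathbb L}=\varphi'(E_{\mathbb L})\odot L$, $L_j=\varphi'(E_j)\odot(L_{j+1}\omega_{j+1}^T)$ for $j<\mathbb L$, and the gradient sums $\nabla\omega_j\mathrel{+}=M_{j-1}^TL_j$. Matrix products and transpositions are computed on packed ciphertexts by homomorphic linear transformations (rotations times diagonal vectors), and each homomorphic multiplication is followed by $\mathbf{RS}$. Users send their encrypted gradients to $\mathcal C$, which broadcasts the encryption of $\omega_j-\frac{\eta}{\mathcal BN}\sum_i\nabla\omega_{j,i}$. At the end the users switch the encrypted weights to $pk'$, so that $\mathcal C$ can decrypt them. **View and ideal world.** For a set $A$ of colluding users, with or without $\mathcal C$, the view of the colluding parties consists of their encoded inputs, their coins (including those of key generation), and all messages transmitted in the protocol. In the ideal world the users have no output, and the output of $\mathcal C$ is the encoding of the weights resulting from the same training computation carried out exactly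 in the clear. **Assumptions.** (a) The bit lengths and sizes of all parameters and hyperparameters, with $\mathcal N$ counted in unary, are polynomially bounded. (b) MCKKS is CPA-secure under collusion of $N-1$ users: for every user $P_h$, an adversary that sees the common random string, all shares of the key generation and the coins of all users other than $P_h$, and then chooses two plaintexts, has negligible advantage in telling their encryptions under $pk$ apart. The same holds for the one-party instance used by $\mathcal C$. (c) $\delta(\lambda)$ is a negligible function. Inputs are called *admissible* if, except with negligible probability over the real execution, each ciphertext entering $\mathbf{DBootstrap}$ or $\mathbf{DKeySwitch}$ decrypts to the encoding of the exact intermediate value up to an error of at most $\delta(2B+1)$ per coefficient, where $B$ is the smudging bound used at that step, and the encodings of the values to be bootstrapped have coefficients of absolute value at most $\delta(2B'+1)$, where $B'$ is the mask bound. **Theorem.** Under these assumptions Hercules realizes data privacy and model privacy: 1. (Collusion of users: privacy of the other users' data and of the model.) For all sets $A=A(\lambda)$ of at most $N-1$ users there is a non-uniform PPT simulator $\mathcal S$ such that for all admissible inputs of the parties, $\mathcal S(\text{encoded inputs of }A)\approx_c$ the view of $A$. 2. (Collusion of the server and users: privacy of the other users' data.) For all sets $A=A(\lambda)$ of at most $N-1$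 users there is a non-uniform PPT simulator $\mathcal S$ such that for all admissible inputs of the parties, $\mathcal S(\text{encoded inputs of }A\text{ and }\mathcal C,\ \text{output of }\mathcal C)\approx_c$ the view of $A\cup\{\mathcal C\}$. -/

import Mathlib

/-! Asymptotics, and a computation model with explicit cost. -/

namespace Hercules

/-- `f` is bounded by a polynomial in the security parameter. -/
def PolyBounded (f : ℕ → ℕ) : Prop := ∃ p : Polynomial ℕ, ∀ k, f k ≤ p.eval k

/-- `f` decays faster than the inverse of every polynomial in the security parameter. -/
def Negligible (f : ℕ → ℝ) : Prop :=
  Asymptotics.SuperpolynomialDecay Filter.atTop (fun k : ℕ => (k : ℝ)) f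

/-- Instructions of a probabilistic straight-line program over integer registers. The first
argument `d` is the register written, `a` and `b` are the registers read. Results of arithmetic are
reduced modulo the hard-wired number `m + 1`; `rand d m` draws a uniform element of `{0, …, m}`. -/
inductive Instr
  | const (d : ℕ) (c : ℤ)
  | add (d a b m : ℕ)
  | sub (d a b m : ℕ)
  | mul (d a b m : ℕ)
  | div (d a b m : ℕ)
  | le (d a b : ℕ)
  | rand (d m : ℕ)

/-- Cost of an instruction: one plus the bit length of its hard-wired constant. -/
def Instr.cost : Instr → ℕ
  | .const _ c => 1 + Nat.size c.natAbs
  | .add _ _ _ m => 1 + Nat.size m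
  | .sub _ _ _ m => 1 + Nat.size m
  | .mul _ _ _ m => 1 + Nat.size m
  | .div _ _ _ m => 1 + Nat.size m
  | .le _ _ _ => 1
  | .rand _ m => 1 + Nat.size m

/-- Effect of an instruction on the register contents. -/
noncomputable def Instr.exec (r : ℕ → ℤ) : Instr → PMF (ℕ → ℤ)
  | .const d c => pure (Function.update r d c)
  | .add d a b m => pure (Function.update r d ((r a + r b) % (m + 1)))
  | .sub d a b m => pure (Function.update r d ((r a - r b) % (m + 1)))
  | .mul d a b m => pure (Function.update r d ((r a * r b) % (m + 1)))
  | .div d a b m => pure (Function.update r d ((r a / r b) % (m + 1)))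
  | .le d a b => pure (Function.update r d (if r a ≤ r b then 1 else 0))
  | .rand d m => do
      let u ← PMF.uniformOfFintype (Fin (m + 1))
      pure (Function.update r d ((u : ℕ) : ℤ))

/-- A probabilistic circuit: a straight-line program and the list of its output registers. Since
all intermediate numbers are bounded by the inputs and the hard-wired constants, families of
circuits of polynomial size are exactly the non-uniform probabilistic polynomial-time algorithms. -/
structure Circuit where
  prog : List Instr
  out : List ℕ

def Circuit.size (C : Circuit) : ℕ := (C.prog.map Instr.cost).sum + C.out.length

/-- The output distribution of a circuit; the input is loaded in registers `0, 1, 2, …`. -/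
noncomputable def Circuit.run (C : Circuit) (l : List ℤ) : PMF (List ℤ) := do
  let r ← C.prog.foldlM (fun r i => i.exec r) (fun i => l.getD i 0)
  pure (C.out.map r)

/-- Probability that an output string begins with `1`. -/
noncomputable def probOne (p : PMF (List ℤ)) : ℝ :=
  (p.toOuterMeasure {o | o.head? = some 1}).toReal

/-- Probability that the circuit `D`, run as a distinguisher on a sample of `p`, answers `1`. -/
noncomputable def acceptProb (D : Circuit) (p : PMF (List ℤ)) : ℝ := probOne (p.bind D.run)

/-- A family of probabilistic polynomial-size circuits. -/
def PPT (C : ℕ → Circuit) : Prop := PolyBounded fun k => (C k).size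

/-- Computational indistinguishability of two ensembles of integer strings. -/
def CompIndist (p p' : ℕ → PMF (List ℤ)) : Prop :=
  ∀ D : ℕ → Circuit, PPT D →
    Negligible fun k => |acceptProb (D k) (p k) - acceptProb (D k) (p' k)|

/-- Data that are written out as integer strings. -/
class Ser (α : Type) where
  ser : α → List ℤ

instance : Ser ℤ := ⟨fun x => [x]⟩
instance (m : ℕ) : Ser (Fin m) := ⟨fun x => [((x : ℕ) : ℤ)]⟩
instance (α β : Type) [Ser α] [Ser β] : Ser (α × β) := ⟨fun x => Ser.ser x.1 ++ Ser.ser x.2⟩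
instance (n : ℕ) (α : Type) [Ser α] : Ser (Fin n → α) :=
  ⟨fun f => (List.finRange n).flatMap fun i => Ser.ser (f i)⟩

/-! Arithmetic in `ℤ[X] / (X ^ n + 1)`, in coefficient representation. -/

abbrev Poly (n : ℕ) := Fin n → ℤ

/-- Reduction of all coefficients to `{0, …, Q - 1}`. -/
def red {n : ℕ} (Q : ℕ) (a : Poly n) : Poly n := fun k => a k % Q

/-- Negacyclic convolution: the product modulo `X ^ n + 1`. -/
def pmul {n : ℕ} (a b : Poly n) : Poly n := fun k =>
  ∑ i : Fin n, ∑ j : Fin n,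
    if (i : ℕ) + j = k then a i * b j else if (i : ℕ) + j = k + n then -(a i * b j) else 0

/-- The automorphism `X ↦ X ^ g`, for odd `g`. -/
def autom {n : ℕ} (g : ℕ) (a : Poly n) : Poly n := fun k =>
  ∑ i : Fin n,
    if (i * g) % (2 * n) = k then a i else if (i * g) % (2 * n) = k + n then -(a i) else 0

/-- The integer nearest to `a / b`. -/
def rdiv (a b : ℤ) : ℤ := (2 * a + b) / (2 * b)

/-! The multiparty CKKS cryptosystem. -/

/-- Public parameters. The ring degree is `2 ^ logDeg`; the ciphertext modulus at level `l` is
`q 0 * ⋯ * q l`; `scale` is the initial scale. Switching keys use the gadget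
`(1, base, base ^ 2, …)` of length `digits`. Encryption and key errors are sampled by inversion of
a cumulative table: with `u` uniform in `{0, …, errCoin}` the error is `errOff` plus the number of
thresholds in `errThr` that are at most `u` (for instance a truncated discrete Gaussian).
`smudge t` bounds the uniform smudging errors of a distributed operation that is step `t` of a
protocol (they have to be chosen according to the noise of the ciphertext), `mask` bounds the
uniform bootstrapping masks, and `prec` is the number of fractional bits used when a scale is
adjusted. -/
structure Params where
  logDeg : ℕ
  logDeg_pos : 1 ≤ logDeg
  levels : ℕ
  q : ℕ → ℕ
  prime_q : ∀ i ≤ levels, (q i).Prime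
  q_inj : ∀ i ≤ levels, ∀ j ≤ levels, q i = q j → i = j
  scale : ℕ
  scale_pos : 0 < scale
  base : ℕ
  two_le_base : 2 ≤ base
  digits : ℕ
  digits_large : ∏ i ∈ Finset.range (levels + 1), q i ≤ base ^ digits
  errCoin : ℕ
  errThr : List ℕ
  errOff : ℤ
  smudge : ℕ → ℕ
  smudge_le : ∀ t, smudge t ≤ ∏ i ∈ Finset.range (levels + 1), q i
  mask : ℕ
  prec : ℕ

namespace Params

variable (pp : Params)

/-- The degree of the ring. -/
def deg : ℕ := 2 ^ pp.logDeg

/-- The number of plaintext slots. -/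
def slots : ℕ := 2 ^ (pp.logDeg - 1)

/-- The ciphertext modulus at level `l`. -/
def Q (l : ℕ) : ℕ := ∏ i ∈ Finset.range (l + 1), pp.q i

/-- The modulus of fresh ciphertexts and of keys. -/
def Qmax : ℕ := pp.Q pp.levels

theorem slots_pos : 0 < pp.slots := Nat.two_pow_pos _

/-- Length of the description of the parameters, with the ring degree counted in unary. -/
def size : ℕ :=
  pp.deg + pp.levels + Nat.size pp.Qmax + Nat.size pp.scale + Nat.size pp.base + pp.digits
    + Nat.size pp.errCoin + pp.errThr.length + Nat.size pp.errOff.natAbs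
    + Nat.size pp.mask + pp.prec

end Params

section Crypto

variable (pp : Params)

abbrev RPoly := Poly pp.deg

/-- Ciphertexts and public keys: pairs of ring elements. -/
abbrev Ct := RPoly pp × RPoly pp

/-- A vector of plaintext values; only the first `pp.slots` entries are used. -/
abbrev Slots := ℕ → ℝ

/-- Encoding with scale `s`: the rounded inverse canonical embedding, for the slot `j` evaluated
at the root of unity `exp (iπ 5 ^ j / deg)`. -/
noncomputable def ecd (v : Slots) (s : ℚ) : RPoly pp := fun k =>
  round ((s : ℝ) * (2 / (pp.deg : ℝ)) *
    ∑ j ∈ Finset.range pp.slots,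
      v j * Real.cos (Real.pi * (5 : ℝ) ^ j * ((k : ℕ) : ℝ) / (pp.deg : ℝ)))

/-! Coins, all uniform on finite sets, and the ring elements they determine. -/

/-- Coins of a uniform ternary polynomial. -/
abbrev TerCoins := Fin pp.deg → Fin 3
/-- Coins of an error polynomial. -/
abbrev ErrCoins := Fin pp.deg → Fin (pp.errCoin + 1)
/-- Coins of a uniform polynomial modulo `pp.Qmax`. -/
abbrev UniCoins := Fin pp.deg → Fin (pp.Qmax - 1 + 1)
/-- Coins of a polynomial with independent coefficients uniform in `{-b, …, b}`. -/
abbrev BddCoins (b : ℕ) := Fin pp.deg → Fin (2 * b + 1)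

variable {pp}

def ter (u : TerCoins pp) : RPoly pp := fun k => ((u k : ℕ) : ℤ) - 1

def err (u : ErrCoins pp) : RPoly pp := fun k =>
  pp.errOff + ((pp.errThr.countP fun t => decide (t ≤ (u k : ℕ)) : ℕ) : ℤ)

def uni (u : UniCoins pp) : RPoly pp := fun k => ((u k : ℕ) : ℤ)

def bdd {b : ℕ} (u : BddCoins pp b) : RPoly pp := fun k => ((u k : ℕ) : ℤ) - b

variable (pp)

/-- The common random string: one uniform polynomial for the encryption key, and one for each
gadget component of the relinearization key and of each rotation key. -/
abbrev CRS :=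
  UniCoins pp × (Fin pp.digits → UniCoins pp) × (Fin pp.slots → Fin pp.digits → UniCoins pp)

/-- Coins of one user for key generation: secret key share, ephemeral secret of the
relinearization key protocol, error of the encryption key share, the four errors per gadget
component in the relinearization key protocol, and the errors of the rotation key shares. -/
abbrev KeyCoins :=
  TerCoins pp × TerCoins pp × ErrCoins pp × (Fin 4 → Fin pp.digits → ErrCoins pp) ×
    (Fin pp.slots → Fin pp.digits → ErrCoins pp)

/-- Coins of the complete key generation of `N` users. -/
abbrev KeyRand (N : ℕ) := CRS pp × (Fin N → KeyCoins pp)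

variable {pp}

/-- The secret key share of a user (`SecKeyGen`). -/
def KeyCoins.sk (c : KeyCoins pp) : RPoly pp := ter c.1

/-- Share of the collective encryption key. -/
def encKeyShare (crs : CRS pp) (c : KeyCoins pp) : RPoly pp :=
  red pp.Qmax (-(pmul (uni crs.1) (KeyCoins.sk c)) + err c.2.2.1)

/-- Share of the first round of the relinearization key protocol. -/
def rlkShare₁ (crs : CRS pp) (c : KeyCoins pp) (t : Fin pp.digits) : Ct pp :=
  (red pp.Qmax (-(pmul (ter c.2.1) (uni (crs.2.1 t)))
      + (fun k => (pp.base : ℤ) ^ (t : ℕ) * KeyCoins.sk c k) + err (c.2.2.2.1 0 t)),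
    red pp.Qmax (pmul (KeyCoins.sk c) (uni (crs.2.1 t)) + err (c.2.2.2.1 1 t)))

/-- Aggregate of the first round of the relinearization key protocol. -/
def rlkSum₁ {N : ℕ} (w : KeyRand pp N) (t : Fin pp.digits) : Ct pp :=
  (red pp.Qmax (∑ i, (rlkShare₁ w.1 (w.2 i) t).1),
    red pp.Qmax (∑ i, (rlkShare₁ w.1 (w.2 i) t).2))

/-- Share of the second round of the relinearization key protocol. -/
def rlkShare₂ {N : ℕ} (w : KeyRand pp N) (i : Fin N) (t : Fin pp.digits) : Ct pp :=
  (red pp.Qmax (pmul (KeyCoins.sk (w.2 i)) (rlkSum₁ w t).1 + err ((w.2 i).2.2.2.1 2 t)),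
    red pp.Qmax (pmul (ter (w.2 i).2.1 - KeyCoins.sk (w.2 i)) (rlkSum₁ w t).2
      + err ((w.2 i).2.2.2.1 3 t)))

/-- Share of the key for the rotation by `k` slots. -/
def rotKeyShare (crs : CRS pp) (c : KeyCoins pp) (k : Fin pp.slots) (t : Fin pp.digits) :
    RPoly pp :=
  red pp.Qmax (-(pmul (uni (crs.2.2 k t)) (KeyCoins.sk c))
    + (fun l => (pp.base : ℤ) ^ (t : ℕ) * autom (5 ^ (k : ℕ)) (KeyCoins.sk c) l)
    + err (c.2.2.2.2 k t))

variable (pp)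

/-- A collective public key: encryption key, relinearization key, rotation keys. -/
structure PubKey where
  enc : Ct pp
  rlk : Fin pp.digits → Ct pp
  rot : Fin pp.slots → Fin pp.digits → Ct pp

variable {pp}

/-- The collective public key produced by the users (`DKeyGen`). -/
def pubKey {N : ℕ} (w : KeyRand pp N) : PubKey pp where
  enc := (red pp.Qmax (∑ i, encKeyShare w.1 (w.2 i)), uni w.1.1)
  rlk t := (red pp.Qmax (∑ i, ((rlkShare₂ w i t).1 + (rlkShare₂ w i t).2)), (rlkSum₁ w t).2)
  rot k t := (red pp.Qmax (∑ i, rotKeyShare w.1 (w.2 i) k t), uni (w.1.2.2 k t))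

/-- The collective secret key `∑ skᵢ`, which no party holds. -/
def secKey {N : ℕ} (w : KeyRand pp N) : RPoly pp := ∑ i, KeyCoins.sk (w.2 i)

/-- What the users in `A` see of the key generation: the common random string, all broadcast
shares, and their own coins (hence their secret key shares). -/
def keyView {N : ℕ} (w : KeyRand pp N) (A : Finset (Fin N)) : List ℤ :=
  Ser.ser w.1 ++ Ser.ser (fun i => encKeyShare w.1 (w.2 i))
    ++ Ser.ser (fun i t => rlkShare₁ w.1 (w.2 i) t)
    ++ Ser.ser (fun i t => rlkShare₂ w i t)
    ++ Ser.ser (fun i k t => rotKeyShare w.1 (w.2 i) k t)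
    ++ (List.finRange N).flatMap fun i => if i ∈ A then Ser.ser (w.2 i) else []

variable (pp)

/-- Coins of an encryption. -/
abbrev EncCoins := TerCoins pp × ErrCoins pp × ErrCoins pp

variable {pp}

/-- Encryption of the encoded plaintext `m` under the encryption key `p`, modulo `Q`. -/
def enc (Q : ℕ) (p : Ct pp) (m : RPoly pp) (r : EncCoins pp) : Ct pp :=
  (red Q (pmul p.1 (ter r.1) + err r.2.1 + m), red Q (pmul p.2 (ter r.1) + err r.2.2))

/-- Decryption of a ciphertext modulo `Q` under `s`, with centered coefficients. -/
def dec (Q : ℕ) (s : RPoly pp) (c : Ct pp) : RPoly pp := fun k =>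
  Int.bmod ((c.1 + pmul c.2 s) k) Q

/-- Base-`base` digit `t` of each coefficient. -/
def digit (t : Fin pp.digits) (a : RPoly pp) : RPoly pp := fun k =>
  a k / (pp.base : ℤ) ^ (t : ℕ) % pp.base

/-- Gadget product of a polynomial with a switching key. -/
def gadgetMul (a : RPoly pp) (K : Fin pp.digits → Ct pp) : Ct pp :=
  (∑ t, pmul (digit t a) (K t).1, ∑ t, pmul (digit t a) (K t).2)

/-- Level and scale of a ciphertext: public data that do not depend on the ciphertext itself. -/
structure Meta where
  lvl : ℕ
  scale : ℚ

/-- Local homomorphic operations; arguments are positions in the list of existing ciphertexts.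
`pt` is the trivial ciphertext of a public plaintext. -/
inductive LocalOp
  | pt (u : Slots)
  | add (a b : ℕ)
  | sub (a b : ℕ)
  | mulPt (a : ℕ) (u : Slots)
  | mulCt (a b : ℕ)
  | rot (a k : ℕ)
  | rs (a : ℕ)

variable (pp)

def getMeta (ms : List Meta) (a : ℕ) : Meta := ms.getD a ⟨0, 0⟩

def getCt (cs : List (Ct pp)) (a : ℕ) : Ct pp := cs.getD a (0, 0)

def getVal (vs : List Slots) (a : ℕ) : Slots := vs.getD a (fun _ => 0)

/-- Level and scale after a local operation. -/
def LocalOp.info (ms : List Meta) : LocalOp → Meta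
  | .pt _ => ⟨pp.levels, pp.scale⟩
  | .add a b | .sub a b =>
      ⟨min (getMeta ms a).lvl (getMeta ms b).lvl, max (getMeta ms a).scale (getMeta ms b).scale⟩
  | .mulPt a _ => ⟨(getMeta ms a).lvl, (getMeta ms a).scale * pp.scale⟩
  | .mulCt a b =>
      ⟨min (getMeta ms a).lvl (getMeta ms b).lvl, (getMeta ms a).scale * (getMeta ms b).scale⟩
  | .rot a _ => getMeta ms a
  | .rs a =>
      if (getMeta ms a).lvl = 0 then getMeta ms a
      else ⟨(getMeta ms a).lvl - 1, (getMeta ms a).scale / pp.q (getMeta ms a).lvl⟩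

/-- Exact effect of a local operation on slot vectors. -/
def LocalOp.val (vs : List Slots) : LocalOp → Slots
  | .pt u => u
  | .add a b => fun j => getVal vs a j + getVal vs b j
  | .sub a b => fun j => getVal vs a j - getVal vs b j
  | .mulPt a u => fun j => getVal vs a j * u j
  | .mulCt a b => fun j => getVal vs a j * getVal vs b j
  | .rot a k => fun j => getVal vs a ((j + k) % pp.slots)
  | .rs a => getVal vs a

/-- The integer that lifts scale `s` to scale `s'` before an addition. -/
def align (s s' : ℚ) : ℤ := round (s' / s)

variable {pp}

/-- Effect of a local operation on ciphertexts. Before an addition or subtraction the operand of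
smaller scale is multiplied by the (rounded) quotient of the scales. -/
noncomputable def LocalOp.eval (K : PubKey pp) (ms : List Meta) (cs : List (Ct pp)) :
    LocalOp → Ct pp
  | .pt u => (red pp.Qmax (ecd pp u pp.scale), 0)
  | .add a b =>
      let o := LocalOp.info pp ms (.add a b)
      let c := align (getMeta ms a).scale o.scale • getCt pp cs a
        + align (getMeta ms b).scale o.scale • getCt pp cs b
      (red (pp.Q o.lvl) c.1, red (pp.Q o.lvl) c.2)
  | .sub a b =>
      let o := LocalOp.info pp ms (.sub a b)
      let c := align (getMeta ms a).scale o.scale • getCt pp cs a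
        - align (getMeta ms b).scale o.scale • getCt pp cs b
      (red (pp.Q o.lvl) c.1, red (pp.Q o.lvl) c.2)
  | .mulPt a u =>
      let Q := pp.Q (getMeta ms a).lvl
      let m := ecd pp u pp.scale
      (red Q (pmul (getCt pp cs a).1 m), red Q (pmul (getCt pp cs a).2 m))
  | .mulCt a b =>
      let Q := pp.Q (min (getMeta ms a).lvl (getMeta ms b).lvl)
      let x := getCt pp cs a
      let y := getCt pp cs b
      let g := gadgetMul (red Q (pmul x.2 y.2)) K.rlk
      (red Q (pmul x.1 y.1 + g.1), red Q (pmul x.1 y.2 + pmul x.2 y.1 + g.2))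
  | .rot a k =>
      let Q := pp.Q (getMeta ms a).lvl
      let i : Fin pp.slots := ⟨k % pp.slots, Nat.mod_lt _ pp.slots_pos⟩
      let x := getCt pp cs a
      let g := gadgetMul (red Q (autom (5 ^ (i : ℕ)) x.2)) (K.rot i)
      (red Q (autom (5 ^ (i : ℕ)) x.1 + g.1), red Q g.2)
  | .rs a =>
      let l := (getMeta ms a).lvl
      let x := getCt pp cs a
      if l = 0 then x
      else (red (pp.Q (l - 1)) fun k => rdiv (x.1 k) (pp.q l),
        red (pp.Q (l - 1)) fun k => rdiv (x.2 k) (pp.q l))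

variable (pp)

/-- Coins of one user in `DBootstrap` as step `t` of a protocol: mask, smudging error, coins of the
encryption of the mask. -/
abbrev BootCoins (t : ℕ) := BddCoins pp pp.mask × BddCoins pp (pp.smudge t) × EncCoins pp

/-- Coins of one user in `DKeySwitch` as step `t` of a protocol: smudging error, coins of the
encryption. -/
abbrev SwitchCoins (t : ℕ) := BddCoins pp (pp.smudge t) × EncCoins pp

variable {pp}

/-- Multiplication by `initial scale / s`, with `pp.prec` fractional bits and rounding. -/
def rescale (pp : Params) (s : ℚ) (x : RPoly pp) : RPoly pp := fun k =>
  rdiv (round ((pp.scale : ℚ) / s * 2 ^ pp.prec) * x k) (2 ^ pp.prec)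

/-- Share of a user in `DBootstrap` of a ciphertext `c` at level and scale `d`: a masked and
smudged partial decryption, and an encryption of the rescaled mask. -/
def bootShare {t : ℕ} (K : PubKey pp) (d : Meta) (c : Ct pp) (sk : RPoly pp)
    (r : BootCoins pp t) : RPoly pp × Ct pp :=
  (red (pp.Q d.lvl) (pmul c.2 sk - bdd r.1 + bdd r.2.1),
    enc pp.Qmax K.enc (rescale pp d.scale (bdd r.1)) r.2.2)

/-- Output of `DBootstrap`: the masked plaintext is opened, lifted to the initial modulus and
scale, and the masks are removed homomorphically. -/
def bootOut {N : ℕ} (d : Meta) (c : Ct pp) (h : Fin N → RPoly pp × Ct pp) : Ct pp :=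
  let m : RPoly pp := fun k => Int.bmod ((c.1 + ∑ i, (h i).1) k) (pp.Q d.lvl)
  (red pp.Qmax (rescale pp d.scale m + ∑ i, (h i).2.1), red pp.Qmax (∑ i, (h i).2.2))

/-- Share of a user in `DKeySwitch` to the key `p`: a smudged partial decryption encrypted
under `p`. -/
def switchShare {t : ℕ} (p : Ct pp) (d : Meta) (c : Ct pp) (sk : RPoly pp)
    (r : SwitchCoins pp t) : Ct pp :=
  enc (pp.Q d.lvl) p (pmul c.2 sk + bdd r.1) r.2

/-- Output of `DKeySwitch`: a ciphertext under the new key. -/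
def switchOut {N : ℕ} (d : Meta) (c : Ct pp) (h : Fin N → Ct pp) : Ct pp :=
  (red (pp.Q d.lvl) (c.1 + ∑ i, (h i).1), red (pp.Q d.lvl) (∑ i, (h i).2))

/-! Security of the cryptosystem under collusion of all users but one. -/

/-- The chosen-plaintext game against the honest user `h`, all other users colluding. After the key
generation `C₁` outputs a string whose first `deg` entries and next `deg` entries are two plaintext
polynomials; `C₂` then receives the encryption of the first or the second one, according to `b`. -/
noncomputable def cpaGame (pp : Params) (N : ℕ) (h : Fin N) (b : Bool) (C₁ C₂ : Circuit) :
    PMF (List ℤ) := do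
  let w ← PMF.uniformOfFintype (KeyRand pp N)
  let v := keyView w (Finset.univ.erase h)
  let st ← C₁.run v
  let m : RPoly pp := fun k => st.getD ((k : ℕ) + if b then pp.deg else 0) 0
  let r ← PMF.uniformOfFintype (EncCoins pp)
  C₂.run (v ++ st ++ Ser.ser (enc pp.Qmax (pubKey w).enc m r))

/-- CPA security even if all users but one collude. -/
def CPASecure (pp : ℕ → Params) (N : ℕ → ℕ) : Prop :=
  ∀ (h : ∀ k, Fin (N k)) (C₁ C₂ : ℕ → Circuit), PPT C₁ → PPT C₂ →
    Negligible fun k =>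
      |probOne (cpaGame (pp k) (N k) (h k) false (C₁ k) (C₂ k))
        - probOne (cpaGame (pp k) (N k) (h k) true (C₁ k) (C₂ k))|

end Crypto

/-! Protocols over the cryptosystem: straight-line sequences of steps on a common list of
ciphertexts, each step appending one ciphertext. -/

section Protocol

variable (pp : Params) (N : ℕ)

/-- The parties: the server `none` and the users. -/
abbrev Party := Option (Fin N)

/-- `input p j`: party `p` encodes and encrypts its input `j`. `op`: a local operation.
`send`: a ciphertext is transmitted. `boot`, `keySwitch`: the users jointly run `DBootstrap`, or
`DKeySwitch` to the server's key. -/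
inductive Step
  | input (p : Party N) (j : ℕ)
  | op (o : LocalOp)
  | send (a : ℕ)
  | boot (a : ℕ)
  | keySwitch (a : ℕ)

variable {N}

/-- Levels and scales of all ciphertexts of a protocol. -/
def metas (P : List (Step N)) : List Meta :=
  P.foldl (fun ms s => ms ++ [match s with
    | .input _ _ => ⟨pp.levels, pp.scale⟩
    | .op o => LocalOp.info pp ms o
    | .send a => getMeta ms a
    | .boot _ => ⟨pp.levels, pp.scale⟩
    | .keySwitch a => getMeta ms a]) []

/-- The exact values that the ciphertexts of a protocol stand for, on inputs `x`: the same
computation in the clear, without encoding errors and noise. -/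
def vals (x : Party N → ℕ → Slots) (P : List (Step N)) : List Slots :=
  P.foldl (fun vs s => vs ++ [match s with
    | .input p j => x p j
    | .op o => LocalOp.val pp vs o
    | .send a => getVal vs a
    | .boot a => getVal vs a
    | .keySwitch a => getVal vs a]) []

variable (N)

/-- What happens in an execution: coins used by the parties, and messages transmitted. -/
inductive Event
  | enc (p : Party N) (r : EncCoins pp)
  | msg (c : Ct pp)
  | boot (t : ℕ) (r : Fin N → BootCoins pp t) (h : Fin N → RPoly pp × Ct pp)
  | keySwitch (t : ℕ) (r : Fin N → SwitchCoins pp t) (h : Fin N → Ct pp)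

/-- State of an execution. -/
structure State where
  infos : List Meta
  cts : List (Ct pp)
  trace : List (Event pp N)

variable {pp N}

/-- Append a ciphertext with its level and scale, and the events of the step. -/
def State.push (st : State pp N) (d : Meta) (c : Ct pp) (e : List (Event pp N)) : State pp N :=
  ⟨st.infos ++ [d], st.cts ++ [c], st.trace ++ e⟩

/-- Execution of one step: `w` are the coins of the users' key generation, `p'` is the server's
encryption key, `x` the inputs of the parties. -/
noncomputable def runStep (w : KeyRand pp N) (p' : Ct pp) (x : Party N → ℕ → Slots)
    (st : State pp N) : Step N → PMF (State pp N)
  | .input p j => do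
      let r ← PMF.uniformOfFintype (EncCoins pp)
      pure (st.push ⟨pp.levels, pp.scale⟩
        (enc pp.Qmax (pubKey w).enc (ecd pp (x p j) pp.scale) r) [.enc p r])
  | .op o => pure (st.push (LocalOp.info pp st.infos o) (o.eval (pubKey w) st.infos st.cts) [])
  | .send a => pure (st.push (getMeta st.infos a) (getCt pp st.cts a) [.msg (getCt pp st.cts a)])
  | .boot a => do
      let d := getMeta st.infos a
      let c := getCt pp st.cts a
      let t := st.cts.length
      let r ← PMF.uniformOfFintype (Fin N → BootCoins pp t)
      let h := fun i => bootShare (pubKey w) d c (KeyCoins.sk (w.2 i)) (r i)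
      pure (st.push ⟨pp.levels, pp.scale⟩ (bootOut d c h) [.boot t r h])
  | .keySwitch a => do
      let d := getMeta st.infos a
      let c := getCt pp st.cts a
      let t := st.cts.length
      let r ← PMF.uniformOfFintype (Fin N → SwitchCoins pp t)
      let h := fun i => switchShare p' d c (KeyCoins.sk (w.2 i)) (r i)
      pure (st.push d (switchOut d c h) [.keySwitch t r h])

/-- Execution of a protocol. -/
noncomputable def exec (w : KeyRand pp N) (p' : Ct pp) (x : Party N → ℕ → Slots)
    (P : List (Step N)) : PMF (State pp N) :=
  P.foldlM (runStep w p' x) ⟨[], [], []⟩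

/-- What the colluding users `A`, together with the server if `srv`, see of an event: every
transmitted message, and their own coins. -/
def Event.view (A : Finset (Fin N)) (srv : Bool) : Event pp N → List ℤ
  | .enc none r => if srv then Ser.ser r else []
  | .enc (some i) r => if i ∈ A then Ser.ser r else []
  | .msg c => Ser.ser c
  | .boot _ r h => Ser.ser h ++ (List.finRange N).flatMap fun i => if i ∈ A then Ser.ser (r i) else []
  | .keySwitch _ r h =>
      Ser.ser h ++ (List.finRange N).flatMap fun i => if i ∈ A then Ser.ser (r i) else []

/-- The computation is accurate, and the parameters mask what the distributed operations open:
every ciphertext that enters a distributed operation decrypts to the encoding of the exact value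
up to a `δ` fraction of the range of the smudging errors, and the encodings of the values that are
bootstrapped are at most a `δ` fraction of the range of the masks, in every coefficient. Here `cts`
are the ciphertexts of an execution of `P` on inputs `x` under the secret key `s`. -/
def Accurate (δ : ℝ) (P : List (Step N)) (x : Party N → ℕ → Slots) (s : RPoly pp)
    (cts : List (Ct pp)) : Prop :=
  ∀ t a, (P[t]? = some (Step.boot a) ∨ P[t]? = some (Step.keySwitch a)) →
    let d := getMeta (metas pp (P.take t)) a
    let m := ecd pp (getVal (vals pp x (P.take t)) a) d.scale
    (∀ k, |((Int.bmod ((dec (pp.Q d.lvl) s (getCt pp (cts.take t) a) - m) k) (pp.Q d.lvl) : ℤ) : ℝ)|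
        ≤ δ * (2 * pp.smudge t + 1)) ∧
      (P[t]? = some (Step.boot a) → ∀ k, |((m k : ℤ) : ℝ)| ≤ δ * (2 * pp.mask + 1))

end Protocol

/-! The training protocol. -/

/-- Instructions of a straight-line polynomial circuit in one variable; arguments are positions in
the list of values computed so far, whose entry `0` is the variable. -/
inductive ActOp
  | const (c : ℝ)
  | scale (c : ℝ) (a : ℕ)
  | add (a b : ℕ)
  | sub (a b : ℕ)
  | mul (a b : ℕ)

/-- Training hyperparameters: number of layers, dimension of the (square, zero-padded) matrices,
number of global iterations, local batch size, learning rate, and circuits for the polynomial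
approximations of the activation function and of its derivative (the result of a circuit is the
last value computed). -/
structure Hyper where
  layers : ℕ
  dim : ℕ
  iters : ℕ
  batch : ℕ
  rate : ℝ
  act : List ActOp
  dact : List ActOp

def Hyper.size (hp : Hyper) : ℕ :=
  hp.layers + hp.dim + hp.iters + hp.batch + hp.act.length + hp.dact.length

section Training

variable (N : ℕ) (hp : Hyper)

/-- Programs that write down a protocol. -/
abbrev Build := StateM (List (Step N))

variable {N}

/-- Append a step; the result is the position of the new ciphertext. -/
def emit (s : Step N) : Build N ℕ := do
  let P ← get
  set (P ++ [s])
  pure P.length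

/-- Multiplication by a public vector, rescaled. -/
def mulPtRS (a : ℕ) (u : Slots) : Build N ℕ := do
  let c ← emit (.op (.mulPt a u))
  emit (.op (.rs c))

/-- Product of ciphertexts, rescaled. -/
def mulCtRS (a b : ℕ) : Build N ℕ := do
  let c ← emit (.op (.mulCt a b))
  emit (.op (.rs c))

/-- The `k`-th diagonal vector of the `n × n` matrix of `v ↦ (v (τ 0), …, v (τ (n - 1)))`,
repeated over all slots. -/
noncomputable def permDiag (n : ℕ) (τ : ℕ → ℕ) (k : ℕ) : Slots := fun j =>
  if (j % n + k) % n = τ (j % n) then 1 else 0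

/-- Homomorphic linear transformation by the permutation matrix of `τ`, as a sum of rotations
multiplied by diagonal vectors; vanishing diagonal vectors are skipped. -/
noncomputable def heLinTrans (n : ℕ) (c : ℕ) (τ : ℕ → ℕ) : Build N ℕ := do
  let c' ← mulPtRS c (permDiag n τ 0)
  (List.range (n - 1)).foldlM (fun c' k =>
    if ∃ l < n, (l + (k + 1)) % n = τ l then do
      let r ← emit (.op (.rot c (k + 1)))
      let r ← mulPtRS r (permDiag n τ (k + 1))
      emit (.op (.add c' r))
    else pure c') c'

/-- Homomorphic product of `h × h` matrices, stored row by row. -/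
noncomputable def heMatMult (h : ℕ) (a b : ℕ) : Build N ℕ := do
  let a₀ ← heLinTrans (h * h) a fun l => h * (l / h) + (l / h + l % h) % h
  let b₀ ← heLinTrans (h * h) b fun l => h * ((l / h + l % h) % h) + l % h
  let ab ← mulCtRS a₀ b₀
  (List.range (h - 1)).foldlM (fun ab k => do
    let aₖ ← heLinTrans (h * h) a₀ fun l => h * (l / h) + (l % h + (k + 1)) % h
    let bₖ ← heLinTrans (h * h) b₀ fun l => h * ((l / h + (k + 1)) % h) + l % h
    let p ← mulCtRS aₖ bₖ
    emit (.op (.add ab p))) ab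

/-- Homomorphic transposition. -/
noncomputable def heTranspose (h : ℕ) (a : ℕ) : Build N ℕ :=
  heLinTrans (h * h) a fun l => h * (l % h) + l / h

/-- Homomorphic evaluation of a polynomial circuit. -/
def evalAct (f : List ActOp) (c : ℕ) : Build N ℕ := do
  let rs ← f.foldlM (fun rs o => do
    let r ← match o with
      | .const u => emit (.op (.pt fun _ => u))
      | .scale u a => mulPtRS (rs.getD a 0) fun _ => u
      | .add a b => emit (.op (.add (rs.getD a 0) (rs.getD b 0)))
      | .sub a b => emit (.op (.sub (rs.getD a 0) (rs.getD b 0)))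
      | .mul a b => mulCtRS (rs.getD a 0) (rs.getD b 0)
    pure (rs ++ [r])) [c]
  pure (rs.getLastD c)

/-- Feedforward of user data `M₀` through the layers with encrypted weights `w`; the results are
the lists `E₁, E₂, …` and `M₀, M₁, …`. Each activation is bootstrapped by all users, for which its
ciphertext is transmitted. -/
noncomputable def feedforward (w : List ℕ) (M₀ : ℕ) : Build N (List ℕ × List ℕ) :=
  (List.range hp.layers).foldlM (fun (Es, Ms) j => do
    let E ← heMatMult hp.dim (w.getD j 0) (Ms.getD j 0)
    let M ← evalAct hp.act E
    let M ← emit (.send M)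
    let M ← emit (.boot M)
    pure (Es ++ [E], Ms ++ [M])) ([], [M₀])

/-- Backpropagation; the list `g` of accumulated gradients is updated. The layers (numbered from
`0` here) are treated from last to first. -/
noncomputable def backprop (w Es Ms : List ℕ) (Y : ℕ) (g : List ℕ) : Build N (List ℕ) := do
  let D ← emit (.op (.sub Y (Ms.getD hp.layers 0)))
  let L ← mulCtRS D D
  let (_, g) ← (List.range hp.layers).reverse.foldlM (fun (L, g) j => do
    let L ← if j + 1 < hp.layers then do
        let T ← heTranspose hp.dim (w.getD (j + 1) 0)
        heMatMult hp.dim L T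
      else pure L
    let F ← evalAct hp.dact (Es.getD j 0)
    let L ← mulCtRS F L
    let T ← heTranspose hp.dim (Ms.getD j 0)
    let p ← heMatMult hp.dim T L
    let s ← emit (.op (.add p (g.getD j 0)))
    pure (L, g.set j s)) (L, g)
  pure g

/-- Local gradients of user `i` in iteration `k`, over its mini-batch. Inputs `2 (k B + t)` and
`2 (k B + t) + 1` of a user are the sample and the label number `t` of its mini-batch in
iteration `k`. -/
noncomputable def localGradients (i : Fin N) (k : ℕ) (w : List ℕ) : Build N (List ℕ) := do
  let g ← (List.range hp.layers).mapM fun _ => emit (.op (.pt fun _ => 0))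
  (List.range hp.batch).foldlM (fun g t => do
    let X ← emit (.input (some i) (2 * (k * hp.batch + t)))
    let Y ← emit (.input (some i) (2 * (k * hp.batch + t) + 1))
    let (Es, Ms) ← feedforward hp w X
    backprop hp w Es Ms Y g) g

/-- One global iteration: local training by all users, who send their encrypted gradients to the
server; the server aggregates them, updates the weights and broadcasts them. -/
noncomputable def iteration (w : List ℕ) (k : ℕ) : Build N (List ℕ) := do
  let gs ← (List.finRange N).mapM fun i => do
    let g ← localGradients hp i k w
    g.mapM fun c => emit (.send c)
  (List.range hp.layers).mapM fun j => do
    let z ← emit (.op (.pt fun _ => 0))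
    let s ← gs.foldlM (fun s g => emit (.op (.add s (g.getD j 0)))) z
    let u ← mulPtRS s fun _ => hp.rate / (hp.batch * N)
    let c ← emit (.op (.sub (w.getD j 0) u))
    emit (.send c)

/-- The whole protocol after key generation: the server encrypts and broadcasts the initial
weights (its inputs), the model is trained, and the final weights are switched to the server's
key. -/
noncomputable def training : Build N (List ℕ) := do
  let w ← (List.range hp.layers).mapM fun j => do
    let c ← emit (.input none j)
    emit (.send c)
  let w ← (List.range hp.iters).foldlM (iteration hp) w
  w.mapM fun c => emit (.keySwitch c)

variable (N)

/-- The steps of the training protocol. -/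
noncomputable def trainingSteps : List (Step N) := (Id.run ((training hp).run [])).2

end Training

/-! Real and ideal world. -/

section Privacy

variable (pp : Params) (N : ℕ) (hp : Hyper)

/-- The inputs of the colluding parties, encoded. -/
noncomputable def corruptInputs (A : Finset (Fin N)) (srv : Bool) (x : Party N → ℕ → Slots) :
    List ℤ :=
  ((List.finRange N).flatMap fun i => if i ∈ A then
    (List.range (2 * (hp.iters * hp.batch))).flatMap fun j =>
      Ser.ser (red pp.Qmax (ecd pp (x (some i) j) pp.scale)) else [])
  ++ if srv then (List.range hp.layers).flatMap fun j =>
      Ser.ser (red pp.Qmax (ecd pp (x none j) pp.scale)) else []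

/-- The server's output in the ideal world: the exact final weights, encoded. -/
noncomputable def idealOutput (x : Party N → ℕ → Slots) : List ℤ :=
  let P : List (Step N) := trainingSteps N hp
  (List.range P.length).flatMap fun t => match P[t]? with
    | some (Step.keySwitch a) =>
        let d := getMeta (metas pp (P.take t)) a
        Ser.ser (red (pp.Q d.lvl) (ecd pp (getVal (vals pp x (P.take t)) a) d.scale))
    | _ => []

/-- Coins of the users' key generation, coins of the server's key generation, and execution of the
training protocol. -/
noncomputable def realRun (x : Party N → ℕ → Slots) :
    PMF (KeyRand pp N × KeyRand pp 1 × State pp N) := do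
  let w ← PMF.uniformOfFintype (KeyRand pp N)
  let w' ← PMF.uniformOfFintype (KeyRand pp 1)
  let st ← exec w (pubKey w').enc x (trainingSteps N hp)
  pure (w, w', st)

/-- The view of the colluding users `A`, together with the server if `srv`, in a real execution:
their inputs and coins and all transmitted messages. -/
noncomputable def realView (A : Finset (Fin N)) (srv : Bool) (x : Party N → ℕ → Slots) :
    PMF (List ℤ) := do
  let (w, w', st) ← realRun pp N hp x
  pure (corruptInputs pp N hp A srv x ++ keyView w A ++ Ser.ser (pubKey w').enc
    ++ (if srv then Ser.ser w' else []) ++ st.trace.flatMap (Event.view A srv))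

/-- What the simulator receives: the inputs of the colluding parties and, if the server is among
them, the server's output. Users have no output. -/
noncomputable def simInput (A : Finset (Fin N)) (srv : Bool) (x : Party N → ℕ → Slots) :
    List ℤ :=
  corruptInputs pp N hp A srv x ++ if srv then idealOutput pp N hp x else []

/-- Probability that the training on inputs `x` is not accurate. -/
noncomputable def failProb (δ : ℝ) (x : Party N → ℕ → Slots) : ℝ :=
  ((realRun pp N hp x).toOuterMeasure
    {z | ¬ Accurate δ (trainingSteps N hp) x (secKey z.1) z.2.2.cts}).toReal

end Privacy

/-- Simulation-based privacy against the users in `A`, colluding with the server if `srv`: there is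
a probabilistic polynomial-size simulator that, for all inputs of the parties on which the
training is accurate, turns the inputs and outputs of the colluding parties into a view that is
indistinguishable from the real one. -/
def Private (pp : ℕ → Params) (N : ℕ → ℕ) (hp : ℕ → Hyper) (δ : ℕ → ℝ)
    (A : ∀ k, Finset (Fin (N k))) (srv : Bool) : Prop :=
  ∃ S : ℕ → Circuit, PPT S ∧
    ∀ x : ∀ k, Party (N k) → ℕ → Slots,
      (Negligible fun k => failProb (pp k) (N k) (hp k) (δ k) (x k)) →
      CompIndist (fun k => realView (pp k) (N k) (hp k) (A k) srv (x k))
        (fun k => (S k).run (simInput (pp k) (N k) (hp k) (A k) srv (x k)))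

end Hercules

/-!
The view of the colluding parties is simulated by running the whole protocol, key generation
included, on other plaintexts. One user `h` does not collude, and every secret of `h` enters the
view of the others only through ciphertexts and through the shares of the distributed operations.

*Statistical part.* An honest share of a distributed operation opens `c₁ skₕ` up to a uniform
smudging error. Since `c₁ skₕ` is the decryption of the ciphertext minus `c₀` and the partial
decryptions of the other users, and since the ciphertext decrypts to the exact value up to a `δ`
fraction of the range of the smudging errors, the share may be computed from the exact value
instead, at statistical distance `δ` per coefficient; the secret key share of `h` is then no longer
used by the distributed operations (`expect_realRun_le`). Executions that are not accurate cost the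
failure probability. In a bootstrapping the exact value is in turn covered by the mask of `h` and
may be replaced by `0`, once the mask is no longer tied to its encryption (`hybrid_simPlain_le`). In
a key switch to a server that does not collude only encryptions under the server's key are seen, and
in a key switch to a colluding server the exact value is the server's output, which the simulator is
given.

*Computational part.* What is left of the secrets of the honest parties is in encryptions under
the collective key or the server's key. They are replaced one step at a time
(`hybrid_le_of_forall_hidden`). The execution is written as a deterministic function of the coins
(`detRun`), one distinguished encryption per step can be overridden from outside, and the coins of
the step that the override makes superfluous can be resampled. Thus a distinguisher between two
neighbouring hybrids is an adversary in the chosen-plaintext game: its first circuit outputs the two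
plaintexts, its second one completes the execution around the challenge and runs the distinguisher
(`expect_detRun_le`).

*Efficiency.* Adversaries and simulator have to be circuits. `Impl` and `Reach` express that
quantities depending on a common parameter can be computed from given ones by a program of bounded
cost; all of key generation and of the protocol steps is followed through in these terms
(`KeySeen.of_coins`, `detRun_cx`, `exists_reach_view`), with one bound `b.s` for all dimensions and
one bound `b.M` for all moduli. The exact intermediate values are real numbers; their encodings are
hard-wired into the adversary of the reduction, never into the simulator (`exists_simulator`).

Since security holds for every family of adversaries, it holds uniformly for all circuits below a
given polynomial size bound (`CPASecure.uniform`), so that a polynomial number of hybrid steps loses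
a negligible amount in total.
-/

namespace Hercules

open scoped ENNReal

/-! ### Polynomially bounded and negligible functions -/

namespace PolyBounded

variable {f g : ℕ → ℕ}

theorem mono (hg : PolyBounded g) (h : ∀ k, f k ≤ g k) : PolyBounded f := by
  obtain ⟨p, hp⟩ := hg
  exact ⟨p, fun k => (h k).trans (hp k)⟩

theorem const (c : ℕ) : PolyBounded fun _ => c :=
  ⟨Polynomial.C c, fun k => by simp⟩

theorem add (hf : PolyBounded f) (hg : PolyBounded g) : PolyBounded fun k => f k + g k := by
  obtain ⟨p, hp⟩ := hf
  obtain ⟨q, hq⟩ := hg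
  exact ⟨p + q, fun k => by simpa using add_le_add (hp k) (hq k)⟩

theorem mul (hf : PolyBounded f) (hg : PolyBounded g) : PolyBounded fun k => f k * g k := by
  obtain ⟨p, hp⟩ := hf
  obtain ⟨q, hq⟩ := hg
  exact ⟨p * q, fun k => by simpa using Nat.mul_le_mul (hp k) (hq k)⟩

theorem pow (hf : PolyBounded f) (n : ℕ) : PolyBounded fun k => f k ^ n := by
  obtain ⟨p, hp⟩ := hf
  exact ⟨p ^ n, fun k => by simpa using Nat.pow_le_pow_left (hp k) n⟩

end PolyBounded

namespace Negligible

variable {f g : ℕ → ℝ}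

theorem mono (hg : Negligible g) (h0 : ∀ k, 0 ≤ f k) (h : ∀ k, f k ≤ g k) : Negligible f :=
  Asymptotics.SuperpolynomialDecay.trans_eventuallyLE
    (Filter.Eventually.of_forall fun k => Nat.cast_nonneg k)
    (Asymptotics.superpolynomialDecay_zero _ _) hg
    (Filter.Eventually.of_forall h0) (Filter.Eventually.of_forall h)

theorem add (hf : Negligible f) (hg : Negligible g) : Negligible fun k => f k + g k :=
  Asymptotics.SuperpolynomialDecay.add hf hg

theorem abs (hf : Negligible f) : Negligible fun k => |f k| :=
  (Asymptotics.superpolynomialDecay_iff_abs_tendsto_zero _ _ _).2 fun n => by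
    have := (Asymptotics.superpolynomialDecay_iff_abs_tendsto_zero _ _ f).1 hf n
    simpa only [abs_mul, abs_abs] using this

theorem polyBounded_mul {n : ℕ → ℕ} (hn : PolyBounded n) (hf : Negligible f) :
    Negligible fun k => n k * |f k| := by
  obtain ⟨p, hp⟩ := hn
  have h := Asymptotics.SuperpolynomialDecay.polynomial_mul hf.abs (p.map (Nat.castRingHom ℝ))
  refine mono h (fun k => by positivity) fun k => ?_
  have : ((p.map (Nat.castRingHom ℝ)).eval (k : ℝ)) = ((p.eval k : ℕ) : ℝ) := by
    rw [Polynomial.eval_natCast_map]; rfl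
  rw [this]
  exact mul_le_mul_of_nonneg_right (by exact_mod_cast hp k) (abs_nonneg _)

end Negligible

/-! ### Expectations over discrete distributions -/

/-- Expectation of a non-negative function under a discrete distribution. -/
noncomputable def expect {α : Type} (p : PMF α) (f : α → ℝ≥0∞) : ℝ≥0∞ := ∑' a, p a * f a

section Expect

variable {α β γ : Type}

theorem expect_pure (a : α) (f : α → ℝ≥0∞) : expect (PMF.pure a) f = f a := by
  rw [expect, tsum_eq_single a]
  · simp
  · intro b hb
    simp [PMF.pure_apply, hb]

theorem expect_bind (p : PMF α) (q : α → PMF β) (f : β → ℝ≥0∞) :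
    expect (p.bind q) f = expect p fun a => expect (q a) f := by
  simp only [expect, PMF.bind_apply, ← ENNReal.tsum_mul_left, ← ENNReal.tsum_mul_right]
  rw [ENNReal.tsum_comm]
  simp only [mul_assoc]

theorem expect_map (p : PMF α) (g : α → β) (f : β → ℝ≥0∞) :
    expect (p.map g) f = expect p fun a => f (g a) := by
  rw [PMF.map, expect_bind]
  simp only [Function.comp, expect_pure]

theorem expect_const (p : PMF α) (c : ℝ≥0∞) : expect p (fun _ => c) = c := by
  rw [expect, ENNReal.tsum_mul_right, PMF.tsum_coe, one_mul]

theorem expect_add (p : PMF α) (f g : α → ℝ≥0∞) :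
    expect p (fun a => f a + g a) = expect p f + expect p g := by
  simp only [expect, mul_add, ENNReal.tsum_add]

theorem expect_mono (p : PMF α) {f g : α → ℝ≥0∞} (h : ∀ a, f a ≤ g a) :
    expect p f ≤ expect p g :=
  ENNReal.tsum_le_tsum fun a => mul_le_mul_right (h a) _

theorem expect_mono_support (p : PMF α) {f g : α → ℝ≥0∞} (h : ∀ a ∈ p.support, f a ≤ g a) :
    expect p f ≤ expect p g := by
  refine ENNReal.tsum_le_tsum fun a => ?_
  by_cases ha : p a = 0
  · simp [ha]
  · exact mul_le_mul_right (h a ((PMF.mem_support_iff _ _).2 ha)) _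

theorem expect_le_one (p : PMF α) {f : α → ℝ≥0∞} (h : ∀ a, f a ≤ 1) : expect p f ≤ 1 :=
  (expect_mono p h).trans_eq (expect_const p 1)

theorem expect_le_expect_add (p : PMF α) {f g : α → ℝ≥0∞} {c : ℝ≥0∞}
    (h : ∀ a, f a ≤ g a + c) : expect p f ≤ expect p g + c := by
  calc expect p f ≤ expect p (fun a => g a + c) := expect_mono p h
    _ = _ := by rw [expect_add, expect_const]

theorem expect_comm (p : PMF α) (q : PMF β) (f : α → β → ℝ≥0∞) :
    (expect p fun a => expect q fun b => f a b) = expect q fun b => expect p fun a => f a b := by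
  simp only [expect, ← ENNReal.tsum_mul_left]
  rw [ENNReal.tsum_comm]
  simp only [mul_left_comm]

theorem expect_one_sub (p : PMF α) {f : α → ℝ≥0∞} (h : ∀ a, f a ≤ 1) :
    expect p (fun a => 1 - f a) = 1 - expect p f := by
  have h1 : expect p (fun a => 1 - f a) + expect p f = 1 := by
    rw [← expect_add]
    simp only [tsub_add_cancel_of_le (h _), expect_const]
  exact ENNReal.eq_sub_of_add_eq (ne_top_of_le_ne_top ENNReal.one_ne_top (expect_le_one p h)) h1

theorem expect_indicator (p : PMF α) (s : Set α) :
    expect p (s.indicator fun _ => 1) = p.toOuterMeasure s := by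
  rw [PMF.toOuterMeasure_apply, expect]
  refine tsum_congr fun a => ?_
  by_cases h : a ∈ s <;> simp [h]

theorem toOuterMeasure_bind (p : PMF α) (q : α → PMF β) (s : Set β) :
    (p.bind q).toOuterMeasure s = expect p fun a => (q a).toOuterMeasure s :=
  PMF.toOuterMeasure_bind_apply p q s

theorem toOuterMeasure_le_one (p : PMF α) (s : Set α) : p.toOuterMeasure s ≤ 1 := by
  rw [← expect_indicator]
  exact expect_le_one p fun a => by by_cases h : a ∈ s <;> simp [h]

end Expect

section Uniform

variable {α β : Type} [Fintype α] [Nonempty α] [Fintype β] [Nonempty β]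

theorem expect_uniform (f : α → ℝ≥0∞) :
    expect (PMF.uniformOfFintype α) f = (Fintype.card α : ℝ≥0∞)⁻¹ * ∑ a, f a := by
  simp only [expect, PMF.uniformOfFintype_apply, tsum_fintype, Finset.mul_sum]

theorem expect_uniform_equiv (e : α ≃ β) (f : β → ℝ≥0∞) :
    expect (PMF.uniformOfFintype α) (fun a => f (e a)) = expect (PMF.uniformOfFintype β) f := by
  rw [expect_uniform, expect_uniform, Fintype.card_congr e, Equiv.sum_comp e f]

theorem expect_uniform_prod (f : α × β → ℝ≥0∞) :
    expect (PMF.uniformOfFintype (α × β)) f =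
      expect (PMF.uniformOfFintype α) fun a => expect (PMF.uniformOfFintype β) fun b => f (a, b) := by
  simp only [expect_uniform, Fintype.card_prod, ← Finset.mul_sum, Fintype.sum_prod_type]
  rw [Nat.cast_mul, ENNReal.mul_inv (by simp) (by simp), mul_assoc]

theorem uniform_equiv (e : α ≃ β) :
    (PMF.uniformOfFintype α).map e = PMF.uniformOfFintype β := by
  ext b
  rw [PMF.map_apply, tsum_eq_single (e.symm b)]
  · simp [Fintype.card_congr e]
  · intro a ha
    rw [if_neg]
    rintro rfl
    simp at ha

theorem uniform_prod :
    PMF.uniformOfFintype (α × β) =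
      (PMF.uniformOfFintype α).bind fun a => (PMF.uniformOfFintype β).map fun b => (a, b) := by
  ext ⟨a, b⟩
  rw [PMF.bind_apply, tsum_eq_single a]
  · rw [PMF.map_apply, tsum_eq_single b]
    · simp [ENNReal.mul_inv]
    · intro b' hb
      simp [Ne.symm hb]
  · intro a' ha
    rw [PMF.map_apply]
    simp [Ne.symm ha]

/-- A coordinate of a uniform element is uniform. -/
def UniformCoord (π : α → β) : Prop :=
  (PMF.uniformOfFintype α).map π = PMF.uniformOfFintype β

theorem UniformCoord.comp {γ : Type} [Fintype γ] [Nonempty γ] {π : α → β} {ρ : β → γ}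
    (hρ : UniformCoord ρ) (hπ : UniformCoord π) : UniformCoord fun a => ρ (π a) := by
  have := PMF.map_comp π (PMF.uniformOfFintype α) ρ
  unfold UniformCoord at *
  rw [hπ, hρ] at this
  exact this.symm

theorem uniformCoord_fst : UniformCoord (Prod.fst : α × β → α) := by
  unfold UniformCoord
  rw [uniform_prod, PMF.map_bind]
  simp only [PMF.map_comp, Function.comp_def]
  exact (congrArg _ (funext fun a => PMF.map_const _ a)).trans (PMF.bind_pure _)

theorem uniformCoord_snd : UniformCoord (Prod.snd : α × β → β) := by
  unfold UniformCoord
  rw [uniform_prod, PMF.map_bind]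
  simp only [PMF.map_comp, Function.comp_def]
  exact (PMF.bind_const _ _).trans (PMF.map_id _)

theorem uniformCoord_equiv (e : α ≃ β) : UniformCoord e := uniform_equiv e

theorem uniformCoord_eval {n : ℕ} (i : Fin n) :
    UniformCoord fun f : Fin n → α => f i := by
  have h := (uniformCoord_fst (α := α) (β := {j // j ≠ i} → α)).comp
    (uniformCoord_equiv (Equiv.funSplitAt i α))
  exact h

theorem expect_uniform_shift (e : α ≃ α) (bad : Set α) {f g : α → ℝ≥0∞} (hf : ∀ a, f a ≤ 1)
    (h : ∀ a ∉ bad, f a = g (e a)) :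
    expect (PMF.uniformOfFintype α) f ≤
      expect (PMF.uniformOfFintype α) g + (PMF.uniformOfFintype α).toOuterMeasure bad := by
  rw [← expect_indicator, ← expect_uniform_equiv e g, ← expect_add]
  refine expect_mono _ fun a => ?_
  by_cases ha : a ∈ bad
  · simpa [ha] using le_add_left (hf a)
  · simp [ha, h a ha]

theorem UniformCoord.toOuterMeasure {π : α → β} (h : UniformCoord π) (s : Set β) :
    (PMF.uniformOfFintype α).toOuterMeasure {a | π a ∈ s} =
      (PMF.uniformOfFintype β).toOuterMeasure s := by
  rw [← h, PMF.toOuterMeasure_map_apply]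
  rfl

end Uniform

/-- Shifting a uniform element of `{0, …, n - 1}` by `v` leaves the range with probability at most
`|v| / n`. -/
theorem uniform_shift_range (m : ℕ) (v : ℤ) :
    (PMF.uniformOfFintype (Fin (m + 1))).toOuterMeasure
      {u | ¬ (0 ≤ ((u : ℕ) : ℤ) + v ∧ ((u : ℕ) : ℤ) + v < m + 1)} ≤
      ENNReal.ofReal (|(v : ℝ)| / (m + 1)) := by
  classical
  have hcard : (Finset.univ.filter fun u : Fin (m + 1) =>
      ¬ (0 ≤ ((u : ℕ) : ℤ) + v ∧ ((u : ℕ) : ℤ) + v < m + 1)).card ≤ v.natAbs := by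
    have h1 : ((Finset.univ.filter fun u : Fin (m + 1) =>
        ¬ (0 ≤ ((u : ℕ) : ℤ) + v ∧ ((u : ℕ) : ℤ) + v < m + 1)).image
          fun u : Fin (m + 1) => ((u : ℕ) : ℤ)) ⊆
        if 0 ≤ v then Finset.Ico ((m : ℤ) + 1 - v) (m + 1) else Finset.Ico 0 (-v) := by
      intro z hz
      simp only [Finset.mem_image, Finset.mem_filter, Finset.mem_univ, true_and] at hz
      obtain ⟨u, hu, rfl⟩ := hz
      have := u.2
      split_ifs with hv <;> simp only [Finset.mem_Ico] <;> omega
    have h2 := Finset.card_le_card h1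
    rw [Finset.card_image_of_injective _ (fun a b hab => Fin.ext (by exact_mod_cast hab))] at h2
    refine h2.trans ?_
    split_ifs with hv <;> simp only [Int.card_Ico] <;> omega
  rw [← expect_indicator, expect_uniform]
  have hsum : ∑ u : Fin (m + 1), ({u : Fin (m + 1) | ¬ (0 ≤ ((u : ℕ) : ℤ) + v ∧
      ((u : ℕ) : ℤ) + v < m + 1)}.indicator (fun _ => (1 : ℝ≥0∞)) u) ≤ (v.natAbs : ℝ≥0∞) := by
    simp only [Set.indicator_apply, Set.mem_ofPred_eq, Finset.sum_boole]
    exact_mod_cast hcard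
  refine (mul_le_mul_right hsum _).trans (le_of_eq ?_)
  have hv : |(v : ℝ)| = (v.natAbs : ℝ) := by rw [Nat.cast_natAbs]; push_cast; rfl
  rw [hv, ENNReal.ofReal_div_of_pos (by positivity), ENNReal.ofReal_natCast, Fintype.card_fin,
    ENNReal.div_eq_inv_mul]
  congr 2
  exact_mod_cast (ENNReal.ofReal_natCast (m + 1)).symm

/-- A vector of uniform elements of `{0, …, m}` hides a shift by `v`, up to the sum of the relative
sizes of the entries of `v`. The shift is realized by a cyclic shift `e`, which differs from the
shift by `v` only if an entry leaves its range. -/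
theorem expect_uniform_vector_shift {α : Type} [Fintype α] [Nonempty α] {d m : ℕ}
    {π : α → Fin d → Fin (m + 1)} (hπ : UniformCoord π) (e : α ≃ α) (v : Fin d → ℤ) (ε : ℝ)
    (hv : ∀ k, |(v k : ℝ)| ≤ ε * (m + 1)) {f g : α → ℝ≥0∞} (hf : ∀ a, f a ≤ 1)
    (h : ∀ a, (∀ k, 0 ≤ ((π a k : ℕ) : ℤ) + v k ∧ ((π a k : ℕ) : ℤ) + v k < m + 1) →
      f a = g (e a)) :
    expect (PMF.uniformOfFintype α) f ≤
      expect (PMF.uniformOfFintype α) g + d * ENNReal.ofReal ε := by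
  refine (expect_uniform_shift e
    (⋃ k, {a | ¬ (0 ≤ ((π a k : ℕ) : ℤ) + v k ∧ ((π a k : ℕ) : ℤ) + v k < m + 1)}) hf
    fun a ha => h a fun k => ?_).trans (add_le_add_right ?_ _)
  · by_contra hk
    exact ha (Set.mem_iUnion.2 ⟨k, hk⟩)
  · have hk : ∀ k, (PMF.uniformOfFintype α).toOuterMeasure
        {a | ¬ (0 ≤ ((π a k : ℕ) : ℤ) + v k ∧ ((π a k : ℕ) : ℤ) + v k < m + 1)} ≤
          ENNReal.ofReal ε := fun k => by
      have hc : UniformCoord fun a => π a k := (uniformCoord_eval k).comp hπ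
      refine (le_of_eq (hc.toOuterMeasure
        {u | ¬ (0 ≤ ((u : ℕ) : ℤ) + v k ∧ ((u : ℕ) : ℤ) + v k < m + 1)})).trans ?_
      refine (uniform_shift_range m (v k)).trans (ENNReal.ofReal_le_ofReal ?_)
      rw [div_le_iff₀ (by positivity)]
      exact hv k
    refine (MeasureTheory.measure_iUnion_fintype_le _ _).trans ?_
    refine (Finset.sum_le_sum fun k _ => hk k).trans ?_
    simp

/-! ### Replacing the steps of a process one by one -/

/-- If the steps `κ` and `κ'` of two processes, whose states are related by `φ`, are `ε`-close at
all good states, the processes are close up to the probability that the first one meets a state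
that is not good. -/
theorem expect_foldlM_le {σ S S' : Type} (κ : S → σ → PMF S) (κ' : S' → σ → PMF S') (φ : S → S')
    (Good : S → σ → Prop) (Bad : Set S) (Inv : S → List σ → Prop) (ε : ℝ≥0∞)
    (hstep : ∀ st s P, Inv st (s :: P) → Good st s → ∀ f : S' → ℝ≥0∞, (∀ z, f z ≤ 1) →
      expect (κ st s) (fun z => f (φ z)) ≤ expect (κ' (φ st) s) f + ε)
    (hinv : ∀ st s P, Inv st (s :: P) → ∀ z ∈ (κ st s).support, Inv z P)
    (hbad : ∀ st s P, Inv st (s :: P) → ¬ Good st s →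
      ∀ z ∈ ((s :: P).foldlM κ st).support, z ∈ Bad)
    (P : List σ) (st : S) (hst : Inv st P) (f : S' → ℝ≥0∞) (hf : ∀ z, f z ≤ 1) :
    expect (P.foldlM κ st) (fun z => f (φ z)) ≤
      expect (P.foldlM κ' (φ st)) f + P.length * ε + (P.foldlM κ st).toOuterMeasure Bad := by
  induction P generalizing st with
  | nil =>
    simp only [List.foldlM_nil]
    refine (le_of_eq ?_).trans (le_add_right le_self_add)
    exact (expect_pure _ _).trans (expect_pure _ _).symm
  | cons s P ih =>
    by_cases hg : Good st s
    · have e1 : ∀ g : S → ℝ≥0∞, expect ((s :: P).foldlM κ st) g =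
          expect (κ st s) fun z => expect (P.foldlM κ z) g := fun g => expect_bind _ _ _
      have e2 : ∀ g : S' → ℝ≥0∞, expect ((s :: P).foldlM κ' (φ st)) g =
          expect (κ' (φ st) s) fun z => expect (P.foldlM κ' z) g := fun g => expect_bind _ _ _
      rw [e1, e2, ← expect_indicator, e1]
      simp only [expect_indicator]
      calc expect (κ st s) (fun z => expect (P.foldlM κ z) fun z => f (φ z))
          ≤ expect (κ st s) (fun z => expect (P.foldlM κ' (φ z)) f + P.length * ε
              + (P.foldlM κ z).toOuterMeasure Bad) :=
            expect_mono_support _ fun z hz => ih z (hinv st s P hst z hz)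
        _ = expect (κ st s) (fun z => expect (P.foldlM κ' (φ z)) f) + P.length * ε
              + expect (κ st s) (fun z => (P.foldlM κ z).toOuterMeasure Bad) := by
            rw [expect_add, expect_add, expect_const]
        _ ≤ (expect (κ' (φ st) s) (fun z => expect (P.foldlM κ' z) f) + ε) + P.length * ε
              + expect (κ st s) (fun z => (P.foldlM κ z).toOuterMeasure Bad) := by
            gcongr
            exact hstep st s P hst hg _ fun z => expect_le_one _ hf
        _ = _ := by
            push_cast [List.length_cons]
            ring
    · have h1 : ((s :: P).foldlM κ st).toOuterMeasure Bad = 1 :=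
        (PMF.toOuterMeasure_apply_eq_one_iff _ _).2 fun z hz => hbad st s P hst hg z hz
      rw [h1]
      exact (expect_le_one _ fun z => hf _).trans le_add_self

/-! ### Acceptance probabilities -/

/-- Probability that a distinguisher accepts a given string. -/
noncomputable def acc (D : Circuit) (l : List ℤ) : ℝ≥0∞ :=
  (D.run l).toOuterMeasure {o | o.head? = some 1}

theorem acc_le_one (D : Circuit) (l : List ℤ) : acc D l ≤ 1 := toOuterMeasure_le_one _ _

theorem acceptProb_eq (D : Circuit) (p : PMF (List ℤ)) :
    acceptProb D p = (expect p (acc D)).toReal := by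
  unfold acceptProb probOne
  rw [toOuterMeasure_bind]
  rfl

theorem abs_toReal_sub_le {a b : ℝ≥0∞} {ε : ℝ} (hε : 0 ≤ ε) (ha : a ≤ 1) (hb : b ≤ 1)
    (h1 : a ≤ b + ENNReal.ofReal ε) (h2 : b ≤ a + ENNReal.ofReal ε) :
    |a.toReal - b.toReal| ≤ ε := by
  have ha' := ne_top_of_le_ne_top ENNReal.one_ne_top ha
  have hb' := ne_top_of_le_ne_top ENNReal.one_ne_top hb
  have e1 := ENNReal.toReal_mono (by simp [hb']) h1
  have e2 := ENNReal.toReal_mono (by simp [ha']) h2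
  rw [ENNReal.toReal_add hb' (by simp), ENNReal.toReal_ofReal hε] at e1
  rw [ENNReal.toReal_add ha' (by simp), ENNReal.toReal_ofReal hε] at e2
  rw [abs_le]
  constructor <;> linarith

theorem le_add_of_abs_toReal_sub_le {a b : ℝ≥0∞} {ε : ℝ} (ha : a ≤ 1) (hb : b ≤ 1)
    (h : |a.toReal - b.toReal| ≤ ε) : a ≤ b + ENNReal.ofReal ε := by
  have ha' := ne_top_of_le_ne_top ENNReal.one_ne_top ha
  have hb' := ne_top_of_le_ne_top ENNReal.one_ne_top hb
  rw [← ENNReal.ofReal_toReal ha', ← ENNReal.ofReal_toReal hb',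
    ← ENNReal.ofReal_add ENNReal.toReal_nonneg ((abs_nonneg _).trans h)]
  exact ENNReal.ofReal_le_ofReal (by linarith [(abs_le.1 h).2])

theorem probOne_eq (p : PMF (List ℤ)) :
    probOne p = (p.toOuterMeasure {o | o.head? = some 1}).toReal := rfl

theorem probOne_nonneg (p : PMF (List ℤ)) : 0 ≤ probOne p := ENNReal.toReal_nonneg

theorem probOne_le_one (p : PMF (List ℤ)) : probOne p ≤ 1 :=
  ENNReal.toReal_le_of_le_ofReal zero_le_one (by simpa using toOuterMeasure_le_one _ _)

/-- Security against all families of polynomial-size adversaries gives, for every polynomial bound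
on the size, one negligible function that bounds the advantage of all adversaries within this
bound: for each value of the security parameter take an adversary that is optimal up to a factor of
two. -/
theorem CPASecure.uniform {pp : ℕ → Params} {N : ℕ → ℕ} (hs : CPASecure pp N)
    (hN : ∀ k, 0 < N k) {c : ℕ → ℕ} (hc : PolyBounded c) :
    ∃ ε : ℕ → ℝ, Negligible ε ∧ (∀ k, 0 ≤ ε k) ∧
      ∀ (k : ℕ) (h : Fin (N k)) (C₁ C₂ : Circuit), C₁.size ≤ c k → C₂.size ≤ c k →
        |probOne (cpaGame (pp k) (N k) h false C₁ C₂)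
          - probOne (cpaGame (pp k) (N k) h true C₁ C₂)| ≤ ε k := by
  let adv : ∀ k, Fin (N k) × Circuit × Circuit → ℝ := fun k z =>
    |probOne (cpaGame (pp k) (N k) z.1 false z.2.1 z.2.2)
      - probOne (cpaGame (pp k) (N k) z.1 true z.2.1 z.2.2)|
  let S : ∀ k, Set ℝ := fun k => adv k '' {z | z.2.1.size ≤ c k ∧ z.2.2.size ≤ c k}
  have hbdd : ∀ k, BddAbove (S k) := fun k => ⟨1, by
    rintro _ ⟨z, -, rfl⟩
    rw [abs_le]
    constructor <;> linarith [probOne_nonneg (cpaGame (pp k) (N k) z.1 false z.2.1 z.2.2),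
      probOne_le_one (cpaGame (pp k) (N k) z.1 false z.2.1 z.2.2),
      probOne_nonneg (cpaGame (pp k) (N k) z.1 true z.2.1 z.2.2),
      probOne_le_one (cpaGame (pp k) (N k) z.1 true z.2.1 z.2.2)]⟩
  have hex : ∀ k, ∃ z : Fin (N k) × Circuit × Circuit,
      (z.2.1.size ≤ c k ∧ z.2.2.size ≤ c k) ∧ sSup (S k) ≤ 2 * adv k z := fun k => by
    have hne : (S k).Nonempty :=
      ⟨_, (⟨0, hN k⟩, ⟨[], []⟩, ⟨[], []⟩), ⟨by simp [Circuit.size], by simp [Circuit.size]⟩, rfl⟩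
    rcases le_or_gt (sSup (S k)) 0 with h0 | h0
    · obtain ⟨_, z, hz, rfl⟩ := hne
      exact ⟨z, hz, h0.trans (mul_nonneg zero_le_two (abs_nonneg _))⟩
    · obtain ⟨_, ⟨z, hz, rfl⟩, hlt⟩ := exists_lt_of_lt_csSup hne (half_lt_self h0)
      exact ⟨z, hz, by linarith⟩
  choose z hz hsup using hex
  have hneg := hs (fun k => (z k).1) (fun k => (z k).2.1) (fun k => (z k).2.2)
    (hc.mono fun k => (hz k).1) (hc.mono fun k => (hz k).2)
  refine ⟨fun k => adv k (z k) + adv k (z k), Negligible.add hneg hneg,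
    fun k => add_nonneg (abs_nonneg _) (abs_nonneg _), fun k h C₁ C₂ h1 h2 => ?_⟩
  have : adv k (h, C₁, C₂) ≤ sSup (S k) := le_csSup (hbdd k) ⟨(h, C₁, C₂), ⟨h1, h2⟩, rfl⟩
  have := hsup k
  show adv k (h, C₁, C₂) ≤ _
  linarith

/-! ### Circuits over named quantities -/

section Impl

variable {X Y : Type}

/-- The effect of a program on the register contents. -/
noncomputable def execProg (prog : List Instr) (r : ℕ → ℤ) : PMF (ℕ → ℤ) :=
  prog.foldlM (fun r (i : Instr) => i.exec r) r

theorem execProg_nil (r : ℕ → ℤ) : execProg [] r = PMF.pure r := rfl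

theorem execProg_cons (i : Instr) (prog : List Instr) (r : ℕ → ℤ) :
    execProg (i :: prog) r = (i.exec r).bind (execProg prog) := rfl

/-- Let every function in `A` be the content of some register, as a function of a parameter `x`.
`Impl A c κ` says that a straight-line program of cost at most `c` then produces the output
distribution `κ x`. The registers `ρ f` that hold the functions `f ∈ A` are arbitrary, and all
registers from some `n` on are free. -/
def Impl (A : Set (X → ℤ)) (c : ℕ) (κ : X → PMF (List ℤ)) : Prop :=
  ∀ (n : ℕ) (ρ : (X → ℤ) → ℕ), (∀ f ∈ A, ρ f < n) →
    ∃ (prog : List Instr) (out : List ℕ), (prog.map Instr.cost).sum + out.length ≤ c ∧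
      ∀ (x : X) (r : ℕ → ℤ), (∀ f ∈ A, r (ρ f) = f x) →
        (execProg prog r).bind (fun r => PMF.pure (out.map r)) = κ x

theorem Impl.mono {A B : Set (X → ℤ)} {c d : ℕ} {κ : X → PMF (List ℤ)} (h : Impl A c κ)
    (hAB : A ⊆ B) (hcd : c ≤ d) : Impl B d κ := by
  intro n ρ hρ
  obtain ⟨prog, out, hc, hr⟩ := h n ρ fun f hf => hρ f (hAB hf)
  exact ⟨prog, out, hc.trans hcd, fun x r hx => hr x r fun f hf => hx f (hAB hf)⟩

theorem Impl.congr {A : Set (X → ℤ)} {c : ℕ} {κ κ' : X → PMF (List ℤ)} (h : Impl A c κ)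
    (hκ : ∀ x, κ x = κ' x) : Impl A c κ' := by
  rwa [← funext hκ]

theorem Impl.reindex {A : Set (X → ℤ)} {c : ℕ} {κ : X → PMF (List ℤ)} (h : Impl A c κ)
    (π : Y → X) : Impl ((fun f y => f (π y)) '' A) c (fun y => κ (π y)) := by
  intro n ρ hρ
  obtain ⟨prog, out, hc, hr⟩ := h n (fun f => ρ fun y => f (π y)) fun f hf => hρ _ ⟨f, hf, rfl⟩
  exact ⟨prog, out, hc, fun x r hx => hr (π x) r fun f hf => hx _ ⟨f, hf, rfl⟩⟩

theorem Impl.pure {A : Set (X → ℤ)} (fs : List (X → ℤ)) (h : ∀ f ∈ fs, f ∈ A) :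
    Impl A fs.length (fun x => PMF.pure (fs.map fun f => f x)) := by
  intro n ρ hρ
  refine ⟨[], fs.map ρ, by simp, fun x r hr => ?_⟩
  simp only [execProg_nil, List.map_map]
  refine (PMF.pure_bind _ _).trans (congrArg _ ?_)
  exact List.map_congr_left fun f hf => hr f (h f hf)

/-- A deterministic instruction that puts `g` into a fresh register makes `g` available. -/
theorem Impl.step {A : Set (X → ℤ)} {g : X → ℤ} {c k : ℕ} {κ : X → PMF (List ℤ)}
    (i : ((X → ℤ) → ℕ) → ℕ → Instr) (hcost : ∀ ρ d, (i ρ d).cost ≤ k)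
    (hi : ∀ ρ d x r, (∀ f ∈ A, r (ρ f) = f x) →
      (i ρ d).exec r = PMF.pure (Function.update r d (g x)))
    (h : Impl (insert g A) c κ) : Impl A (k + c) κ := by
  classical
  intro n ρ hρ
  obtain ⟨prog, out, hc, hr⟩ := h (n + 1) (Function.update ρ g n) fun f hf => by
    by_cases hfg : f = g
    · simp [hfg]
    · rw [Function.update_of_ne hfg]
      exact (hρ f (hf.resolve_left hfg)).trans (Nat.lt_succ_self n)
  refine ⟨i ρ n :: prog, out, ?_, fun x r hx => ?_⟩
  · have := hcost ρ n
    simp only [List.map_cons, List.sum_cons]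
    omega
  · rw [execProg_cons, hi ρ n x r hx]
    refine (PMF.bind_bind _ _ _).trans ((PMF.pure_bind _ _).trans ?_)
    refine hr x _ fun f hf => ?_
    by_cases hfg : f = g
    · simp [hfg]
    · have hf' := hf.resolve_left hfg
      rw [Function.update_of_ne hfg, Function.update_of_ne (hρ f hf').ne]
      exact hx f hf'

theorem Impl.const {A : Set (X → ℤ)} {c : ℕ} {κ : X → PMF (List ℤ)} (z : ℤ)
    (h : Impl (insert (fun _ => z) A) c κ) : Impl A (1 + Nat.size z.natAbs + c) κ :=
  Impl.step (fun _ d => .const d z) (fun _ _ => le_rfl) (fun _ _ _ _ _ => rfl) h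

theorem Impl.add {A : Set (X → ℤ)} {c : ℕ} {κ : X → PMF (List ℤ)} {f g : X → ℤ} (hf : f ∈ A)
    (hg : g ∈ A) (m : ℕ) (h : Impl (insert (fun x => (f x + g x) % (m + 1)) A) c κ) :
    Impl A (1 + Nat.size m + c) κ :=
  Impl.step (fun ρ d => .add d (ρ f) (ρ g) m) (fun _ _ => le_rfl)
    (fun ρ d x r hr => by rw [Instr.exec, hr f hf, hr g hg]; rfl) h

theorem Impl.sub {A : Set (X → ℤ)} {c : ℕ} {κ : X → PMF (List ℤ)} {f g : X → ℤ} (hf : f ∈ A)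
    (hg : g ∈ A) (m : ℕ) (h : Impl (insert (fun x => (f x - g x) % (m + 1)) A) c κ) :
    Impl A (1 + Nat.size m + c) κ :=
  Impl.step (fun ρ d => .sub d (ρ f) (ρ g) m) (fun _ _ => le_rfl)
    (fun ρ d x r hr => by rw [Instr.exec, hr f hf, hr g hg]; rfl) h

theorem Impl.mul {A : Set (X → ℤ)} {c : ℕ} {κ : X → PMF (List ℤ)} {f g : X → ℤ} (hf : f ∈ A)
    (hg : g ∈ A) (m : ℕ) (h : Impl (insert (fun x => (f x * g x) % (m + 1)) A) c κ) :
    Impl A (1 + Nat.size m + c) κ :=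
  Impl.step (fun ρ d => .mul d (ρ f) (ρ g) m) (fun _ _ => le_rfl)
    (fun ρ d x r hr => by rw [Instr.exec, hr f hf, hr g hg]; rfl) h

theorem Impl.div {A : Set (X → ℤ)} {c : ℕ} {κ : X → PMF (List ℤ)} {f g : X → ℤ} (hf : f ∈ A)
    (hg : g ∈ A) (m : ℕ) (h : Impl (insert (fun x => (f x / g x) % (m + 1)) A) c κ) :
    Impl A (1 + Nat.size m + c) κ :=
  Impl.step (fun ρ d => .div d (ρ f) (ρ g) m) (fun _ _ => le_rfl)
    (fun ρ d x r hr => by rw [Instr.exec, hr f hf, hr g hg]; rfl) h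

theorem Impl.le {A : Set (X → ℤ)} {c : ℕ} {κ : X → PMF (List ℤ)} {f g : X → ℤ} (hf : f ∈ A)
    (hg : g ∈ A) (h : Impl (insert (fun x => if f x ≤ g x then 1 else 0) A) c κ) :
    Impl A (1 + c) κ :=
  Impl.step (fun ρ d => .le d (ρ f) (ρ g)) (fun _ _ => le_rfl)
    (fun ρ d x r hr => by rw [Instr.exec, hr f hf, hr g hg]; rfl) h

theorem Impl.rand {A : Set (X → ℤ)} {c : ℕ} (m : ℕ) {κ : X × Fin (m + 1) → PMF (List ℤ)}
    (h : Impl ((fun f y => f y.1) '' A ∪ {fun y => ((y.2 : ℕ) : ℤ)}) c κ) :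
    Impl A (1 + Nat.size m + c)
      (fun x => (PMF.uniformOfFintype (Fin (m + 1))).bind fun u => κ (x, u)) := by
  classical
  intro n ρ hρ
  -- A function of the pair is located at the new register if it is the new coin, and otherwise,
  -- if it does not depend on the coin, where it was located before.
  let ρ' : (X × Fin (m + 1) → ℤ) → ℕ := fun f =>
    if f = fun y => ((y.2 : ℕ) : ℤ) then n else ρ fun x => f (x, 0)
  obtain ⟨prog, out, hc, hr⟩ := h (n + 1) ρ' fun f hf => by
    by_cases hfg : f = fun y => ((y.2 : ℕ) : ℤ)
    · simp [ρ', hfg]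
    · obtain ⟨f', hf', rfl⟩ := hf.resolve_right hfg
      simp only [ρ', if_neg hfg]
      exact (hρ f' hf').trans (Nat.lt_succ_self n)
  refine ⟨.rand n m :: prog, out, ?_, fun x r hx => ?_⟩
  · simp only [List.map_cons, List.sum_cons, Instr.cost]
    omega
  · rw [execProg_cons]
    refine (PMF.bind_bind _ _ _).trans ((PMF.bind_bind _ _ _).trans ?_)
    refine congrArg _ (funext fun u => ?_)
    refine (PMF.pure_bind _ _).trans (hr (x, u) _ fun f hf => ?_)
    by_cases hfg : f = fun y => ((y.2 : ℕ) : ℤ)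
    · simp [ρ', hfg]
    · obtain ⟨f', hf', rfl⟩ := hf.resolve_right hfg
      simp only [ρ', if_neg hfg]
      rw [Function.update_of_ne (hρ f' hf').ne]
      exact hx f' hf'

/-- A straight-line program may be run on available quantities: `g i` is the current content of
its register `i`. -/
theorem Impl.program (prog : List Instr) (out : List ℕ) : ∀ {X : Type} {A : Set (X → ℤ)}
    (g : ℕ → X → ℤ), (∀ i, g i ∈ A) →
    Impl A ((prog.map Instr.cost).sum + out.length) (fun x =>
      (execProg prog fun i => g i x).bind fun r => PMF.pure (out.map r)) := by
  induction prog with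
  | nil =>
    intro X A g hg
    have := Impl.pure (A := A) (out.map g) (by
      intro f hf
      obtain ⟨i, -, rfl⟩ := List.mem_map.1 hf
      exact hg i)
    simp only [List.map_map, List.length_map] at this
    simp only [List.map_nil, List.sum_nil, zero_add, execProg_nil]
    refine Impl.congr this fun x => ?_
    rw [PMF.pure_bind]
    rfl
  | cons i prog ih =>
    intro X A g hg
    have key : ∀ (d : ℕ) (v : X → ℤ), Impl (insert v A) ((prog.map Instr.cost).sum + out.length)
        (fun x => (execProg prog (Function.update (fun i => g i x) d (v x))).bind
          fun r => PMF.pure (out.map r)) := by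
      intro d v
      have := ih (A := insert v A) (Function.update g d v) (by
        intro j
        by_cases hj : j = d
        · subst hj; simp
        · rw [Function.update_of_ne hj]; exact Or.inr (hg j))
      refine Impl.congr this fun x => ?_
      congr 2
      funext j
      by_cases hj : j = d
      · subst hj; simp
      · simp [Function.update_of_ne hj]
    have det : ∀ (d : ℕ) (v : X → ℤ) (_ : ∀ x, i.exec (fun i => g i x) =
        PMF.pure (Function.update (fun i => g i x) d (v x))),
        (fun x => (execProg (i :: prog) fun i => g i x).bind
          fun r => PMF.pure (out.map r)) =
        (fun x => (execProg prog (Function.update (fun i => g i x) d (v x))).bind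
          fun r => PMF.pure (out.map r)) := by
      intro d v hv
      funext x
      rw [execProg_cons, hv]
      exact (PMF.bind_bind _ _ _).trans (PMF.pure_bind _ _)
    rw [List.map_cons, List.sum_cons, add_assoc]
    cases i with
    | const d c => rw [det d _ fun x => rfl]; exact Impl.const c (key d _)
    | add d a b m => rw [det d _ fun x => rfl]; exact Impl.add (hg a) (hg b) m (key d _)
    | sub d a b m => rw [det d _ fun x => rfl]; exact Impl.sub (hg a) (hg b) m (key d _)
    | mul d a b m => rw [det d _ fun x => rfl]; exact Impl.mul (hg a) (hg b) m (key d _)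
    | div d a b m => rw [det d _ fun x => rfl]; exact Impl.div (hg a) (hg b) m (key d _)
    | le d a b => rw [det d _ fun x => rfl]; exact Impl.le (hg a) (hg b) (key d _)
    | rand d m =>
      have := ih (X := X × Fin (m + 1))
        (A := (fun f y => f y.1) '' A ∪ {fun y => ((y.2 : ℕ) : ℤ)})
        (Function.update (fun j y => g j y.1) d fun y => ((y.2 : ℕ) : ℤ)) (by
        intro j
        by_cases hj : j = d
        · subst hj; simp
        · rw [Function.update_of_ne hj]; exact Or.inl ⟨_, hg j, rfl⟩)
      refine (Impl.rand m this).congr fun x => ?_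
      rw [execProg_cons]
      refine Eq.trans ?_ (((PMF.bind_bind _ _ _).trans (PMF.bind_bind _ _ _)).symm)
      refine congrArg _ (funext fun u => ?_)
      refine Eq.trans ?_ (PMF.pure_bind _ _).symm
      show PMF.bind _ _ = PMF.bind _ _
      congr 2
      funext j
      by_cases hj : j = d
      · subst hj; simp
      · simp [Function.update_of_ne hj]

/-- A circuit may be called on a list of available quantities. -/
theorem Impl.call (D : Circuit) {A : Set (X → ℤ)} (fs : List (X → ℤ)) (h : ∀ f ∈ fs, f ∈ A) :
    Impl A (1 + D.size) (fun x => D.run (fs.map fun f => f x)) := by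
  have := Impl.program D.prog D.out (A := insert (fun _ => (0 : ℤ)) A)
    (fun i => fs.getD i fun _ => 0) (by
    intro i
    rw [List.getD_eq_getElem?_getD]
    cases hi : fs[i]? with
    | none => exact Or.inl rfl
    | some f => exact Or.inr (h f (List.mem_of_getElem? hi)))
  refine (Impl.const 0 this).congr fun x => ?_
  have e : (fun i => (fs.getD i fun _ => 0) x) = fun i => (fs.map fun f => f x).getD i 0 := by
    funext i
    simp only [List.getD_eq_getElem?_getD, List.getElem?_map]
    cases fs[i]? <;> rfl
  rw [e]
  rfl

/-- From quantities to circuits: if the available quantities are the entries of the input, the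
program is a circuit. -/
theorem Impl.circuit {fs : List (X → ℤ)} {c : ℕ} {κ : X → PMF (List ℤ)}
    (h : Impl {f | f ∈ fs} c κ) :
    ∃ C : Circuit, C.size ≤ c ∧ ∀ x, C.run (fs.map fun f => f x) = κ x := by
  classical
  obtain ⟨prog, out, hc, hr⟩ := h fs.length (fun f => fs.idxOf f) fun f hf =>
    List.idxOf_lt_length_of_mem hf
  refine ⟨⟨prog, out⟩, hc, fun x => hr x _ fun f hf => ?_⟩
  have hlt := List.idxOf_lt_length_of_mem hf
  simp [List.getD_eq_getElem?_getD, hlt]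

end Impl

/-! ### Quantities that are cheap to compute -/

/-- A bound `s` for the dimensions and a bound `M` for the moduli and constants. -/
structure Budget where
  s : ℕ
  M : ℕ
  four_le : 4 ≤ s

/-- Cost of an instruction within a budget. -/
def Budget.W (b : Budget) : ℕ := 1 + Nat.size b.M

section Cx

variable {X : Type}

/-- `OpStep M A f`: the quantity `f` results from quantities in `A` by one instruction whose
constant is at most `M`. -/
inductive OpStep (M : ℕ) (A : Set (X → ℤ)) : (X → ℤ) → Prop
  | const (z : ℤ) : z.natAbs ≤ M → OpStep M A fun _ => z
  | add {f g : X → ℤ} (m : ℕ) : f ∈ A → g ∈ A → m ≤ M → OpStep M A fun x => (f x + g x) % (m + 1)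
  | sub {f g : X → ℤ} (m : ℕ) : f ∈ A → g ∈ A → m ≤ M → OpStep M A fun x => (f x - g x) % (m + 1)
  | mul {f g : X → ℤ} (m : ℕ) : f ∈ A → g ∈ A → m ≤ M → OpStep M A fun x => (f x * g x) % (m + 1)
  | div {f g : X → ℤ} (m : ℕ) : f ∈ A → g ∈ A → m ≤ M → OpStep M A fun x => (f x / g x) % (m + 1)
  | le {f g : X → ℤ} : f ∈ A → g ∈ A → OpStep M A fun x => if f x ≤ g x then 1 else 0

/-- `Reach M A n B`: with `n` instructions the available quantities grow from `A` to `B`. -/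
inductive Reach (M : ℕ) (A : Set (X → ℤ)) : ℕ → Set (X → ℤ) → Prop
  | refl : Reach M A 0 A
  | step {n : ℕ} {B : Set (X → ℤ)} {f : X → ℤ} :
      Reach M A n B → OpStep M B f → Reach M A (n + 1) (insert f B)

theorem Reach.subset {M n : ℕ} {A B : Set (X → ℤ)} (h : Reach M A n B) : A ⊆ B := by
  induction h with
  | refl => exact subset_rfl
  | step _ _ ih => exact ih.trans (Set.subset_insert _ _)

theorem Reach.trans {M n m : ℕ} {A B C : Set (X → ℤ)} (h : Reach M A n B) (h' : Reach M B m C) :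
    Reach M A (n + m) C := by
  induction h' with
  | refl => exact h
  | step _ ho ih => exact ih.step ho

theorem Impl.opStep {b : Budget} {A : Set (X → ℤ)} {f : X → ℤ} {c : ℕ} {κ : X → PMF (List ℤ)}
    (ho : OpStep b.M A f) (h : Impl (insert f A) c κ) : Impl A (b.W + c) κ := by
  unfold Budget.W
  cases ho with
  | const z hz =>
    exact (Impl.const z h).mono subset_rfl (by have := Nat.size_le_size hz; omega)
  | add m hf hg hm =>
    exact (Impl.add hf hg m h).mono subset_rfl (by have := Nat.size_le_size hm; omega)
  | sub m hf hg hm =>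
    exact (Impl.sub hf hg m h).mono subset_rfl (by have := Nat.size_le_size hm; omega)
  | mul m hf hg hm =>
    exact (Impl.mul hf hg m h).mono subset_rfl (by have := Nat.size_le_size hm; omega)
  | div m hf hg hm =>
    exact (Impl.div hf hg m h).mono subset_rfl (by have := Nat.size_le_size hm; omega)
  | le hf hg => exact (Impl.le hf hg h).mono subset_rfl (by omega)

theorem Impl.reach {b : Budget} {A B : Set (X → ℤ)} {n c : ℕ} {κ : X → PMF (List ℤ)}
    (hr : Reach b.M A n B) (h : Impl B c κ) : Impl A (n * b.W + c) κ := by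
  induction hr generalizing c with
  | refl => simpa using h
  | step _ ho ih => exact (ih (h.opStep ho)).mono subset_rfl (by rw [Nat.succ_mul]; omega)

/-- `Cx b A e f`: from the quantities in `A` the quantity `f` is computed by at most `s ^ e`
instructions. All costs are counted in powers of the dimension bound `s`. -/
def Cx (b : Budget) (A : Set (X → ℤ)) (e : ℕ) (f : X → ℤ) : Prop :=
  ∀ A', A ⊆ A' → ∃ n B, n ≤ b.s ^ e ∧ Reach b.M A' n B ∧ f ∈ B

variable {b : Budget} {A : Set (X → ℤ)}

theorem Budget.one_le_pow (b : Budget) (e : ℕ) : 1 ≤ b.s ^ e :=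
  Nat.one_le_pow _ _ (by have := b.four_le; omega)

theorem Budget.pow_le_pow (b : Budget) {e e' : ℕ} (h : e ≤ e') : b.s ^ e ≤ b.s ^ e' :=
  Nat.pow_le_pow_right (by have := b.four_le; omega) h

theorem Budget.four_mul_pow_le (b : Budget) (e : ℕ) : 4 * b.s ^ e ≤ b.s ^ (e + 1) := by
  rw [pow_succ, mul_comm]
  exact Nat.mul_le_mul_left _ b.four_le

theorem Cx.mono {e e' : ℕ} {A' : Set (X → ℤ)} {f : X → ℤ} (h : Cx b A e f) (he : e ≤ e')
    (hA : A ⊆ A') : Cx b A' e' f := by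
  intro B hB
  obtain ⟨n, C, hn, hr, hf⟩ := h B (hA.trans hB)
  exact ⟨n, C, hn.trans (b.pow_le_pow he), hr, hf⟩

theorem Cx.up {e e' : ℕ} {f : X → ℤ} (h : Cx b A e f) (he : e ≤ e' := by omega) : Cx b A e' f :=
  h.mono he subset_rfl

theorem Cx.of_mem {e : ℕ} {f : X → ℤ} (h : f ∈ A) : Cx b A e f :=
  fun A' hA => ⟨0, A', Nat.zero_le _, .refl, hA h⟩

theorem Cx.const {e : ℕ} (z : ℤ) (hz : z.natAbs ≤ b.M) : Cx b A e fun _ => z :=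
  fun _ _ => ⟨1, _, b.one_le_pow e, .step .refl (.const z hz), Set.mem_insert _ _⟩

theorem Cx.op₂ {e : ℕ} {f g o : X → ℤ} (hf : Cx b A e f) (hg : Cx b A e g)
    (ho : ∀ B, f ∈ B → g ∈ B → OpStep b.M B o) : Cx b A (e + 1) o := by
  intro A' hA
  obtain ⟨n, B, hn, hr, hfB⟩ := hf A' hA
  obtain ⟨m, C, hm, hr', hgC⟩ := hg B (hA.trans hr.subset)
  refine ⟨n + m + 1, _, ?_, .step (hr.trans hr') (ho C (hr'.subset hfB) hgC), Set.mem_insert _ _⟩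
  have := b.four_mul_pow_le e
  have := b.one_le_pow e
  omega

theorem Cx.le {e : ℕ} {f g : X → ℤ} (hf : Cx b A e f) (hg : Cx b A e g) :
    Cx b A (e + 1) fun x => if f x ≤ g x then 1 else 0 :=
  hf.op₂ hg fun _ h h' => .le h h'

/-- `f` modulo `Q` is computed by at most `s ^ e` instructions. -/
def Cm (b : Budget) (A : Set (X → ℤ)) (e Q : ℕ) (f : X → ℤ) : Prop := Cx b A e fun x => f x % Q

theorem Cm.up {e e' Q : ℕ} {f : X → ℤ} (h : Cm b A e Q f) (he : e ≤ e' := by omega) :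
    Cm b A e' Q f :=
  Cx.up h he

theorem Cm.congr {e Q : ℕ} {f g : X → ℤ} (h : Cm b A e Q f) (hfg : ∀ x, f x ≡ g x [ZMOD Q]) :
    Cm b A e Q g := by
  have : (fun x => f x % (Q : ℤ)) = fun x => g x % Q := funext hfg
  unfold Cm at *
  rwa [← this]

variable {e Q : ℕ} {f g : X → ℤ}

theorem natCast_sub_one_add_one (hQ : 0 < Q) : (((Q - 1 : ℕ) : ℤ) + 1) = Q := by omega

theorem Cm.add (hf : Cm b A e Q f) (hg : Cm b A e Q g) (hQ : 0 < Q) (hM : Q ≤ b.M) :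
    Cm b A (e + 1) Q fun x => f x + g x := by
  refine hf.op₂ hg fun B h h' => ?_
  have := OpStep.add (M := b.M) (Q - 1) h h' (by omega)
  rw [natCast_sub_one_add_one hQ] at this
  simpa only [← Int.add_emod] using this

theorem Cm.sub (hf : Cm b A e Q f) (hg : Cm b A e Q g) (hQ : 0 < Q) (hM : Q ≤ b.M) :
    Cm b A (e + 1) Q fun x => f x - g x := by
  refine hf.op₂ hg fun B h h' => ?_
  have := OpStep.sub (M := b.M) (Q - 1) h h' (by omega)
  rw [natCast_sub_one_add_one hQ] at this
  simpa only [← Int.sub_emod] using this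

theorem Cm.mul (hf : Cm b A e Q f) (hg : Cm b A e Q g) (hQ : 0 < Q) (hM : Q ≤ b.M) :
    Cm b A (e + 1) Q fun x => f x * g x := by
  refine hf.op₂ hg fun B h h' => ?_
  have := OpStep.mul (M := b.M) (Q - 1) h h' (by omega)
  rw [natCast_sub_one_add_one hQ] at this
  simpa only [← Int.mul_emod] using this

theorem Cx.divMod (hf : Cx b A e f) (hg : Cx b A e g) (hQ : 0 < Q) (hM : Q ≤ b.M) :
    Cm b A (e + 1) Q fun x => f x / g x := by
  refine hf.op₂ hg fun B h h' => ?_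
  have := OpStep.div (M := b.M) (Q - 1) h h' (by omega)
  rwa [natCast_sub_one_add_one hQ] at this

theorem Cm.const (z : ℤ) (hQ : 0 < Q) (hM : Q ≤ b.M) : Cm b A e Q fun _ => z := by
  have h1 := Int.emod_nonneg z (by omega : (Q : ℤ) ≠ 0)
  have h2 := Int.emod_lt_of_pos z (by omega : (0 : ℤ) < Q)
  exact Cx.const _ (by omega)

theorem Cm.zero (hQ : 0 < Q) (hM : Q ≤ b.M) : Cm b A e Q fun _ => 0 := Cm.const 0 hQ hM

theorem Cx.mod (hf : Cx b A e f) (hQ : 0 < Q) (hM : Q ≤ b.M) : Cm b A (e + 1) Q f := by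
  refine hf.op₂ (Cx.const 0 (Nat.zero_le _)) fun B h h' => ?_
  have := OpStep.add (M := b.M) (Q - 1) h h' (by omega)
  rw [natCast_sub_one_add_one hQ] at this
  simpa only [add_zero] using this

theorem Cm.neg (hf : Cm b A e Q f) (hQ : 0 < Q) (hM : Q ≤ b.M) :
    Cm b A (e + 1) Q fun x => -f x := by
  simpa using (Cm.zero hQ hM).sub hf hQ hM

/-- Division of a number known modulo `D * Q` by the constant `D`, modulo `Q`. -/
theorem Cm.div_const {D : ℕ} (hf : Cm b A e (D * Q) f) (hD : 0 < D) (hQ : 0 < Q)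
    (hM : D * Q ≤ b.M) : Cm b A (e + 1) Q fun x => f x / D := by
  have hDM : D ≤ b.M := (Nat.le_mul_of_pos_right D hQ).trans hM
  have hQM : Q ≤ b.M := (Nat.le_mul_of_pos_left Q hD).trans hM
  refine (Cx.divMod hf (Cx.const (D : ℤ) (by simpa using hDM)) hQ hQM).congr fun x => ?_
  have hD' : (D : ℤ) ≠ 0 := by omega
  have h1 : f x % ((D * Q : ℕ) : ℤ) = f x + D * (-(Q * (f x / ((D * Q : ℕ) : ℤ)))) := by
    have := Int.emod_add_mul_ediv (f x) ((D * Q : ℕ) : ℤ)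
    push_cast at this ⊢
    linarith
  rw [h1, Int.add_mul_ediv_left _ _ hD']
  exact (Int.modEq_iff_dvd.2 ⟨f x / ((D * Q : ℕ) : ℤ), by ring⟩)

theorem Cm.sum {ι : Type} (S : Finset ι) {f : ι → X → ℤ} (hS : S.card ≤ b.s)
    (hf : ∀ i ∈ S, Cm b A e Q (f i)) (hQ : 0 < Q) (hM : Q ≤ b.M) :
    Cm b A (e + 2) Q fun x => ∑ i ∈ S, f i x := by
  classical
  have key : ∀ A', A ⊆ A' → ∃ n B, n ≤ S.card * (b.s ^ e + 1) + 1 ∧ Reach b.M A' n B ∧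
      (fun x => (∑ i ∈ S, f i x) % (Q : ℤ)) ∈ B := by
    intro A' hA
    clear hS
    induction S using Finset.induction_on with
    | empty =>
      refine ⟨1, _, by simp, .step .refl (.const 0 (Nat.zero_le _)), ?_⟩
      simp
    | insert i S hi ih =>
      obtain ⟨n, B, hn, hr, hB⟩ := ih fun j hj => hf j (Finset.mem_insert_of_mem hj)
      obtain ⟨m, C, hm, hr', hC⟩ := hf i (Finset.mem_insert_self i S) B (hA.trans hr.subset)
      have := OpStep.add (M := b.M) (Q - 1) hC (hr'.subset hB) (by omega)
      refine ⟨n + m + 1, _, ?_, .step (hr.trans hr') this, ?_⟩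
      · rw [Finset.card_insert_of_notMem hi, Nat.succ_mul]
        omega
      · simp only [natCast_sub_one_add_one hQ, Finset.sum_insert hi, ← Int.add_emod]
        exact Set.mem_insert _ _
  intro A' hA
  obtain ⟨n, B, hn, hr, hB⟩ := key A' hA
  refine ⟨n, B, hn.trans ?_, hr, hB⟩
  have h1 : S.card * (b.s ^ e + 1) ≤ b.s * (b.s ^ e + 1) := Nat.mul_le_mul_right _ hS
  have h2 := b.four_mul_pow_le e
  have h3 : 4 * b.s ^ (e + 1) ≤ b.s ^ (e + 2) := b.four_mul_pow_le (e + 1)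
  have h4 : b.s ≤ b.s ^ (e + 1) := Nat.le_self_pow (by omega) _
  have h5 := b.four_le
  have h6 : b.s * (b.s ^ e + 1) = b.s ^ (e + 1) + b.s := by ring
  omega

theorem Cm.ite (p : Prop) [Decidable p] (hf : p → Cm b A e Q f) (hg : ¬p → Cm b A e Q g) :
    Cm b A e Q fun x => if p then f x else g x := by
  split_ifs with h
  · exact hf h
  · exact hg h

/-- Several quantities are computed one after the other. -/
theorem Reach.family {e : ℕ} (fs : List (X → ℤ)) (h : ∀ f ∈ fs, Cx b A e f) :
    ∃ n B, n ≤ fs.length * b.s ^ e ∧ Reach b.M A n B ∧ ∀ f ∈ fs, f ∈ B := by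
  induction fs with
  | nil => exact ⟨0, A, by simp, .refl, by simp⟩
  | cons f fs ih =>
    obtain ⟨n, B, hn, hr, hB⟩ := ih fun g hg => h g (List.mem_cons_of_mem _ hg)
    obtain ⟨m, C, hm, hr', hC⟩ := h f List.mem_cons_self B hr.subset
    refine ⟨n + m, C, ?_, hr.trans hr', ?_⟩
    · rw [List.length_cons, Nat.succ_mul]
      omega
    · intro g hg
      rcases List.mem_cons.1 hg with rfl | hg
      · exact hC
      · exact hr'.subset (hB g hg)

end Cx

/-! ### Coordinates of structured data -/

/-- The integers that make up an element of a type of structured data. -/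
class Coords (α : Type) where
  coords : List (α → ℤ)

instance : Coords ℤ := ⟨[fun a => a]⟩
instance (m : ℕ) : Coords (Fin m) := ⟨[fun a => ((a : ℕ) : ℤ)]⟩
instance (α β : Type) [Coords α] [Coords β] : Coords (α × β) :=
  ⟨(Coords.coords.map fun f a => f a.1) ++ Coords.coords.map fun f a => f a.2⟩
instance (n : ℕ) (β : Fin n → Type) [∀ i, Coords (β i)] : Coords (∀ i, β i) :=
  ⟨(List.finRange n).flatMap fun i => Coords.coords.map fun f a => f (a i)⟩

/-- Number of coordinates. -/
def dim (α : Type) [Coords α] : ℕ := (Coords.coords (α := α)).length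

/-- Serialization lists the coordinates. -/
class LawfulSer (α : Type) [Ser α] [Coords α] : Prop where
  ser_eq : ∀ a : α, Ser.ser a = Coords.coords.map fun f => f a

instance : LawfulSer ℤ := ⟨fun _ => rfl⟩
instance (m : ℕ) : LawfulSer (Fin m) := ⟨fun _ => rfl⟩
instance (α β : Type) [Ser α] [Ser β] [Coords α] [Coords β] [LawfulSer α] [LawfulSer β] :
    LawfulSer (α × β) :=
  ⟨fun a => by
    show Ser.ser a.1 ++ Ser.ser a.2 = _
    simp only [LawfulSer.ser_eq, Coords.coords, List.map_append, List.map_map]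
    rfl⟩
instance (n : ℕ) (α : Type) [Ser α] [Coords α] [LawfulSer α] : LawfulSer (Fin n → α) :=
  ⟨fun a => by
    show (List.finRange n).flatMap (fun i => Ser.ser (a i)) = _
    simp only [LawfulSer.ser_eq, Coords.coords, List.map_flatMap, List.map_map]
    rfl⟩

section Coords

variable {X Y α β : Type} [Coords α] [Coords β]

/-- All coordinates of `a`, as functions of a parameter `x`, satisfy `p`. -/
def EachCoord (p : (X → ℤ) → Prop) (a : X → α) : Prop :=
  ∀ f ∈ Coords.coords (α := α), p fun x => f (a x)

variable {p q : (X → ℤ) → Prop}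

theorem EachCoord.imp {a : X → α} (h : EachCoord p a) (hpq : ∀ f, p f → q f) : EachCoord q a :=
  fun f hf => hpq _ (h f hf)

theorem eachCoord_int {a : X → ℤ} : EachCoord p a ↔ p a := by
  simp [EachCoord, Coords.coords]

theorem eachCoord_fin {m : ℕ} {a : X → Fin m} : EachCoord p a ↔ p fun x => ((a x : ℕ) : ℤ) := by
  simp [EachCoord, Coords.coords]

theorem eachCoord_prod {a : X → α × β} :
    EachCoord p a ↔ EachCoord p (fun x => (a x).1) ∧ EachCoord p fun x => (a x).2 := by
  simp only [EachCoord, Coords.coords, List.mem_append, List.mem_map]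
  constructor
  · intro h
    exact ⟨fun f hf => h _ (Or.inl ⟨f, hf, rfl⟩), fun f hf => h _ (Or.inr ⟨f, hf, rfl⟩)⟩
  · rintro ⟨h1, h2⟩ f (⟨g, hg, rfl⟩ | ⟨g, hg, rfl⟩)
    · exact h1 g hg
    · exact h2 g hg

theorem eachCoord_pi {n : ℕ} {β : Fin n → Type} [∀ i, Coords (β i)] {a : X → ∀ i, β i} :
    EachCoord p a ↔ ∀ i, EachCoord p fun x => a x i := by
  simp only [EachCoord, Coords.coords, List.mem_flatMap, List.mem_map, List.mem_finRange, true_and]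
  constructor
  · intro h i f hf
    exact h _ ⟨i, f, hf, rfl⟩
  · rintro h f ⟨i, g, hg, rfl⟩
    exact h i g hg

theorem EachCoord.fst {a : X → α × β} (h : EachCoord p a) : EachCoord p fun x => (a x).1 :=
  (eachCoord_prod.1 h).1

theorem EachCoord.snd {a : X → α × β} (h : EachCoord p a) : EachCoord p fun x => (a x).2 :=
  (eachCoord_prod.1 h).2

theorem EachCoord.apply {n : ℕ} {β : Fin n → Type} [∀ i, Coords (β i)] {a : X → ∀ i, β i}
    (h : EachCoord p a) (i : Fin n) : EachCoord p fun x => a x i :=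
  eachCoord_pi.1 h i

/-- The coordinates of a ring element. -/
theorem eachCoord_poly {n : ℕ} {a : X → Fin n → ℤ} : EachCoord p a ↔ ∀ k, p fun x => a x k := by
  rw [eachCoord_pi]
  exact forall_congr' fun k => eachCoord_int

theorem dim_prod : dim (α × β) = dim α + dim β := by
  simp [dim, Coords.coords]

theorem dim_pi {n : ℕ} {β : Fin n → Type} [∀ i, Coords (β i)] {d : ℕ} (h : ∀ i, dim (β i) ≤ d) :
    dim (∀ i, β i) ≤ n * d := by
  simp only [dim, Coords.coords, List.length_flatMap, List.length_map]
  refine (List.sum_le_card_nsmul _ d fun z hz => ?_).trans (by simp)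
  obtain ⟨i, -, rfl⟩ := List.mem_map.1 hz
  exact h i

/-- Bound for the absolute values of all coordinates. -/
def CoordBound (M : ℕ) (α : Type) [Coords α] : Prop :=
  ∀ f ∈ Coords.coords (α := α), ∀ a, (f a).natAbs ≤ M

theorem CoordBound.fin {M m : ℕ} (h : m ≤ M) : CoordBound M (Fin (m + 1)) := by
  intro f hf a
  simp only [Coords.coords, List.mem_singleton] at hf
  subst hf
  simp only [Int.natAbs_natCast]
  omega

theorem CoordBound.prod {M : ℕ} (hα : CoordBound M α) (hβ : CoordBound M β) :
    CoordBound M (α × β) := by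
  intro f hf a
  simp only [Coords.coords, List.mem_append, List.mem_map] at hf
  rcases hf with ⟨g, hg, rfl⟩ | ⟨g, hg, rfl⟩
  · exact hα g hg a.1
  · exact hβ g hg a.2

theorem CoordBound.pi {M n : ℕ} {β : Fin n → Type} [∀ i, Coords (β i)]
    (h : ∀ i, CoordBound M (β i)) : CoordBound M (∀ i, β i) := by
  intro f hf a
  simp only [Coords.coords, List.mem_flatMap, List.mem_map] at hf
  obtain ⟨i, -, g, hg, rfl⟩ := hf
  exact h i g hg (a i)

/-- A list of integers depending on a parameter that has at most `l` entries, all of them subject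
to `p`; its length does not depend on the parameter. -/
def Listed (p : (X → ℤ) → Prop) (l : ℕ) (L : X → List ℤ) : Prop :=
  ∃ fs : List (X → ℤ), (∀ x, L x = fs.map fun f => f x) ∧ fs.length ≤ l ∧ ∀ f ∈ fs, p f

theorem Listed.imp {l : ℕ} {L : X → List ℤ} (h : Listed p l L) (hpq : ∀ f, p f → q f) :
    Listed q l L := by
  obtain ⟨fs, h1, h2, h3⟩ := h
  exact ⟨fs, h1, h2, fun f hf => hpq f (h3 f hf)⟩

theorem Listed.mono {l l' : ℕ} {L : X → List ℤ} (h : Listed p l L) (hl : l ≤ l') :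
    Listed p l' L := by
  obtain ⟨fs, h1, h2, h3⟩ := h
  exact ⟨fs, h1, h2.trans hl, h3⟩

theorem Listed.nil {l : ℕ} : Listed p l fun _ => [] := ⟨[], fun _ => rfl, Nat.zero_le _, by simp⟩

theorem Listed.append {l l' : ℕ} {L L' : X → List ℤ} (h : Listed p l L) (h' : Listed p l' L') :
    Listed p (l + l') fun x => L x ++ L' x := by
  obtain ⟨fs, h1, h2, h3⟩ := h
  obtain ⟨gs, h1', h2', h3'⟩ := h'
  refine ⟨fs ++ gs, fun x => by simp only [h1, h1', List.map_append], ?_, fun f hf => ?_⟩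
  · rw [List.length_append]
    exact add_le_add h2 h2'
  · exact (List.mem_append.1 hf).elim (h3 f) (h3' f)

theorem Listed.flatMap {ι : Type} {l : ℕ} (S : List ι) {L : ι → X → List ℤ}
    (h : ∀ i ∈ S, Listed p l (L i)) : Listed p (S.length * l) fun x => S.flatMap fun i => L i x := by
  induction S with
  | nil => exact Listed.nil
  | cons i S ih =>
    refine ((h i List.mem_cons_self).append
      (ih fun j hj => h j (List.mem_cons_of_mem _ hj))).mono (le_of_eq ?_)
    rw [List.length_cons, Nat.succ_mul, add_comm]

theorem Listed.ite {l : ℕ} (c : Prop) [Decidable c] {L L' : X → List ℤ} (h : c → Listed p l L)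
    (h' : ¬c → Listed p l L') : Listed p l fun x => if c then L x else L' x := by
  split_ifs with hc
  · exact h hc
  · exact h' hc

theorem EachCoord.listed [Ser α] [LawfulSer α] {a : X → α} (h : EachCoord p a) :
    Listed p (dim α) fun x => Ser.ser (a x) := by
  refine ⟨Coords.coords.map fun f x => f (a x), fun x => ?_, by simp [dim], fun f hf => ?_⟩
  · simp only [LawfulSer.ser_eq, List.map_map]
    rfl
  · obtain ⟨g, hg, rfl⟩ := List.mem_map.1 hf
    exact h g hg

/-- Structured data are computed coordinate by coordinate. -/
theorem EachCoord.reach {b : Budget} {A : Set (X → ℤ)} {e : ℕ} {a : X → α}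
    (h : EachCoord (Cx b A e) a) :
    ∃ n B, n ≤ dim α * b.s ^ e ∧ Reach b.M A n B ∧ EachCoord (· ∈ B) a := by
  obtain ⟨n, B, hn, hr, hB⟩ := Reach.family (b := b) (A := A)
    (Coords.coords.map fun (f : α → ℤ) x => f (a x)) (fun f hf => by
      obtain ⟨g, hg, rfl⟩ := List.mem_map.1 hf
      exact h g hg)
  refine ⟨n, B, by simpa [dim] using hn, hr, fun f hf => hB _ (List.mem_map.2 ⟨f, hf, rfl⟩)⟩

theorem Listed.reach {b : Budget} {A : Set (X → ℤ)} {e l : ℕ} {L : X → List ℤ}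
    (h : Listed (Cx b A e) l L) :
    ∃ n B, n ≤ l * b.s ^ e ∧ Reach b.M A n B ∧ Listed (· ∈ B) l L := by
  obtain ⟨fs, h1, h2, h3⟩ := h
  obtain ⟨n, B, hn, hr, hB⟩ := Reach.family (b := b) (A := A) fs h3
  exact ⟨n, B, hn.trans (Nat.mul_le_mul_right _ h2), hr, fs, h1, h2, hB⟩

theorem Listed.impl_pure {A : Set (X → ℤ)} {l : ℕ} {L : X → List ℤ} (h : Listed (· ∈ A) l L) :
    Impl A l fun x => PMF.pure (L x) := by
  obtain ⟨fs, h1, h2, h3⟩ := h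
  exact ((Impl.pure fs h3).mono subset_rfl h2).congr fun x => by rw [h1]

theorem Listed.impl_call {A : Set (X → ℤ)} {l : ℕ} {L : X → List ℤ} (D : Circuit)
    (h : Listed (· ∈ A) l L) : Impl A (1 + D.size) fun x => D.run (L x) := by
  obtain ⟨fs, h1, h2, h3⟩ := h
  exact (Impl.call D fs h3).congr fun x => by rw [h1]

end Coords

/-! ### Sampling structured data -/

section Samplable

variable {α β : Type} [Fintype α] [Nonempty α] [Coords α] [Fintype β] [Nonempty β] [Coords β]

/-- The quantities available after structured data are drawn. -/
def withCoins {X : Type} (A : Set (X → ℤ)) (α : Type) [Coords α] : Set (X × α → ℤ) :=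
  {f | (∃ g ∈ A, f = fun y => g y.1) ∨ ∃ g ∈ Coords.coords (α := α), f = fun y => g y.2}

/-- Uniform elements of `α` can be drawn by a program, at the cost `W` for each coordinate. -/
def Samplable (W : ℕ) (α : Type) [Fintype α] [Nonempty α] [Coords α] : Prop :=
  ∀ ⦃X : Type⦄ ⦃A : Set (X → ℤ)⦄ ⦃c : ℕ⦄ ⦃κ : X × α → PMF (List ℤ)⦄,
    Impl (withCoins A α) c κ →
      Impl A (dim α * W + c) fun x => (PMF.uniformOfFintype α).bind fun a => κ (x, a)

theorem Samplable.fin {b : Budget} {m : ℕ} (h : m ≤ b.M) : Samplable b.W (Fin (m + 1)) := by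
  intro X A c κ hκ
  refine (Impl.rand m (hκ.mono ?_ le_rfl)).mono subset_rfl ?_
  · rintro f (⟨g, hg, rfl⟩ | ⟨g, hg, rfl⟩)
    · exact Or.inl ⟨g, hg, rfl⟩
    · simp only [Coords.coords, List.mem_singleton] at hg
      subst hg
      exact Or.inr rfl
  · have := Nat.size_le_size h
    simp only [dim, Coords.coords, Budget.W, List.length_singleton, one_mul]
    omega

theorem Samplable.of_equiv {W : ℕ} (h : Samplable W α) (e : α ≃ β) (hdim : dim α = dim β)
    (hmem : ∀ g ∈ Coords.coords (α := β), (fun a => g (e a)) ∈ Coords.coords (α := α)) :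
    Samplable W β := by
  intro X A c κ hκ
  have h1 := h (A := A) (κ := fun y => κ (y.1, e y.2))
    ((hκ.reindex fun y : X × α => (y.1, e y.2)).mono (by
      rintro _ ⟨f, ⟨g, hg, rfl⟩ | ⟨g, hg, rfl⟩, rfl⟩
      · exact Or.inl ⟨g, hg, rfl⟩
      · exact Or.inr ⟨_, hmem g hg, rfl⟩) le_rfl)
  rw [hdim] at h1
  refine h1.congr fun x => ?_
  rw [← uniform_equiv e, PMF.bind_map]
  rfl

theorem Samplable.prod {W : ℕ} (hα : Samplable W α) (hβ : Samplable W β) :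
    Samplable W (α × β) := by
  intro X A c κ hκ
  have h1 := hβ (X := X × α) (A := withCoins A α) (κ := fun y => κ (y.1.1, y.1.2, y.2))
    ((hκ.reindex fun y : (X × α) × β => (y.1.1, y.1.2, y.2)).mono (by
      rintro _ ⟨f, ⟨g, hg, rfl⟩ | ⟨g, hg, rfl⟩, rfl⟩
      · exact Or.inl ⟨_, Or.inl ⟨g, hg, rfl⟩, rfl⟩
      · simp only [Coords.coords, List.mem_append, List.mem_map] at hg
        rcases hg with ⟨g, hg, rfl⟩ | ⟨g, hg, rfl⟩
        · exact Or.inl ⟨_, Or.inr ⟨g, hg, rfl⟩, rfl⟩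
        · exact Or.inr ⟨g, hg, rfl⟩) le_rfl)
  refine ((hα h1).mono subset_rfl (le_of_eq ?_)).congr fun x => ?_
  · rw [dim_prod]
    ring
  · rw [uniform_prod, PMF.bind_bind]
    simp only [PMF.bind_map]
    rfl

theorem Samplable.pi {W n : ℕ} {β : Fin n → Type} [∀ i, Fintype (β i)] [∀ i, Nonempty (β i)]
    [∀ i, Coords (β i)] (h : ∀ i, Samplable W (β i)) : Samplable W (∀ i, β i) := by
  induction n with
  | zero =>
    intro X A c κ hκ
    let a₀ : ∀ i, β i := fun i => i.elim0
    refine ((hκ.reindex fun x => (x, a₀)).mono ?_ (by simp [dim, Coords.coords])).congr fun x => ?_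
    · rintro _ ⟨f, ⟨g, hg, rfl⟩ | ⟨g, hg, rfl⟩, rfl⟩
      · exact hg
      · simp [Coords.coords] at hg
    · have : PMF.uniformOfFintype (∀ i, β i) = PMF.pure a₀ := by
        ext a
        have ha : a = a₀ := Subsingleton.elim _ _
        subst ha
        simp
      rw [this, PMF.pure_bind]
  | succ n ih =>
    have hrest : Samplable W (∀ i : Fin n, β i.succ) := ih fun i => h i.succ
    refine Samplable.of_equiv (Samplable.prod (h 0) hrest) (Fin.consEquiv β) ?_ ?_
    · rw [dim_prod]
      simp only [dim, Coords.coords, List.finRange_succ, List.flatMap_cons, List.length_append,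
        List.length_map, List.length_flatMap, List.map_map]
      rfl
    · intro g hg
      simp only [Coords.coords, List.mem_flatMap, List.mem_map, List.mem_finRange, true_and] at hg
      obtain ⟨i, g, hg, rfl⟩ := hg
      simp only [Coords.coords, List.mem_append, List.mem_map, List.mem_flatMap, List.mem_finRange,
        true_and]
      induction i using Fin.cases with
      | zero => exact Or.inl ⟨g, hg, rfl⟩
      | succ i => exact Or.inr ⟨_, ⟨i, g, hg, rfl⟩, rfl⟩

end Samplable

/-! ### Cost of ring arithmetic -/

/-- A modulus that fits into the budget. -/
def Budget.IsModulus (b : Budget) (Q : ℕ) : Prop := 0 < Q ∧ Q ≤ b.M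

section Ring

variable {X : Type} {b : Budget} {A : Set (X → ℤ)} {e Q n : ℕ}

/-- The coefficients of a ring element modulo `Q` are each computed by at most `s ^ e`
instructions. -/
def Pm (b : Budget) (A : Set (X → ℤ)) (e Q : ℕ) (a : X → Poly n) : Prop :=
  ∀ k, Cm b A e Q fun x => a x k

variable {a a' : X → Poly n}

theorem Pm.up {e' : ℕ} (h : Pm b A e Q a) (he : e ≤ e' := by omega) : Pm b A e' Q a :=
  fun k => (h k).up he

theorem Pm.of_eachCoord (h : EachCoord (Cx b A e) a) (hQ : b.IsModulus Q) : Pm b A (e + 1) Q a :=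
  fun k => Cx.mod (eachCoord_poly.1 h k) hQ.1 hQ.2

theorem Pm.add (h : Pm b A e Q a) (h' : Pm b A e Q a') (hQ : b.IsModulus Q) :
    Pm b A (e + 1) Q fun x => a x + a' x :=
  fun k => (h k).add (h' k) hQ.1 hQ.2

theorem Pm.sub (h : Pm b A e Q a) (h' : Pm b A e Q a') (hQ : b.IsModulus Q) :
    Pm b A (e + 1) Q fun x => a x - a' x :=
  fun k => (h k).sub (h' k) hQ.1 hQ.2

theorem Pm.neg (h : Pm b A e Q a) (hQ : b.IsModulus Q) : Pm b A (e + 1) Q fun x => -a x :=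
  fun k => (h k).neg hQ.1 hQ.2

theorem Pm.const (c : Poly n) (hQ : b.IsModulus Q) : Pm b A e Q fun _ => c :=
  fun k => Cm.const (c k) hQ.1 hQ.2

theorem Pm.const_mul (z : ℤ) (h : Pm b A e Q a) (hQ : b.IsModulus Q) :
    Pm b A (e + 1) Q fun x k => z * a x k :=
  fun k => (Cm.const z hQ.1 hQ.2).mul (h k) hQ.1 hQ.2

theorem Pm.sum {ι : Type} (S : Finset ι) {a : ι → X → Poly n} (hS : S.card ≤ b.s)
    (h : ∀ i ∈ S, Pm b A e Q (a i)) (hQ : b.IsModulus Q) :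
    Pm b A (e + 2) Q fun x => ∑ i ∈ S, a i x := by
  intro k
  simp only [Finset.sum_apply]
  exact Cm.sum S hS (fun i hi => h i hi k) hQ.1 hQ.2

theorem Pm.pmul (h : Pm b A e Q a) (h' : Pm b A e Q a') (hQ : b.IsModulus Q) (hn : n ≤ b.s) :
    Pm b A (e + 6) Q fun x => pmul (a x) (a' x) := by
  intro k
  have hc : (Finset.univ : Finset (Fin n)).card ≤ b.s := by simpa using hn
  refine Cm.sum _ hc (fun i _ => Cm.sum _ hc (fun j _ => ?_) hQ.1 hQ.2) hQ.1 hQ.2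
  have hm := (h i).mul (h' j) hQ.1 hQ.2
  exact Cm.ite _ (fun _ => hm.up) fun _ =>
    Cm.ite _ (fun _ => hm.neg hQ.1 hQ.2) fun _ => Cm.zero hQ.1 hQ.2

theorem Pm.autom (g : ℕ) (h : Pm b A e Q a) (hQ : b.IsModulus Q) (hn : n ≤ b.s) :
    Pm b A (e + 3) Q fun x => autom g (a x) := by
  intro k
  refine Cm.sum _ (by simpa using hn) (fun i _ => ?_) hQ.1 hQ.2
  exact Cm.ite _ (fun _ => (h i).up) fun _ =>
    Cm.ite _ (fun _ => (h i).neg hQ.1 hQ.2) fun _ => Cm.zero hQ.1 hQ.2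

theorem Pm.red (h : Pm b A e Q a) : EachCoord (Cx b A e) fun x => red Q (a x) :=
  eachCoord_poly.2 h

end Ring

/-! ### Cost of the cryptosystem -/

/-- The parameters of a cryptosystem with `N` users fit into the budget. -/
structure Fits (b : Budget) (pp : Params) (N : ℕ) : Prop where
  deg : pp.deg ≤ b.s
  digits : pp.digits ≤ b.s
  errThr : pp.errThr.length ≤ b.s
  users : N ≤ b.s
  Qmax : 2 * 2 ^ pp.prec * pp.Qmax ≤ b.M
  base : pp.base ^ (pp.digits + 1) ≤ b.M
  errCoin : pp.errCoin + 1 ≤ b.M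
  mask : 2 * pp.mask ≤ b.M
  errOff : pp.errOff.natAbs ≤ b.M

section Params

variable {pp : Params}

theorem Params.q_pos {i : ℕ} (hi : i ≤ pp.levels) : 0 < pp.q i := (pp.prime_q i hi).pos

theorem Params.Q_pos {l : ℕ} (hl : l ≤ pp.levels) : 0 < pp.Q l :=
  Finset.prod_pos fun i hi => Params.q_pos (by have := Finset.mem_range.1 hi; omega)

theorem Params.Qmax_pos : 0 < pp.Qmax := Params.Q_pos le_rfl

theorem Params.Q_dvd {l : ℕ} (hl : l ≤ pp.levels) : pp.Q l ∣ pp.Qmax :=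
  Finset.prod_dvd_prod_of_subset _ _ _
    (Finset.range_subset_range.2 (Nat.succ_le_succ hl))

theorem Params.Q_succ (pp : Params) (l : ℕ) : pp.Q (l + 1) = pp.Q l * pp.q (l + 1) :=
  Finset.prod_range_succ _ _

theorem Params.slots_le : pp.slots ≤ pp.deg := Nat.pow_le_pow_right (by norm_num) (by omega)

variable {b : Budget} {N : ℕ} (hb : Fits b pp N)
include hb

theorem Fits.slots : pp.slots ≤ b.s := Params.slots_le.trans hb.deg

theorem Fits.two_mul_Qmax_le : 2 * pp.Qmax ≤ b.M := by
  refine le_trans ?_ hb.Qmax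
  have : 1 ≤ 2 ^ pp.prec := Nat.one_le_two_pow
  exact Nat.mul_le_mul_right _ (by omega)

theorem Fits.Qmax_le : pp.Qmax ≤ b.M := by
  have := hb.two_mul_Qmax_le
  omega

theorem Fits.isModulus {l : ℕ} (hl : l ≤ pp.levels) : b.IsModulus (pp.Q l) :=
  ⟨Params.Q_pos hl, (Nat.le_of_dvd Params.Qmax_pos (Params.Q_dvd hl)).trans hb.Qmax_le⟩

theorem Fits.isModulus_Qmax : b.IsModulus pp.Qmax := hb.isModulus le_rfl

theorem Fits.base_pow_le {t : ℕ} (ht : t ≤ pp.digits + 1) : pp.base ^ t ≤ b.M :=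
  (Nat.pow_le_pow_right (by have := pp.two_le_base; omega) ht).trans hb.base

theorem Fits.base_isModulus : b.IsModulus pp.base := by
  refine ⟨by have := pp.two_le_base; omega, ?_⟩
  simpa using hb.base_pow_le (t := 1) (by omega)

end Params

section Crypto

variable {pp : Params} {X : Type} {b : Budget} {A : Set (X → ℤ)} {e Q N : ℕ} (hb : Fits b pp N)

theorem Pm.ter {u : X → TerCoins pp} (hu : EachCoord (Cx b A e) u) (hQ : b.IsModulus Q) :
    Pm b A (e + 2) Q fun x => ter (u x) := by
  intro k
  exact (Cx.mod (eachCoord_fin.1 (hu.apply k)) hQ.1 hQ.2).sub (Cm.const 1 hQ.1 hQ.2) hQ.1 hQ.2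

theorem Pm.bdd {B : ℕ} {u : X → BddCoins pp B} (hu : EachCoord (Cx b A e) u)
    (hQ : b.IsModulus Q) : Pm b A (e + 2) Q fun x => bdd (u x) := by
  intro k
  exact (Cx.mod (eachCoord_fin.1 (hu.apply k)) hQ.1 hQ.2).sub (Cm.const B hQ.1 hQ.2) hQ.1 hQ.2

theorem Pm.uni {u : X → UniCoins pp} (hu : EachCoord (Cx b A e) u) (hQ : b.IsModulus Q) :
    Pm b A (e + 1) Q fun x => uni (u x) := by
  intro k
  exact Cx.mod (eachCoord_fin.1 (hu.apply k)) hQ.1 hQ.2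

theorem countP_eq_sum (l : List ℕ) (p : ℕ → Bool) :
    ((l.countP p : ℕ) : ℤ) = ∑ i : Fin l.length, if p l[i] then 1 else 0 := by
  induction l with
  | nil => simp
  | cons t l ih =>
    rw [List.countP_cons]
    push_cast
    rw [ih, add_comm]
    exact (Fin.sum_univ_succ (n := l.length)
      (fun i => if p ((t :: l)[i]) then (1 : ℤ) else 0)).symm

include hb

theorem Pm.err {u : X → ErrCoins pp} (hu : EachCoord (Cx b A e) u) (hQ : b.IsModulus Q) :
    Pm b A (e + 5) Q fun x => err (u x) := by
  intro k
  have huk := eachCoord_fin.1 (hu.apply k)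
  refine Cm.add (Cm.const _ hQ.1 hQ.2) ?_ hQ.1 hQ.2
  simp only [countP_eq_sum]
  refine Cm.sum _ (by simpa using hb.errThr) (fun i _ => ?_) hQ.1 hQ.2
  -- Thresholds above the range of the coins may be lowered to the end of the range.
  refine (Cx.mod ((Cx.const ((min pp.errThr[i] (pp.errCoin + 1) : ℕ) : ℤ)
    ((Int.natAbs_natCast _).trans_le ((min_le_right _ _).trans hb.errCoin))).le huk) hQ.1 hQ.2).congr
    fun x => ?_
  have hlt := (u x k).2
  have : ((min pp.errThr[i] (pp.errCoin + 1) : ℕ) : ℤ) ≤ ((u x k : ℕ) : ℤ) ↔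
      pp.errThr[i] ≤ (u x k : ℕ) := by
    rw [Nat.cast_le, min_le_iff]
    exact ⟨fun h => h.elim id fun h' => by omega, Or.inl⟩
  simp only [this, decide_eq_true_eq]
  exact Int.ModEq.refl _

theorem enc_cx {p : X → Ct pp} {m : X → RPoly pp} {r : X → EncCoins pp}
    (hp₁ : Pm b A e Q fun x => (p x).1) (hp₂ : Pm b A e Q fun x => (p x).2)
    (hm : Pm b A e Q m) (hr : EachCoord (Cx b A e) r) (hQ : b.IsModulus Q) :
    EachCoord (Cx b A (e + 10)) fun x => enc Q (p x) (m x) (r x) := by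
  have ht := Pm.ter hr.fst hQ
  refine eachCoord_prod.2 ⟨Pm.red ?_, Pm.red ?_⟩
  · exact ((((hp₁.up).pmul ht hQ hb.deg).add (Pm.err hb hr.snd.fst hQ).up hQ).add hm.up hQ).up
  · exact ((hp₂.up.pmul ht hQ hb.deg).add (Pm.err hb hr.snd.snd hQ).up hQ).up

theorem digit_cx (t : Fin pp.digits) {a : X → RPoly pp} (ha : EachCoord (Cx b A e) a)
    (hQ : b.IsModulus Q) : Pm b A (e + 2) Q fun x => digit t (a x) := by
  intro k
  have hbase := hb.base_isModulus
  have h := Cx.divMod (Q := pp.base) (eachCoord_poly.1 ha k)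
    (Cx.const ((pp.base : ℤ) ^ (t : ℕ)) (by
      rw [Int.natAbs_pow, Int.natAbs_natCast]
      exact hb.base_pow_le (by have := t.2; omega))) hbase.1 hbase.2
  exact Cx.mod h hQ.1 hQ.2

theorem gadgetMul_cx {a : X → RPoly pp} {K : X → Fin pp.digits → Ct pp}
    (ha : EachCoord (Cx b A e) a) (hK : EachCoord (Cx b A e) K) (hQ : b.IsModulus Q) :
    (Pm b A (e + 10) Q fun x => (gadgetMul (a x) (K x)).1) ∧
      Pm b A (e + 10) Q fun x => (gadgetMul (a x) (K x)).2 := by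
  have hc : (Finset.univ : Finset (Fin pp.digits)).card ≤ b.s := by simpa using hb.digits
  constructor
  · exact Pm.sum _ hc (fun t _ => (digit_cx hb t ha hQ).pmul
      (Pm.of_eachCoord (hK.apply t).fst hQ).up hQ hb.deg) hQ
  · exact Pm.sum _ hc (fun t _ => (digit_cx hb t ha hQ).pmul
      (Pm.of_eachCoord (hK.apply t).snd hQ).up hQ hb.deg) hQ

/-- The quantities that make up a public key. -/
structure KeyCx (b : Budget) (A : Set (X → ℤ)) (e : ℕ) (K : X → PubKey pp) : Prop where
  enc : EachCoord (Cx b A e) fun x => (K x).enc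
  rlk : EachCoord (Cx b A e) fun x => (K x).rlk
  rot : EachCoord (Cx b A e) fun x => (K x).rot

omit hb in
theorem getMeta_lvl_le {ms : List Meta} (hms : ∀ d ∈ ms, d.lvl ≤ pp.levels) (a : ℕ) :
    (getMeta ms a).lvl ≤ pp.levels := by
  unfold getMeta
  rw [List.getD_eq_getElem?_getD]
  cases h : ms[a]? with
  | none => exact Nat.zero_le _
  | some d => exact hms d (List.mem_of_getElem? h)

omit hb in
theorem zsmul_cx (z : ℤ) {a : X → RPoly pp} (ha : EachCoord (Cx b A e) a) (hQ : b.IsModulus Q) :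
    Pm b A (e + 2) Q fun x => z • a x := by
  have := (Pm.of_eachCoord ha hQ).const_mul z hQ
  intro k
  simpa only [Pi.smul_apply, smul_eq_mul] using this k

theorem rs_cx {l : ℕ} (hl : l ≤ pp.levels) (hl0 : l ≠ 0) {a : X → RPoly pp}
    (ha : EachCoord (Cx b A e) a) :
    Pm b A (e + 4) (pp.Q (l - 1)) fun x k => rdiv (a x k) (pp.q l) := by
  obtain ⟨l, rfl⟩ := Nat.exists_eq_succ_of_ne_zero hl0
  have hq : 0 < pp.q (l + 1) := Params.q_pos hl
  have hQ : 0 < pp.Q l := Params.Q_pos (by omega)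
  have hQ' : 2 * pp.q (l + 1) * pp.Q l ≤ b.M := by
    have h1 : 2 * pp.q (l + 1) * pp.Q l = 2 * pp.Q (l + 1) := by rw [Params.Q_succ]; ring
    have h2 : pp.Q (l + 1) ≤ pp.Qmax := Nat.le_of_dvd Params.Qmax_pos (Params.Q_dvd hl)
    have h3 := hb.two_mul_Qmax_le
    omega
  have hM : b.IsModulus (2 * pp.q (l + 1) * pp.Q l) := ⟨by positivity, hQ'⟩
  intro k
  have h1 := ((Cm.const (A := A) (e := e + 1) 2 hM.1 hM.2).mul
    (Pm.of_eachCoord ha hM k) hM.1 hM.2).add (Cm.const (pp.q (l + 1) : ℤ) hM.1 hM.2) hM.1 hM.2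
  refine (h1.div_const (D := 2 * pp.q (l + 1)) (by positivity) hQ hQ').congr fun x => ?_
  simp only [rdiv, Nat.succ_eq_add_one, Nat.cast_mul, Nat.cast_ofNat]
  exact Int.ModEq.refl _

theorem rescale_cx (s : ℚ) {a : X → RPoly pp}
    (ha : Pm b A e (2 * 2 ^ pp.prec * pp.Qmax) a) :
    Pm b A (e + 3) pp.Qmax fun x => rescale pp s (a x) := by
  have hM : b.IsModulus (2 * 2 ^ pp.prec * pp.Qmax) :=
    ⟨Nat.mul_pos (by positivity) Params.Qmax_pos, hb.Qmax⟩
  intro k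
  have h1 := ((Cm.const (A := A) (e := e) (2 * round ((pp.scale : ℚ) / s * 2 ^ pp.prec)) hM.1
    hM.2).mul (ha k) hM.1 hM.2).add (Cm.const (2 ^ pp.prec : ℤ) hM.1 hM.2) hM.1 hM.2
  refine (h1.div_const (D := 2 * 2 ^ pp.prec) (by positivity) Params.Qmax_pos hb.Qmax).congr
    fun x => ?_
  simp only [rescale, rdiv, Nat.cast_mul, Nat.cast_ofNat, Nat.cast_pow, mul_assoc]
  exact Int.ModEq.refl _

omit hb in
/-- The centered representative of a residue modulo `Q`, modulo some other modulus. -/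
theorem bmod_cx {Q' : ℕ} {f : X → ℤ} (hf : Cm b A e Q f) (hQ : b.IsModulus Q)
    (hQ' : b.IsModulus Q') : Cm b A (e + 4) Q' fun x => Int.bmod (f x) Q := by
  have hle := (Cx.const (A := A) (e := e) (((Q + 1) / 2 : ℕ) : ℤ)
    ((Int.natAbs_natCast _).trans_le (by have := hQ.2; have := hQ.1; omega))).le hf
  have h := (Cx.mod hf hQ'.1 hQ'.2).up.sub
    ((Cm.const (A := A) (e := e + 2) (Q : ℤ) hQ'.1 hQ'.2).mul
      (Cx.mod hle hQ'.1 hQ'.2) hQ'.1 hQ'.2) hQ'.1 hQ'.2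
  refine h.congr fun x => ?_
  have hx : Int.bmod (f x) Q = f x % (Q : ℤ) -
      (Q : ℤ) * if (((Q + 1) / 2 : ℕ) : ℤ) ≤ f x % (Q : ℤ) then 1 else 0 := by
    rw [Int.bmod]
    push_cast
    split_ifs <;> omega
  rw [hx]

theorem localOp_cx {K : X → PubKey pp} (hK : KeyCx b A 0 K) {ms : List Meta}
    (hms : ∀ d ∈ ms, d.lvl ≤ pp.levels) {cts : X → List (Ct pp)}
    (hcts : ∀ a, EachCoord (Cx b A 0) fun x => getCt pp (cts x) a) (o : LocalOp) :
    EachCoord (Cx b A 20) fun x => o.eval (K x) ms (cts x) := by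
  have hl := getMeta_lvl_le hms
  cases o with
  | pt u =>
    exact eachCoord_prod.2 ⟨(Pm.const _ hb.isModulus_Qmax).red,
      eachCoord_poly.2 fun k => Cx.const 0 (Nat.zero_le _)⟩
  | add a c =>
    have hQ : b.IsModulus (pp.Q (LocalOp.info pp ms (.add a c)).lvl) :=
      hb.isModulus ((min_le_left _ _).trans (hl a))
    refine eachCoord_prod.2 ⟨Pm.red ?_, Pm.red ?_⟩
    · exact ((zsmul_cx _ (hcts a).fst hQ).add (zsmul_cx _ (hcts c).fst hQ) hQ).up
    · exact ((zsmul_cx _ (hcts a).snd hQ).add (zsmul_cx _ (hcts c).snd hQ) hQ).up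
  | sub a c =>
    have hQ : b.IsModulus (pp.Q (LocalOp.info pp ms (.sub a c)).lvl) :=
      hb.isModulus ((min_le_left _ _).trans (hl a))
    refine eachCoord_prod.2 ⟨Pm.red ?_, Pm.red ?_⟩
    · exact ((zsmul_cx _ (hcts a).fst hQ).sub (zsmul_cx _ (hcts c).fst hQ) hQ).up
    · exact ((zsmul_cx _ (hcts a).snd hQ).sub (zsmul_cx _ (hcts c).snd hQ) hQ).up
  | mulPt a u =>
    have hQ := hb.isModulus (hl a)
    refine eachCoord_prod.2 ⟨Pm.red ?_, Pm.red ?_⟩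
    · exact ((Pm.of_eachCoord (hcts a).fst hQ).pmul (Pm.const _ hQ) hQ hb.deg).up
    · exact ((Pm.of_eachCoord (hcts a).snd hQ).pmul (Pm.const _ hQ) hQ hb.deg).up
  | mulCt a c =>
    have hQ := hb.isModulus ((min_le_left _ (getMeta ms c).lvl).trans (hl a))
    have hx₁ := Pm.of_eachCoord (hcts a).fst hQ
    have hx₂ := Pm.of_eachCoord (hcts a).snd hQ
    have hy₁ := Pm.of_eachCoord (hcts c).fst hQ
    have hy₂ := Pm.of_eachCoord (hcts c).snd hQ
    have hg := gadgetMul_cx hb (hx₂.pmul hy₂ hQ hb.deg).red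
      (hK.rlk.imp fun f hf => hf.up (e' := 7)) hQ
    refine eachCoord_prod.2 ⟨Pm.red ?_, Pm.red ?_⟩
    · exact ((hx₁.pmul hy₁ hQ hb.deg).up.add hg.1 hQ).up
    · exact (((hx₁.pmul hy₂ hQ hb.deg).add (hx₂.pmul hy₁ hQ hb.deg) hQ).up.add hg.2 hQ).up
  | rot a k =>
    have hQ := hb.isModulus (hl a)
    have hx₁ := Pm.of_eachCoord (hcts a).fst hQ
    have hx₂ := Pm.of_eachCoord (hcts a).snd hQ
    have hg := gadgetMul_cx hb
      (hx₂.autom (5 ^ (k % pp.slots)) hQ hb.deg).red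
      ((hK.rot.apply ⟨k % pp.slots, Nat.mod_lt _ pp.slots_pos⟩).imp
        fun f hf => hf.up (e' := 4)) hQ
    refine eachCoord_prod.2 ⟨Pm.red ?_, Pm.red ?_⟩
    · exact ((hx₁.autom _ hQ hb.deg).up.add hg.1 hQ).up
    · exact hg.2.up
  | rs a =>
    simp only [LocalOp.eval]
    by_cases h0 : (getMeta ms a).lvl = 0
    · simp only [if_pos h0]
      exact (hcts a).imp fun f hf => hf.up
    · simp only [if_neg h0]
      refine eachCoord_prod.2 ⟨Pm.red ?_, Pm.red ?_⟩
      · exact (rs_cx hb (hl a) h0 (hcts a).fst).up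
      · exact (rs_cx hb (hl a) h0 (hcts a).snd).up

/-- Cost of a share of `DBootstrap`. -/
theorem bootShare_cx {t : ℕ} {K : X → PubKey pp} (hK : KeyCx b A 0 K) {d : Meta}
    (hd : d.lvl ≤ pp.levels) {c : X → Ct pp} (hc : EachCoord (Cx b A 0) c) {sk : X → RPoly pp}
    (hsk : Pm b A 2 (pp.Q d.lvl) sk) {r : X → BootCoins pp t} (hr : EachCoord (Cx b A 0) r) :
    EachCoord (Cx b A 15) fun x => bootShare (K x) d (c x) (sk x) (r x) := by
  have hQ := hb.isModulus hd
  have hQ' := hb.isModulus_Qmax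
  have hM : b.IsModulus (2 * 2 ^ pp.prec * pp.Qmax) :=
    ⟨Nat.mul_pos (by positivity) Params.Qmax_pos, hb.Qmax⟩
  refine eachCoord_prod.2 ⟨Pm.red ?_, ?_⟩
  · exact (((((Pm.of_eachCoord hc.snd hQ).up (e' := 2)).pmul hsk hQ hb.deg).sub
      (Pm.bdd hr.fst hQ).up hQ).add (Pm.bdd hr.snd.fst hQ).up hQ).up
  · exact enc_cx hb (e := 5) (Pm.of_eachCoord hK.enc.fst hQ').up
      (Pm.of_eachCoord hK.enc.snd hQ').up (rescale_cx hb _ (Pm.bdd hr.fst hM))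
      (hr.snd.snd.imp fun f hf => hf.up) hQ'

/-- Cost of the result of `DBootstrap`, given the shares. -/
theorem bootOut_cx {d : Meta} (hd : d.lvl ≤ pp.levels) {c : X → Ct pp}
    (hc : EachCoord (Cx b A 0) c) {sh : X → Fin N → RPoly pp × Ct pp}
    (hsh : EachCoord (Cx b A e) sh) :
    EachCoord (Cx b A (e + 12)) fun x => bootOut d (c x) (sh x) := by
  have hQ := hb.isModulus hd
  have hQ' := hb.isModulus_Qmax
  have hM : b.IsModulus (2 * 2 ^ pp.prec * pp.Qmax) :=
    ⟨Nat.mul_pos (by positivity) Params.Qmax_pos, hb.Qmax⟩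
  have hcard : (Finset.univ : Finset (Fin N)).card ≤ b.s := by simpa using hb.users
  refine eachCoord_prod.2 ⟨Pm.red ?_, Pm.red ?_⟩
  · have h1 : Pm b A (e + 4) (pp.Q d.lvl) fun x => (c x).1 + ∑ i, (sh x i).1 :=
      ((Pm.of_eachCoord hc.fst hQ).up (e' := e + 3)).add
        (Pm.sum _ hcard (fun i _ => Pm.of_eachCoord (hsh.apply i).fst hQ) hQ) hQ
    have h2 : Pm b A (e + 8) (2 * 2 ^ pp.prec * pp.Qmax)
        fun x k => Int.bmod (((c x).1 + ∑ i, (sh x i).1) k) (pp.Q d.lvl) :=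
      fun k => bmod_cx (h1 k) hQ hM
    have h3 := Pm.sum Finset.univ hcard
      (fun i _ => Pm.of_eachCoord (hsh.apply i).snd.fst hQ') hQ'
    exact (rescale_cx hb d.scale h2).add h3.up hQ'
  · exact (Pm.sum Finset.univ hcard (fun i _ => Pm.of_eachCoord (hsh.apply i).snd.snd hQ') hQ').up

/-- Cost of a share of `DKeySwitch`. -/
theorem switchShare_cx {t : ℕ} {p : X → Ct pp} (hp : EachCoord (Cx b A 0) p) {d : Meta}
    (hd : d.lvl ≤ pp.levels) {c : X → Ct pp} (hc : EachCoord (Cx b A 0) c) {sk : X → RPoly pp}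
    (hsk : Pm b A 2 (pp.Q d.lvl) sk) {r : X → SwitchCoins pp t} (hr : EachCoord (Cx b A 0) r) :
    EachCoord (Cx b A 20) fun x => switchShare (p x) d (c x) (sk x) (r x) := by
  have hQ := hb.isModulus hd
  have hm := ((((Pm.of_eachCoord hc.snd hQ).up (e' := 2)).pmul hsk hQ hb.deg).add
      (Pm.bdd hr.fst hQ).up hQ)
  exact (enc_cx hb (e := 10) (Pm.of_eachCoord hp.fst hQ).up (Pm.of_eachCoord hp.snd hQ).up
    hm.up (hr.snd.imp fun f hf => hf.up) hQ)

/-- Cost of the result of `DKeySwitch`, given the shares. -/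
theorem switchOut_cx {d : Meta} (hd : d.lvl ≤ pp.levels) {c : X → Ct pp}
    (hc : EachCoord (Cx b A 0) c) {sh : X → Fin N → Ct pp} (hsh : EachCoord (Cx b A e) sh) :
    EachCoord (Cx b A (e + 4)) fun x => switchOut d (c x) (sh x) := by
  have hQ := hb.isModulus hd
  have hcard : (Finset.univ : Finset (Fin N)).card ≤ b.s := by simpa using hb.users
  refine eachCoord_prod.2 ⟨Pm.red ?_, Pm.red ?_⟩
  · exact ((Pm.of_eachCoord hc.fst hQ).up (e' := e + 3)).add
      (Pm.sum _ hcard (fun i _ => Pm.of_eachCoord (hsh.apply i).fst hQ) hQ) hQ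
  · exact (Pm.sum _ hcard (fun i _ => Pm.of_eachCoord (hsh.apply i).snd hQ) hQ).up

/-! ### Cost of key generation -/

omit hb in
theorem keyCoins_sk_cx {c : X → KeyCoins pp} (hc : EachCoord (Cx b A e) c) (hQ : b.IsModulus Q) :
    Pm b A (e + 2) Q fun x => KeyCoins.sk (c x) :=
  Pm.ter hc.fst hQ

theorem encKeyShare_cx {crs : X → CRS pp} (hcrs : EachCoord (Cx b A 0) crs)
    {c : X → KeyCoins pp} (hc : EachCoord (Cx b A 0) c) :
    EachCoord (Cx b A 10) fun x => encKeyShare (crs x) (c x) := by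
  have hQ := hb.isModulus_Qmax
  have h1 := (((Pm.uni hcrs.fst hQ).up (e' := 2)).pmul (keyCoins_sk_cx hc hQ) hQ hb.deg).neg hQ
  have h2 := (Pm.err hb hc.snd.snd.fst hQ).up (e' := 9)
  exact (h1.add h2 hQ).red

theorem rlkShare₁_cx {crs : X → CRS pp} (hcrs : EachCoord (Cx b A 0) crs)
    {c : X → KeyCoins pp} (hc : EachCoord (Cx b A 0) c) :
    EachCoord (Cx b A 11) fun x t => rlkShare₁ (crs x) (c x) t := by
  have hQ := hb.isModulus_Qmax
  refine eachCoord_pi.2 fun t => eachCoord_prod.2 ⟨Pm.red ?_, Pm.red ?_⟩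
  · exact (((((Pm.ter hc.snd.fst hQ).pmul (Pm.uni (hcrs.snd.fst.apply t) hQ).up hQ hb.deg).neg
      hQ).add ((keyCoins_sk_cx hc hQ).const_mul _ hQ).up hQ).add
        (Pm.err hb ((hc.snd.snd.snd.fst.apply 0).apply t) hQ).up hQ).up
  · exact (((keyCoins_sk_cx hc hQ).pmul (Pm.uni (hcrs.snd.fst.apply t) hQ).up hQ hb.deg).add
      (Pm.err hb ((hc.snd.snd.snd.fst.apply 1).apply t) hQ).up hQ).up

theorem rotKeyShare_cx {crs : X → CRS pp} (hcrs : EachCoord (Cx b A 0) crs)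
    {c : X → KeyCoins pp} (hc : EachCoord (Cx b A 0) c) :
    EachCoord (Cx b A 11) fun x k t => rotKeyShare (crs x) (c x) k t := by
  have hQ := hb.isModulus_Qmax
  refine eachCoord_pi.2 fun k => eachCoord_pi.2 fun t => Pm.red ?_
  exact ((((((Pm.uni ((hcrs.snd.snd.apply k).apply t) hQ).up (e' := 2)).pmul
    (keyCoins_sk_cx hc hQ) hQ hb.deg).neg hQ).add
      (((keyCoins_sk_cx hc hQ).autom _ hQ hb.deg).const_mul _ hQ).up hQ).add
        (Pm.err hb ((hc.snd.snd.snd.snd.apply k).apply t) hQ).up hQ).up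

/-- Cost of the aggregate of the first round, given its shares. -/
theorem rlkSum₁_cx {w : X → KeyRand pp N}
    (hs : EachCoord (Cx b A e) fun x i t => rlkShare₁ (w x).1 ((w x).2 i) t) :
    EachCoord (Cx b A (e + 3)) fun x t => rlkSum₁ (w x) t := by
  have hQ := hb.isModulus_Qmax
  have hcard : (Finset.univ : Finset (Fin N)).card ≤ b.s := by simpa using hb.users
  refine eachCoord_pi.2 fun t => eachCoord_prod.2 ⟨Pm.red ?_, Pm.red ?_⟩
  · exact Pm.sum _ hcard (fun i _ => Pm.of_eachCoord ((hs.apply i).apply t).fst hQ) hQ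
  · exact Pm.sum _ hcard (fun i _ => Pm.of_eachCoord ((hs.apply i).apply t).snd hQ) hQ

theorem rlkShare₂_cx {w : X → KeyRand pp N} (hw : EachCoord (Cx b A 0) w) (i : Fin N) :
    EachCoord (Cx b A 22) fun x t => rlkShare₂ (w x) i t := by
  have hQ := hb.isModulus_Qmax
  have hc := hw.snd.apply i
  have hs := rlkSum₁_cx hb (eachCoord_pi.2 fun i => rlkShare₁_cx hb hw.fst (hw.snd.apply i))
  refine eachCoord_pi.2 fun t => eachCoord_prod.2 ⟨Pm.red ?_, Pm.red ?_⟩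
  · exact (((keyCoins_sk_cx hc hQ).up.pmul (Pm.of_eachCoord (hs.apply t).fst hQ) hQ
      hb.deg).add (Pm.err hb ((hc.snd.snd.snd.fst.apply 2).apply t) hQ).up hQ).up
  · exact ((((Pm.ter hc.snd.fst hQ).sub (keyCoins_sk_cx hc hQ) hQ).up.pmul
      (Pm.of_eachCoord (hs.apply t).snd hQ) hQ hb.deg).add
        (Pm.err hb ((hc.snd.snd.snd.fst.apply 3).apply t) hQ).up hQ).up

end Crypto

/-! ### Executions in which one user is simulated -/

theorem expect_uniform_snoc {n : ℕ} (α : Fin (n + 1) → Type) [∀ i, Fintype (α i)]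
    [∀ i, Nonempty (α i)] (f : (∀ i, α i) → ℝ≥0∞) :
    expect (PMF.uniformOfFintype (∀ i, α i)) f =
      expect (PMF.uniformOfFintype (∀ i : Fin n, α i.castSucc)) fun ω =>
        expect (PMF.uniformOfFintype (α (Fin.last n))) fun a => f (Fin.snoc (α := α) ω a) := by
  rw [← expect_uniform_equiv (Fin.snocEquiv α), expect_uniform_prod, expect_comm]
  rfl

section SimulatedRun

variable (pp : Params) (N : ℕ)

/-- Coins of one step: coins for all users, and separate coins for the one encryption of the step
that hides the secrets of an honest party. -/
abbrev StepCoins (t : ℕ) := (Fin N → BootCoins pp t) × EncCoins pp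

/-- Key material used in an execution. -/
structure Env where
  key : PubKey pp
  sk : Fin N → RPoly pp
  srvKey : Ct pp

/-- State of an execution as seen by the colluding parties: the trace is replaced by their view of
it. -/
@[ext]
structure VState where
  infos : List Meta
  cts : List (Ct pp)
  view : List ℤ

variable {pp N}

/-- The key material that results from the key generations of the users and of the server. -/
def keyEnv (w : KeyRand pp N) (w' : KeyRand pp 1) : Env pp N :=
  ⟨pubKey w, fun i => KeyCoins.sk (w.2 i), (pubKey w').enc⟩

/-- Level and scale of the ciphertext appended by a step. -/
def stepMeta (pp : Params) (ms : List Meta) : Step N → Meta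
  | .input _ _ => ⟨pp.levels, pp.scale⟩
  | .op o => LocalOp.info pp ms o
  | .send a => getMeta ms a
  | .boot _ => ⟨pp.levels, pp.scale⟩
  | .keySwitch a => getMeta ms a

/-- The partial decryptions of all users but `h`. -/
def otherShares (h : Fin N) (sk : Fin N → RPoly pp) (c : Ct pp) : RPoly pp :=
  ∑ i ∈ Finset.univ.erase h, pmul c.2 (sk i)

/-- The plaintext of the distinguished encryption of a step. It is the plaintext of an input; the
mask of user `h` in a bootstrapping, or `0`; and in a key switch the partial decryption of user
`h`, computed from the plaintext `g.1` and the partial decryptions of the others, or `0`. -/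
def plain (h : Fin N) (E : Env pp N) {t : ℕ} (g : RPoly pp × Bool) (r : Fin N → BootCoins pp t)
    (ms : List Meta) (cts : List (Ct pp)) : Step N → RPoly pp
  | .input _ _ => red pp.Qmax g.1
  | .boot a =>
      if g.2 then red pp.Qmax (rescale pp (getMeta ms a).scale (bdd (r h).1)) else 0
  | .keySwitch a =>
      if g.2 then
        red (pp.Q (getMeta ms a).lvl)
          (g.1 - (getCt pp cts a).1 - otherShares h E.sk (getCt pp cts a) + bdd (r h).2.1)
      else 0
  | .op _ | .send _ => 0

/-- The key of the distinguished encryption of a step. -/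
def Env.encKey (E : Env pp N) : Step N → Ct pp
  | .keySwitch _ => E.srvKey
  | _ => E.key.enc

/-- Shares in `DBootstrap`, those of user `h` being derived from the plaintext `g`, which is opened,
and an encryption `c'` of the mask. -/
def bootShares (h : Fin N) (E : Env pp N) {t : ℕ} (g : RPoly pp) (r : Fin N → BootCoins pp t)
    (d : Meta) (c c' : Ct pp) : Fin N → RPoly pp × Ct pp := fun i =>
  if i = h then
    (red (pp.Q d.lvl) (g - c.1 - otherShares h E.sk c - bdd (r h).1 + bdd (r h).2.1), c')
  else bootShare E.key d c (E.sk i) (r i)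

/-- Shares in `DKeySwitch`, the one of user `h` being `c'`. -/
def switchShares (h : Fin N) (E : Env pp N) {t : ℕ} (r : Fin N → BootCoins pp t)
    (d : Meta) (c c' : Ct pp) : Fin N → Ct pp := fun i =>
  if i = h then (red (pp.Q d.lvl) c'.1, red (pp.Q d.lvl) c'.2)
  else switchShare E.srvKey d c (E.sk i) (r i).2

/-- Ciphertext appended by a step, and what the colluding parties see, if `c'` is the distinguished
ciphertext of the step. -/
noncomputable def output (h : Fin N) (A : Finset (Fin N)) (srv : Bool) (E : Env pp N) {t : ℕ}
    (g : RPoly pp) (a : StepCoins pp N t) (ms : List Meta) (cts : List (Ct pp)) (c' : Ct pp) :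
    Step N → Ct pp × List ℤ
  | .input p _ => (c', Event.view A srv (.enc p a.2))
  | .op o => (o.eval E.key ms cts, [])
  | .send b => (getCt pp cts b, Ser.ser (getCt pp cts b))
  | .boot b =>
      (bootOut (getMeta ms b) (getCt pp cts b)
          (bootShares h E g a.1 (getMeta ms b) (getCt pp cts b) c'),
        Event.view A srv
          (.boot t a.1 (bootShares h E g a.1 (getMeta ms b) (getCt pp cts b) c')))
  | .keySwitch b =>
      (switchOut (getMeta ms b) (getCt pp cts b)
          (switchShares h E a.1 (getMeta ms b) (getCt pp cts b) c'),
        Event.view A srv (.keySwitch t (fun i => (a.1 i).2)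
          (switchShares h E a.1 (getMeta ms b) (getCt pp cts b) c')))

/-- The distinguished ciphertext of a step. -/
def hidingCt (h : Fin N) (E : Env pp N) {t : ℕ} (g : RPoly pp × Bool) (a : StepCoins pp N t)
    (ms : List Meta) (cts : List (Ct pp)) (s : Step N) : Ct pp :=
  enc pp.Qmax (E.encKey s) (plain h E g a.1 ms cts s) a.2

/-- One step of an execution on given coins. The distinguished ciphertext may be overridden. -/
noncomputable def stepFn (h : Fin N) (A : Finset (Fin N)) (srv : Bool) (E : Env pp N) {t : ℕ}
    (ov : Option (Ct pp)) (g : RPoly pp × Bool) (a : StepCoins pp N t) (st : VState pp)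
    (s : Step N) : VState pp :=
  let o := output h A srv E g.1 a st.infos st.cts
    (ov.getD (hidingCt h E g a st.infos st.cts s)) s
  ⟨st.infos ++ [stepMeta pp st.infos s], st.cts ++ [o.1], st.view ++ o.2⟩

/-- Execution of a protocol on given coins. `g` provides the plaintexts from which the secrets of
honest parties are simulated, and `ov` overrides distinguished ciphertexts. -/
noncomputable def detRun (h : Fin N) (A : Finset (Fin N)) (srv : Bool) (E : Env pp N)
    (ov : ℕ → Option (Ct pp)) (g : ℕ → RPoly pp × Bool) (ω : ∀ t, StepCoins pp N t)
    (P : List (Step N)) : VState pp :=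
  P.foldl (fun st s => stepFn h A srv E (ov st.cts.length) (g st.cts.length) (ω st.cts.length) st s)
    ⟨[], [], []⟩

/-- One step of an execution on random coins. -/
noncomputable def simStep (h : Fin N) (A : Finset (Fin N)) (srv : Bool) (E : Env pp N)
    (g : ℕ → RPoly pp × Bool) (st : VState pp) (s : Step N) : PMF (VState pp) :=
  (PMF.uniformOfFintype (StepCoins pp N st.cts.length)).map fun a =>
    stepFn h A srv E none (g st.cts.length) a st s

/-- Coins of an execution of `T` steps. -/
abbrev RunCoins (pp : Params) (N T : ℕ) := ∀ t : Fin T, StepCoins pp N t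

instance (t : ℕ) : Inhabited (StepCoins pp N t) := ⟨(fun _ => (fun _ => 0, fun _ => 0, fun _ => 0,
  fun _ => 0, fun _ => 0), fun _ => 0, fun _ => 0, fun _ => 0)⟩

/-- Coins for all steps, arbitrary from step `T` on. -/
def extend {T : ℕ} (ω : RunCoins pp N T) (t : ℕ) : StepCoins pp N t :=
  if ht : t < T then ω ⟨t, ht⟩ else default

section

variable {h : Fin N} {A : Finset (Fin N)} {srv : Bool} {E : Env pp N}

theorem detRun_length (ov : ℕ → Option (Ct pp)) (g : ℕ → RPoly pp × Bool)
    (ω : ∀ t, StepCoins pp N t) (P : List (Step N)) :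
    (detRun h A srv E ov g ω P).cts.length = P.length := by
  induction P using List.reverseRecOn with
  | nil => rfl
  | append_singleton P s ih =>
    rw [detRun] at ih
    rw [detRun, List.foldl_append, List.foldl_cons, List.foldl_nil, stepFn, List.length_append, ih]
    simp

theorem detRun_snoc (ov : ℕ → Option (Ct pp)) (g : ℕ → RPoly pp × Bool)
    (ω : ∀ t, StepCoins pp N t) (P : List (Step N)) (s : Step N) :
    detRun h A srv E ov g ω (P ++ [s]) =
      stepFn h A srv E (ov P.length) (g P.length) (ω P.length) (detRun h A srv E ov g ω P) s := by
  have key : ∀ n, n = (detRun h A srv E ov g ω P).cts.length →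
      detRun h A srv E ov g ω (P ++ [s]) =
        stepFn h A srv E (ov n) (g n) (ω n) (detRun h A srv E ov g ω P) s := by
    rintro n rfl
    rw [detRun, List.foldl_append]
    rfl
  exact key _ (detRun_length ov g ω P).symm

theorem metas_snoc (P : List (Step N)) (s : Step N) :
    metas pp (P ++ [s]) = metas pp P ++ [stepMeta pp (metas pp P) s] := by
  rw [metas, List.foldl_append]
  rfl

/-- Two executions agree if each of their steps agrees on the state of the first one. -/
theorem detRun_congr {ov ov' : ℕ → Option (Ct pp)} {g g' : ℕ → RPoly pp × Bool}
    {ω ω' : ∀ t, StepCoins pp N t} {P : List (Step N)}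
    (H : ∀ t (ht : t < P.length),
      let st := detRun h A srv E ov g ω (P.take t)
      stepFn h A srv E (ov t) (g t) (ω t) st P[t] =
        stepFn h A srv E (ov' t) (g' t) (ω' t) st P[t]) :
    detRun h A srv E ov g ω P = detRun h A srv E ov' g' ω' P := by
  induction P using List.reverseRecOn with
  | nil => rfl
  | append_singleton P s ih =>
    have hP : detRun h A srv E ov g ω P = detRun h A srv E ov' g' ω' P := ih fun t ht => by
      have := H t (by simp; omega)
      rw [List.take_append_of_le_length ht.le, List.getElem_append_left ht] at this
      exact this
    have hs := H P.length (by simp)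
    rw [List.take_append_of_le_length le_rfl, List.take_length,
      List.getElem_append_right le_rfl] at hs
    rw [detRun_snoc, detRun_snoc, ← hP]
    simpa using hs

/-- An execution with step-by-step coins is an execution on coins drawn in advance. -/
theorem expect_foldlM_simStep (g : ℕ → RPoly pp × Bool) (P : List (Step N))
    (f : VState pp → ℝ≥0∞) :
    expect (P.foldlM (simStep h A srv E g) ⟨[], [], []⟩) f =
      expect (PMF.uniformOfFintype (RunCoins pp N P.length)) fun ω =>
        f (detRun h A srv E (fun _ => none) g (extend ω) P) := by
  induction P using List.reverseRecOn generalizing f with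
  | nil =>
    refine (expect_pure _ _).trans ?_
    exact (expect_const _ _).symm
  | append_singleton P s ih =>
    rw [List.foldlM_append]
    refine (expect_bind _ _ _).trans ?_
    rw [ih]
    have hlen : (P ++ [s]).length = P.length + 1 := by simp
    rw [hlen]
    refine Eq.trans ?_ (expect_uniform_snoc (fun t : Fin (P.length + 1) => StepCoins pp N t) _).symm
    refine congrArg _ (funext fun ω => ?_)
    refine (expect_bind _ _ _).trans ?_
    refine (congrArg _ (funext fun st => expect_pure st f)).trans ?_
    have hext : ∀ (a : StepCoins pp N P.length) (t : ℕ) (ht : t < P.length),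
        extend (Fin.snoc (α := fun t : Fin (P.length + 1) => StepCoins pp N t) ω a) t =
          extend ω t := fun a t ht => by
      have ht' : t < P.length + 1 := by omega
      simp only [extend, dif_pos ht, dif_pos ht']
      exact Fin.snoc_castSucc (α := fun t : Fin (P.length + 1) => StepCoins pp N t) a ω ⟨t, ht⟩
    have hlast : ∀ a : StepCoins pp N P.length,
        extend (Fin.snoc (α := fun t : Fin (P.length + 1) => StepCoins pp N t) ω a) P.length =
          a := fun a => by
      simp only [extend, dif_pos (Nat.lt_succ_self P.length)]
      exact Fin.snoc_last (α := fun t : Fin (P.length + 1) => StepCoins pp N t) a ω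
    have hfst : ∀ a : StepCoins pp N P.length,
        detRun h A srv E (fun _ => none) g
          (extend (Fin.snoc (α := fun t : Fin (P.length + 1) => StepCoins pp N t) ω a)) P =
        detRun h A srv E (fun _ => none) g (extend ω) P := fun a =>
      detRun_congr fun t ht => by simp only [hext a t ht]
    have hstep : ∀ n, n = (detRun h A srv E (fun _ => none) g (extend ω) P).cts.length →
        expect (PMF.uniformOfFintype (StepCoins pp N n)) (fun a => f (stepFn h A srv E none (g n) a
          (detRun h A srv E (fun _ => none) g (extend ω) P) s)) =
        expect (simStep h A srv E g (detRun h A srv E (fun _ => none) g (extend ω) P) s) f := by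
      rintro n rfl
      rw [simStep, expect_map]
    refine (hstep _ (detRun_length _ _ _ _).symm).symm.trans ?_
    refine congrArg _ (funext fun a => ?_)
    rw [detRun_snoc, hfst, hlast]

end

end SimulatedRun

/-! ### Statistical hiding of plaintexts by smudging errors and masks -/

section Smudge

variable {pp : Params} {N : ℕ}

/-- The coins of one step in which the separate encryption coins are used by user `h`. -/
def mergeCoins (h : Fin N) {t : ℕ} (a : StepCoins pp N t) : Fin N → BootCoins pp t :=
  Function.update a.1 h ((a.1 h).1, (a.1 h).2.1, a.2)

theorem expect_mergeCoins (h : Fin N) {t : ℕ} (F : (Fin N → BootCoins pp t) → ℝ≥0∞) :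
    expect (PMF.uniformOfFintype (StepCoins pp N t)) (fun a => F (mergeCoins h a)) =
      expect (PMF.uniformOfFintype (Fin N → BootCoins pp t)) F := by
  -- Exchanging the separate coins with the coins of user `h` is a permutation.
  let τ : StepCoins pp N t → StepCoins pp N t := fun a => (mergeCoins h a, (a.1 h).2.2)
  have hτ : Function.Involutive τ := by
    rintro ⟨r, r'⟩
    simp [τ, mergeCoins]
  have h1 := expect_uniform_equiv hτ.toPerm fun a : StepCoins pp N t => F a.1
  refine h1.trans ?_
  rw [expect_uniform_prod]
  exact congrArg _ (funext fun r => expect_const _ (F r))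

/-- The element of `{0, …, m}` congruent to `v`. -/
def shiftOf (m : ℕ) (v : ℤ) : Fin (m + 1) :=
  ⟨(v % ((m + 1 : ℕ) : ℤ)).toNat, by
    have h1 := Int.emod_nonneg v (by omega : ((m + 1 : ℕ) : ℤ) ≠ 0)
    have h2 := Int.emod_lt_of_pos v (by omega : (0 : ℤ) < ((m + 1 : ℕ) : ℤ))
    omega⟩

theorem add_shiftOf {m : ℕ} (u : Fin (m + 1)) {v : ℤ}
    (h : 0 ≤ ((u : ℕ) : ℤ) + v ∧ ((u : ℕ) : ℤ) + v < m + 1) :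
    (((u + shiftOf m v : Fin (m + 1)) : ℕ) : ℤ) = ((u : ℕ) : ℤ) + v := by
  have h1 := Int.emod_nonneg v (by omega : ((m + 1 : ℕ) : ℤ) ≠ 0)
  rw [Fin.val_add]
  simp only [shiftOf]
  rw [Int.natCast_mod, Nat.cast_add, Int.toNat_of_nonneg h1, Int.add_emod_emod]
  exact Int.emod_eq_of_lt h.1 (by push_cast; exact h.2)

theorem bdd_add_shiftOf {B : ℕ} (u : BddCoins pp B) (v : RPoly pp)
    (h : ∀ k, 0 ≤ ((u k : ℕ) : ℤ) + v k ∧ ((u k : ℕ) : ℤ) + v k < (2 * B : ℕ) + 1) :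
    bdd (u + fun k => shiftOf (2 * B) (v k)) = bdd u + v := by
  funext k
  simp only [bdd, Pi.add_apply]
  rw [add_shiftOf (u k) (h k)]
  ring

/-- Cyclic shift of the smudging error of user `h` by `v`. -/
def shiftErr (h : Fin N) {t : ℕ} (v : RPoly pp) : StepCoins pp N t ≃ StepCoins pp N t :=
  Equiv.addRight (Pi.single h (0, (fun k => shiftOf (2 * pp.smudge t) (v k)), 0), 0)

/-- Cyclic shift of the mask of user `h` by `v`. -/
def shiftMask (h : Fin N) {t : ℕ} (v : RPoly pp) : StepCoins pp N t ≃ StepCoins pp N t :=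
  Equiv.addRight (Pi.single h ((fun k => shiftOf (2 * pp.mask) (v k)), 0, 0), 0)

theorem shiftErr_apply (h : Fin N) {t : ℕ} (v : RPoly pp) (a : StepCoins pp N t) :
    shiftErr h v a = (Function.update a.1 h ((a.1 h).1,
      (a.1 h).2.1 + (fun k => shiftOf (2 * pp.smudge t) (v k)), (a.1 h).2.2), a.2) := by
  refine Prod.ext (funext fun i => ?_) (add_zero _)
  show a.1 i + (Pi.single h (0, (fun k => shiftOf (2 * pp.smudge t) (v k)), 0) :
    Fin N → BootCoins pp t) i = _
  by_cases hi : i = h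
  · subst hi
    simp only [Pi.single_eq_same, Function.update_self]
    exact Prod.ext (add_zero _) (Prod.ext rfl (add_zero _))
  · simp only [Pi.single_eq_of_ne hi, Function.update_of_ne hi, add_zero]

theorem shiftMask_apply (h : Fin N) {t : ℕ} (v : RPoly pp) (a : StepCoins pp N t) :
    shiftMask h v a = (Function.update a.1 h ((a.1 h).1 + (fun k => shiftOf (2 * pp.mask) (v k)),
      (a.1 h).2), a.2) := by
  refine Prod.ext (funext fun i => ?_) (add_zero _)
  show a.1 i + (Pi.single h ((fun k => shiftOf (2 * pp.mask) (v k)), 0, 0) :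
    Fin N → BootCoins pp t) i = _
  by_cases hi : i = h
  · subst hi
    simp only [Pi.single_eq_same, Function.update_self]
    exact Prod.ext rfl (add_zero _)
  · simp only [Pi.single_eq_of_ne hi, Function.update_of_ne hi, add_zero]

/-- A smudging error hides a shift by a small vector. -/
theorem expect_shiftErr (h : Fin N) {t : ℕ} (v : RPoly pp) {ε : ℝ}
    (hv : ∀ k, |(v k : ℝ)| ≤ ε * (2 * pp.smudge t + 1)) {f g : StepCoins pp N t → ℝ≥0∞}
    (hf : ∀ a, f a ≤ 1)
    (hfg : ∀ a, bdd ((shiftErr h v a).1 h).2.1 = bdd (a.1 h).2.1 + v → f a = g (shiftErr h v a)) :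
    expect (PMF.uniformOfFintype (StepCoins pp N t)) f ≤
      expect (PMF.uniformOfFintype (StepCoins pp N t)) g + pp.deg * ENNReal.ofReal ε := by
  have hπ : UniformCoord fun a : StepCoins pp N t => (a.1 h).2.1 :=
    uniformCoord_fst.comp (uniformCoord_snd.comp ((uniformCoord_eval h).comp uniformCoord_fst))
  refine expect_uniform_vector_shift hπ (shiftErr h v) v ε (by exact_mod_cast hv) hf
    fun a ha => hfg a ?_
  simp only [shiftErr_apply, Function.update_self]
  exact bdd_add_shiftOf _ v ha

/-- A mask hides a shift by a small vector. -/
theorem expect_shiftMask (h : Fin N) {t : ℕ} (v : RPoly pp) {ε : ℝ}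
    (hv : ∀ k, |(v k : ℝ)| ≤ ε * (2 * pp.mask + 1)) {f g : StepCoins pp N t → ℝ≥0∞}
    (hf : ∀ a, f a ≤ 1)
    (hfg : ∀ a, bdd ((shiftMask h v a).1 h).1 = bdd (a.1 h).1 + v → f a = g (shiftMask h v a)) :
    expect (PMF.uniformOfFintype (StepCoins pp N t)) f ≤
      expect (PMF.uniformOfFintype (StepCoins pp N t)) g + pp.deg * ENNReal.ofReal ε := by
  have hπ : UniformCoord fun a : StepCoins pp N t => (a.1 h).1 :=
    uniformCoord_fst.comp ((uniformCoord_eval h).comp uniformCoord_fst)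
  refine expect_uniform_vector_shift hπ (shiftMask h v) v ε (by exact_mod_cast hv) hf
    fun a ha => hfg a ?_
  simp only [shiftMask_apply, Function.update_self]
  exact bdd_add_shiftOf _ v ha

end Smudge

/-! ### The real execution with opened plaintexts replaced by exact ones -/

section Real

variable {pp : Params} {N : ℕ}

/-- The plaintexts from which an execution on inputs `x` is simulated: inputs and exact values of
opened ciphertexts, encoded. -/
noncomputable def realPlain (x : Party N → ℕ → Slots) (P : List (Step N)) (t : ℕ) :
    RPoly pp × Bool :=
  match P[t]? with
  | some (.input p j) => (red pp.Qmax (ecd pp (x p j) pp.scale), true)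
  | some (.boot a) | some (.keySwitch a) =>
      (red (pp.Q (getMeta (metas pp (P.take t)) a).lvl)
        (ecd pp (getVal (vals pp x (P.take t)) a) (getMeta (metas pp (P.take t)) a).scale), true)
  | _ => (0, false)

/-- What the colluding parties see of a state of the real execution. -/
def viewState (A : Finset (Fin N)) (srv : Bool) (st : State pp N) : VState pp :=
  ⟨st.infos, st.cts, st.trace.flatMap (Event.view A srv)⟩

theorem viewState_push (A : Finset (Fin N)) (srv : Bool) (st : State pp N) (d : Meta) (c : Ct pp)
    (e : Event pp N) : viewState A srv (st.push d c [e]) =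
      ⟨st.infos ++ [d], st.cts ++ [c], (viewState A srv st).view ++ e.view A srv⟩ := by
  simp [viewState, State.push]

theorem pmul_add {n : ℕ} (a b c : Poly n) : pmul a (b + c) = pmul a b + pmul a c := by
  funext k
  simp only [pmul, Pi.add_apply, ← Finset.sum_add_distrib]
  refine Finset.sum_congr rfl fun i _ => Finset.sum_congr rfl fun j _ => ?_
  split_ifs <;> ring

theorem pmul_sum {n : ℕ} {ι : Type} (a : Poly n) (S : Finset ι) (b : ι → Poly n) :
    pmul a (∑ i ∈ S, b i) = ∑ i ∈ S, pmul a (b i) := by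
  classical
  induction S using Finset.induction_on with
  | empty =>
    funext k
    simp [pmul]
  | insert i S hi ih => rw [Finset.sum_insert hi, Finset.sum_insert hi, pmul_add, ih]

theorem red_congr {n Q : ℕ} {a b : Poly n} (h : ∀ k, a k ≡ b k [ZMOD Q]) : red Q a = red Q b :=
  funext h

theorem red_red {n Q Q' : ℕ} (h : Q ∣ Q') (a : Poly n) : red Q (red Q' a) = red Q a :=
  funext fun _ => Int.emod_emod_of_dvd _ (by exact_mod_cast h)

theorem red_apply {n : ℕ} (Q : ℕ) (a : Poly n) (k : Fin n) : red Q a k = a k % Q := rfl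

theorem red_modEq {n : ℕ} (Q : ℕ) (a : Poly n) (k : Fin n) : red Q a k ≡ a k [ZMOD Q] :=
  Int.mod_modEq _ _

theorem enc_congr {Q : ℕ} (p : Ct pp) {m m' : RPoly pp} (r : EncCoins pp)
    (h : ∀ k, m k ≡ m' k [ZMOD Q]) : enc Q p m r = enc Q p m' r := by
  refine Prod.ext (red_congr fun k => ?_) rfl
  exact (h k).add_left _

theorem enc_of_dvd {Q Q' : ℕ} (hQ : Q ∣ Q') (p : Ct pp) (m : RPoly pp) (r : EncCoins pp) :
    (red Q (enc Q' p m r).1, red Q (enc Q' p m r).2) = enc Q p m r :=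
  Prod.ext (red_red hQ _) (red_red hQ _)

/-- If the opened plaintext is `g + v`, the partial decryption of user `h` results from `g` and the
partial decryptions of the others, up to the error `v`. -/
theorem pmul_sk_modEq {h : Fin N} {w : KeyRand pp N} {w' : KeyRand pp 1} {Q : ℕ} {c : Ct pp}
    (m : RPoly pp) (k : Fin pp.deg) :
    pmul c.2 (KeyCoins.sk (w.2 h)) k ≡
      m k - c.1 k - otherShares h (keyEnv w w').sk c k
        + Int.bmod ((dec Q (secKey w) c - m) k) Q [ZMOD Q] := by
  have h1 : pmul c.2 (secKey w) =
      pmul c.2 (KeyCoins.sk (w.2 h)) + otherShares h (keyEnv w w').sk c := by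
    rw [secKey, pmul_sum, ← Finset.add_sum_erase _ _ (Finset.mem_univ h)]
    rfl
  have h2 : Int.bmod ((dec Q (secKey w) c - m) k) Q ≡ (c.1 + pmul c.2 (secKey w)) k - m k
      [ZMOD Q] := by
    refine (Int.bmod_emod : _ = _).trans ?_
    exact Int.ModEq.sub_right _ Int.bmod_emod
  rw [h1] at h2
  refine Int.modEq_iff_dvd.2 ?_
  obtain ⟨z, hz⟩ := Int.modEq_iff_dvd.1 h2
  refine ⟨-z, ?_⟩
  simp only [Pi.add_apply] at hz
  linarith

theorem view_boot_congr {A : Finset (Fin N)} {srv : Bool} {t : ℕ} {r r' : Fin N → BootCoins pp t}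
    {sh sh' : Fin N → RPoly pp × Ct pp} (hr : ∀ i ∈ A, r i = r' i) (hsh : sh = sh') :
    (Event.boot t r sh).view A srv = (Event.boot t r' sh').view A srv := by
  subst hsh
  simp only [Event.view]
  congr 2
  funext i
  split_ifs with hi
  · rw [hr i hi]
  · rfl

theorem view_keySwitch_congr {A : Finset (Fin N)} {srv : Bool} {t : ℕ}
    {r r' : Fin N → SwitchCoins pp t} {sh sh' : Fin N → Ct pp} (hr : ∀ i ∈ A, r i = r' i)
    (hsh : sh = sh') :
    (Event.keySwitch t r sh).view A srv = (Event.keySwitch t r' sh').view A srv := by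
  subst hsh
  simp only [Event.view]
  congr 2
  funext i
  split_ifs with hi
  · rw [hr i hi]
  · rfl

theorem uniformCoord_piSnd {t : ℕ} :
    UniformCoord fun (r : Fin N → BootCoins pp t) i => (r i).2 :=
  uniformCoord_snd.comp (uniformCoord_equiv
    (Equiv.arrowProdEquivProdArrow (Fin N) (fun _ => BddCoins pp pp.mask)
      (fun _ => SwitchCoins pp t)))

variable {h : Fin N} {A : Finset (Fin N)} {srv : Bool} {w : KeyRand pp N} {w' : KeyRand pp 1}

/-- The real shares of `DBootstrap` are simulated shares with a shifted smudging error. -/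
theorem bootShare_eq_bootShares {t : ℕ} {d : Meta} {c : Ct pp}
    (m v : RPoly pp) (hv : ∀ k, v k = Int.bmod ((dec (pp.Q d.lvl) (secKey w) c - m) k) (pp.Q d.lvl))
    (a : StepCoins pp N t)
    (ha : bdd ((shiftErr h v a).1 h).2.1 = bdd (a.1 h).2.1 + v) :
    (fun i => bootShare (pubKey w) d c (KeyCoins.sk (w.2 i)) (mergeCoins h a i)) =
      bootShares h (keyEnv w w') (red (pp.Q d.lvl) m) (shiftErr h v a).1 d c
        (enc pp.Qmax (pubKey w).enc (red pp.Qmax (rescale pp d.scale (bdd ((shiftErr h v a).1 h).1)))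
          (shiftErr h v a).2) := by
  funext i
  by_cases hi : i = h
  · subst hi
    simp only [bootShares, if_pos, ha]
    simp only [bootShare, mergeCoins, shiftErr_apply, Function.update_self]
    refine Prod.ext (red_congr fun k => ?_) (enc_congr _ _ fun k => (red_modEq _ _ k).symm)
    have h1 := pmul_sk_modEq (h := i) (w := w) (w' := w') (c := c) (Q := pp.Q d.lvl) m k
    rw [← hv] at h1
    have h2 := (red_modEq (pp.Q d.lvl) m k).symm.trans (Int.ModEq.refl _)
    obtain ⟨y, hy⟩ := Int.modEq_iff_dvd.1 h1
    obtain ⟨z, hz⟩ := Int.modEq_iff_dvd.1 h2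
    refine Int.modEq_iff_dvd.2 ⟨y + z, ?_⟩
    simp only [Pi.add_apply, Pi.sub_apply]
    linear_combination hy + hz
  · simp only [bootShares, if_neg hi, mergeCoins, shiftErr_apply, Function.update_of_ne hi]
    rfl

/-- The real shares of `DKeySwitch` are simulated shares with a shifted smudging error. -/
theorem switchShare_eq_switchShares {t : ℕ} {d : Meta} (hd : d.lvl ≤ pp.levels) {c : Ct pp}
    (m v : RPoly pp) (hv : ∀ k, v k = Int.bmod ((dec (pp.Q d.lvl) (secKey w) c - m) k) (pp.Q d.lvl))
    (a : StepCoins pp N t)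
    (ha : bdd ((shiftErr h v a).1 h).2.1 = bdd (a.1 h).2.1 + v) :
    (fun i => switchShare (pubKey w').enc d c (KeyCoins.sk (w.2 i)) (mergeCoins h a i).2) =
      switchShares h (keyEnv w w') (shiftErr h v a).1 d c
        (enc pp.Qmax (pubKey w').enc (red (pp.Q d.lvl) (red (pp.Q d.lvl) m - c.1
          - otherShares h (keyEnv w w').sk c + bdd ((shiftErr h v a).1 h).2.1))
          (shiftErr h v a).2) := by
  funext i
  by_cases hi : i = h
  · subst hi
    simp only [switchShares, if_pos, ha]
    simp only [switchShare, mergeCoins, shiftErr_apply, Function.update_self]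
    rw [enc_of_dvd (Params.Q_dvd hd)]
    refine enc_congr _ _ fun k => ?_
    refine Int.ModEq.trans ?_ (red_modEq _ _ k).symm
    have h1 := pmul_sk_modEq (h := i) (w := w) (w' := w') (c := c) (Q := pp.Q d.lvl) m k
    rw [← hv] at h1
    have h2 := (red_modEq (pp.Q d.lvl) m k).symm
    obtain ⟨y, hy⟩ := Int.modEq_iff_dvd.1 h1
    obtain ⟨z, hz⟩ := Int.modEq_iff_dvd.1 h2
    refine Int.modEq_iff_dvd.2 ⟨y + z, ?_⟩
    simp only [Pi.add_apply, Pi.sub_apply]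
    linear_combination hy + hz
  · simp only [switchShares, if_neg hi, mergeCoins, shiftErr_apply, Function.update_of_ne hi]
    rfl

theorem mergeCoins_eq_shiftErr {t : ℕ} (v : RPoly pp) (a : StepCoins pp N t) {i : Fin N}
    (hi : i ≠ h) : mergeCoins h a i = (shiftErr h v a).1 i := by
  simp only [mergeCoins, shiftErr_apply, Function.update_of_ne hi]

/-- The noise of the ciphertexts opened by a step, relative to the exact plaintexts, is small. -/
def GoodStep (δ : ℝ) (x : Party N → ℕ → Slots) (P : List (Step N)) (w : KeyRand pp N)
    (st : State pp N) (s : Step N) : Prop :=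
  ∀ a, (s = Step.boot a ∨ s = Step.keySwitch a) →
    let d := getMeta st.infos a
    let m := ecd pp (getVal (vals pp x (P.take st.cts.length)) a) d.scale
    ∀ k, |((Int.bmod ((dec (pp.Q d.lvl) (secKey w) (getCt pp st.cts a) - m) k) (pp.Q d.lvl) : ℤ) : ℝ)|
      ≤ δ * (2 * pp.smudge st.cts.length + 1)

/-- The state is reached by the steps that precede `P'` in `P`. -/
def Reached (P : List (Step N)) (st : State pp N) (P' : List (Step N)) : Prop :=
  P = P.take st.cts.length ++ P' ∧ st.cts.length ≤ P.length ∧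
    st.infos = metas pp (P.take st.cts.length)

theorem Reached.getElem? {P P' : List (Step N)} {st : State pp N} {s : Step N}
    (hst : Reached P st (s :: P')) : P[st.cts.length]? = some s := by
  obtain ⟨h1, h2, -⟩ := hst
  conv_lhs => rw [h1]
  rw [List.getElem?_append_right (by simp), List.length_take, min_eq_left h2, Nat.sub_self]
  rfl

theorem expect_runStep_le (hA : h ∉ A) {δ : ℝ} {x : Party N → ℕ → Slots} {P P' : List (Step N)}
    {st : State pp N} {s : Step N} (hst : Reached P st (s :: P'))
    (hms : ∀ d ∈ st.infos, d.lvl ≤ pp.levels)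
    (hgood : GoodStep δ x P w st s) (f : VState pp → ℝ≥0∞) (hf : ∀ z, f z ≤ 1) :
    expect (runStep w (pubKey w').enc x st s) (fun z => f (viewState A srv z)) ≤
      expect (simStep h A srv (keyEnv w w') (realPlain x P) (viewState A srv st) s) f
        + pp.deg * ENNReal.ofReal δ := by
  have hget := hst.getElem?
  obtain ⟨-, -, hinfos⟩ := hst
  rw [simStep, expect_map]
  cases s with
  | input p j =>
    refine le_add_right (le_of_eq ?_)
    refine (expect_bind _ _ _).trans ?_
    refine Eq.trans (congrArg _ (funext fun r => expect_pure _ _)) ?_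
    refine Eq.trans ?_ (expect_uniform_prod _).symm
    refine Eq.trans (expect_const (PMF.uniformOfFintype (Fin N → BootCoins pp st.cts.length)) _).symm
      (congrArg _ (funext fun _ => congrArg _ (funext fun r => congrArg f ?_)))
    rw [viewState_push]
    have : realPlain x P st.cts.length = (red pp.Qmax (ecd pp (x p j) pp.scale), true) := by
      simp only [realPlain, hget]
    simp only [stepFn, output, hidingCt, plain, Option.getD_none, viewState, this, Env.encKey,
      stepMeta, keyEnv]
    rw [enc_congr (m := red pp.Qmax (red pp.Qmax (ecd pp (x p j) pp.scale)))
      (m' := ecd pp (x p j) pp.scale)]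
    exact fun k => (red_modEq _ _ k).trans (red_modEq _ _ k)
  | op o =>
    refine le_add_right (le_of_eq ?_)
    refine (expect_pure _ _).trans ?_
    refine Eq.symm (Eq.trans (congrArg _ (funext fun b => congrArg f ?_)) (expect_const _ _))
    simp [stepFn, output, viewState, stepMeta, State.push, keyEnv]
  | send a =>
    refine le_add_right (le_of_eq ?_)
    refine (expect_pure _ _).trans ?_
    refine Eq.symm (Eq.trans (congrArg _ (funext fun b => congrArg f ?_)) (expect_const _ _))
    simp [stepFn, output, viewState, stepMeta, State.push, Event.view]
  | boot a =>
    have hk := hgood a (Or.inl rfl)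
    have hpl : realPlain x P st.cts.length = (red (pp.Q (getMeta st.infos a).lvl)
        (ecd pp (getVal (vals pp x (P.take st.cts.length)) a) (getMeta st.infos a).scale), true) := by
      simp only [realPlain, hget, ← hinfos]
    refine (expect_bind _ _ _).trans_le ?_
    refine (Eq.trans (congrArg _ (funext fun r => expect_pure _ _))
      (expect_mergeCoins h _).symm).trans_le ?_
    refine expect_shiftErr h _ hk (fun _ => hf _) fun b hb => congrArg f ?_
    rw [viewState_push]
    have hsh := bootShare_eq_bootShares (h := h) (w := w) (w' := w') _ _
      (d := getMeta st.infos a) (fun k => rfl) b hb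
    simp only [stepFn, output, Option.getD_none, hidingCt, plain, viewState, Env.encKey, hpl, if_true]
    refine VState.ext rfl ?_ ?_
    · rw [hsh]
      rfl
    · refine congrArg (fun l => st.trace.flatMap (Event.view A srv) ++ l)
        (view_boot_congr (fun i hi => ?_) hsh)
      exact mergeCoins_eq_shiftErr _ b fun hih => hA (hih ▸ hi)
  | keySwitch a =>
    have hk := hgood a (Or.inr rfl)
    have hpl : realPlain x P st.cts.length = (red (pp.Q (getMeta st.infos a).lvl)
        (ecd pp (getVal (vals pp x (P.take st.cts.length)) a) (getMeta st.infos a).scale), true) := by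
      simp only [realPlain, hget, ← hinfos]
    refine (expect_bind _ _ _).trans_le ?_
    refine (Eq.trans (congrArg _ (funext fun r => expect_pure _ _)) ?_).trans_le
      (expect_shiftErr h _ hk (f := fun b => f (viewState A srv
        (st.push (getMeta st.infos a) (switchOut (getMeta st.infos a) (getCt pp st.cts a) fun i =>
          switchShare (pubKey w').enc (getMeta st.infos a) (getCt pp st.cts a)
            (KeyCoins.sk (w.2 i)) (mergeCoins h b i).2)
          [.keySwitch st.cts.length (fun i => (mergeCoins h b i).2) fun i =>
            switchShare (pubKey w').enc (getMeta st.infos a) (getCt pp st.cts a)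
              (KeyCoins.sk (w.2 i)) (mergeCoins h b i).2])))
        (fun _ => hf _) fun b hb => congrArg f ?_)
    · rw [expect_mergeCoins h fun r => f (viewState A srv
        (st.push (getMeta st.infos a) (switchOut (getMeta st.infos a) (getCt pp st.cts a) fun i =>
          switchShare (pubKey w').enc (getMeta st.infos a) (getCt pp st.cts a)
            (KeyCoins.sk (w.2 i)) (r i).2)
          [.keySwitch st.cts.length (fun i => (r i).2) fun i =>
            switchShare (pubKey w').enc (getMeta st.infos a) (getCt pp st.cts a)
              (KeyCoins.sk (w.2 i)) (r i).2])), ← uniformCoord_piSnd, expect_map]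
    · rw [viewState_push]
      have hsh := switchShare_eq_switchShares (h := h) (w := w) (w' := w') (getMeta_lvl_le hms a) _ _
        (fun k => rfl) b hb
      simp only [stepFn, output, Option.getD_none, hidingCt, plain, viewState, Env.encKey, hpl, if_true]
      refine VState.ext rfl ?_ ?_
      · rw [hsh]
        rfl
      · refine congrArg (fun l => st.trace.flatMap (Event.view A srv) ++ l)
          (view_keySwitch_congr (fun i hi => ?_) hsh)
        exact congrArg Prod.snd (mergeCoins_eq_shiftErr _ b fun hih => hA (hih ▸ hi))

end Real

section Hybrid

variable {pp : Params} {N : ℕ} {h : Fin N} {A : Finset (Fin N)} {srv : Bool}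

theorem stepMeta_lvl_le {ms : List Meta} (hms : ∀ d ∈ ms, d.lvl ≤ pp.levels) (s : Step N) :
    (stepMeta pp ms s).lvl ≤ pp.levels := by
  have hl := getMeta_lvl_le hms
  cases s with
  | input p j => exact le_rfl
  | op o =>
    cases o with
    | pt u => exact le_rfl
    | add a c => exact (min_le_left _ _).trans (hl a)
    | sub a c => exact (min_le_left _ _).trans (hl a)
    | mulPt a u => exact hl a
    | mulCt a c => exact (min_le_left _ _).trans (hl a)
    | rot a k => exact hl a
    | rs a =>
      simp only [stepMeta, LocalOp.info]
      split_ifs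
      · exact hl a
      · exact (Nat.sub_le _ _).trans (hl a)
  | send a => exact hl a
  | boot a => exact le_rfl
  | keySwitch a => exact hl a

theorem metas_lvl_le (P : List (Step N)) : ∀ d ∈ metas pp P, d.lvl ≤ pp.levels := by
  induction P using List.reverseRecOn with
  | nil => intro d hd; simp [metas] at hd
  | append_singleton P s ih =>
    rw [metas_snoc]
    intro d hd
    rcases List.mem_append.1 hd with hd | hd
    · exact ih d hd
    · rw [List.mem_singleton.1 hd]
      exact stepMeta_lvl_le ih s

/-- A step appends one ciphertext, of predetermined level and scale. -/
theorem runStep_support {w : KeyRand pp N} {p' : Ct pp} {x : Party N → ℕ → Slots}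
    {st z : State pp N} {s : Step N} (hz : z ∈ (runStep w p' x st s).support) :
    z.infos = st.infos ++ [stepMeta pp st.infos s] ∧ ∃ c, z.cts = st.cts ++ [c] := by
  cases s with
  | input p j =>
    obtain ⟨r, -, hr⟩ := (PMF.mem_support_bind_iff _ _ _).1 hz
    rw [(PMF.mem_support_pure_iff _ _).1 hr]
    exact ⟨rfl, _, rfl⟩
  | op o =>
    rw [(PMF.mem_support_pure_iff _ _).1 hz]
    exact ⟨rfl, _, rfl⟩
  | send a =>
    rw [(PMF.mem_support_pure_iff _ _).1 hz]
    exact ⟨rfl, _, rfl⟩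
  | boot a =>
    obtain ⟨r, -, hr⟩ := (PMF.mem_support_bind_iff _ _ _).1 hz
    rw [(PMF.mem_support_pure_iff _ _).1 hr]
    exact ⟨rfl, _, rfl⟩
  | keySwitch a =>
    obtain ⟨r, -, hr⟩ := (PMF.mem_support_bind_iff _ _ _).1 hz
    rw [(PMF.mem_support_pure_iff _ _).1 hr]
    exact ⟨rfl, _, rfl⟩

theorem foldlM_runStep_support {w : KeyRand pp N} {p' : Ct pp} {x : Party N → ℕ → Slots}
    {st z : State pp N} {P : List (Step N)}
    (hz : z ∈ (P.foldlM (runStep w p' x) st).support) : st.cts <+: z.cts := by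
  induction P generalizing st with
  | nil =>
    rw [(PMF.mem_support_pure_iff _ _).1 hz]
  | cons s P ih =>
    obtain ⟨y, hy, hz⟩ := (PMF.mem_support_bind_iff _ _ _).1 hz
    obtain ⟨-, c, hc⟩ := runStep_support hy
    exact (hc ▸ List.prefix_append _ _ : st.cts <+: y.cts).trans (ih hz)

theorem take_succ_append {α : Type} {P P' : List α} {n : ℕ} {s : α}
    (h : P = P.take n ++ s :: P') (hn : n ≤ P.length) :
    P = P.take (n + 1) ++ P' ∧ n + 1 ≤ P.length ∧ P.take (n + 1) = P.take n ++ [s] := by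
  have hlen : n < P.length := by
    have h' := congrArg List.length h
    simp only [List.length_append, List.length_take, min_eq_left hn, List.length_cons] at h'
    omega
  have hs : P[n] = s := by
    have : P[n]? = some s := by
      conv_lhs => rw [h]
      rw [List.getElem?_append_right (by simp), List.length_take, min_eq_left hn, Nat.sub_self]
      rfl
    exact (List.getElem?_eq_some_iff.1 this).2
  have htake : P.take (n + 1) = P.take n ++ [s] := by
    rw [List.take_succ_eq_append_getElem hlen, hs]
  refine ⟨?_, hlen, htake⟩
  rw [htake, List.append_assoc]
  exact h

/-- The real execution is close to the execution simulated from exact plaintexts, up to the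
probability that the computation is not accurate. -/
theorem expect_exec_le (hA : h ∉ A) {δ : ℝ} {x : Party N → ℕ → Slots} {P : List (Step N)}
    (w : KeyRand pp N) (w' : KeyRand pp 1) (f : VState pp → ℝ≥0∞) (hf : ∀ z, f z ≤ 1) :
    expect (exec w (pubKey w').enc x P) (fun z => f (viewState A srv z)) ≤
      expect (P.foldlM (simStep h A srv (keyEnv w w') (realPlain x P)) ⟨[], [], []⟩) f
        + P.length * (pp.deg * ENNReal.ofReal δ)
        + (exec w (pubKey w').enc x P).toOuterMeasure
            {z | ¬ Accurate δ P x (secKey w) z.cts} := by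
  refine expect_foldlM_le (runStep w (pubKey w').enc x) _ (viewState A srv) (GoodStep δ x P w)
    {z | ¬ Accurate δ P x (secKey w) z.cts} (Reached P) _ ?_ ?_ ?_ P ⟨[], [], []⟩
    ⟨rfl, Nat.zero_le _, rfl⟩ f hf
  · intro st s P' hst hgood f hf
    exact expect_runStep_le hA hst (by rw [hst.2.2]; exact metas_lvl_le _) hgood f hf
  · rintro st s P' ⟨h1, h2, h3⟩ z hz
    obtain ⟨hi, c, hc⟩ := runStep_support hz
    obtain ⟨h4, h5, h6⟩ := take_succ_append h1 h2
    have hlen : z.cts.length = st.cts.length + 1 := by simp [hc]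
    refine ⟨?_, ?_, ?_⟩
    · rw [hlen]; exact h4
    · rw [hlen]; exact h5
    · rw [hlen, h6, metas_snoc, hi, h3]
  · intro st s P' hst hgood z hz hacc
    obtain ⟨l, hl⟩ := foldlM_runStep_support hz
    refine hgood fun a ha => ?_
    have hget := hst.getElem?
    have := (hacc st.cts.length a (by
      rcases ha with rfl | rfl
      · exact Or.inl hget
      · exact Or.inr hget)).1
    rw [← hl, List.take_left, ← hst.2.2] at this
    exact this

/-- Acceptance of `F` in an execution with fresh keys that is simulated from the plaintexts `g`. -/
noncomputable def hybrid (h : Fin N) (A : Finset (Fin N)) (srv : Bool) (P : List (Step N))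
    (F : KeyRand pp N → KeyRand pp 1 → VState pp → ℝ≥0∞) (g : ℕ → RPoly pp × Bool) : ℝ≥0∞ :=
  expect (PMF.uniformOfFintype (KeyRand pp N)) fun w =>
    expect (PMF.uniformOfFintype (KeyRand pp 1)) fun w' =>
      expect (PMF.uniformOfFintype (RunCoins pp N P.length)) fun ω =>
        F w w' (detRun h A srv (keyEnv w w') (fun _ => none) g (extend ω) P)

variable {P : List (Step N)} {F : KeyRand pp N → KeyRand pp 1 → VState pp → ℝ≥0∞}

theorem hybrid_le_one (hF : ∀ w w' z, F w w' z ≤ 1) (g : ℕ → RPoly pp × Bool) :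
    hybrid h A srv P F g ≤ 1 :=
  expect_le_one _ fun _ => expect_le_one _ fun _ => expect_le_one _ fun _ => hF _ _ _

theorem hybrid_one_sub (hF : ∀ w w' z, F w w' z ≤ 1) (g : ℕ → RPoly pp × Bool) :
    hybrid h A srv P (fun w w' z => 1 - F w w' z) g = 1 - hybrid h A srv P F g := by
  unfold hybrid
  rw [← expect_one_sub _ fun w => expect_le_one _ fun w' => expect_le_one _ fun ω => hF _ _ _]
  refine congrArg _ (funext fun w => ?_)
  rw [← expect_one_sub _ fun w' => expect_le_one _ fun ω => hF _ _ _]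
  refine congrArg _ (funext fun w' => ?_)
  rw [← expect_one_sub _ fun ω => hF _ _ _]

/-- A one-sided bound for complementary events is a bound from the other side. -/
theorem le_add_of_one_sub_le {a b ε : ℝ≥0∞} (hb : b ≤ 1)
    (H : 1 - a ≤ 1 - b + ε) : b ≤ a + ε := by
  have h1 : 1 ≤ 1 - b + ε + a := tsub_le_iff_right.1 H
  have hb' := ne_top_of_le_ne_top ENNReal.one_ne_top hb
  have h2 : (1 - b) + b ≤ (1 - b) + (a + ε) := by
    rw [tsub_add_cancel_of_le hb]
    calc (1 : ℝ≥0∞) ≤ 1 - b + ε + a := h1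
      _ = _ := by ring
  exact (ENNReal.add_le_add_iff_left (ne_top_of_le_ne_top ENNReal.one_ne_top tsub_le_self)).1 h2

/-- Whether a party is among the colluding parties. -/
def Corrupt (A : Finset (Fin N)) (srv : Bool) : Party N → Prop
  | none => srv = true
  | some i => i ∈ A

open Classical in
/-- The plaintexts from which the view of the colluding parties is simulated. Inputs of honest
parties are replaced by `0`, the masks of user `h` are not encrypted, and the plaintexts opened by
key switches are the output of the server. The plaintexts opened by bootstrappings are replaced by
`0` unless `open_` is set. -/
noncomputable def simPlain (A : Finset (Fin N)) (srv : Bool) (open_ : Bool)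
    (x : Party N → ℕ → Slots) (P : List (Step N)) (t : ℕ) : RPoly pp × Bool :=
  match P[t]? with
  | some (.input p _) => if Corrupt A srv p then realPlain x P t else (0, true)
  | some (.boot _) => (if open_ then (realPlain x P t).1 else 0, false)
  | some (.keySwitch _) => if srv then realPlain x P t else (0, false)
  | _ => (0, false)

/-- The masks hide the plaintexts that are opened by bootstrappings. -/
theorem expect_simStep_mask (hA : h ∉ A) {δ : ℝ} (E : Env pp N) (st : VState pp) (b : ℕ)
    {g g' : ℕ → RPoly pp × Bool} (m : RPoly pp)
    (hm : ∀ k, |((m k : ℤ) : ℝ)| ≤ δ * (2 * pp.mask + 1))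
    (hg : g st.cts.length = (red (pp.Q (getMeta st.infos b).lvl) m, false))
    (hg' : g' st.cts.length = (0, false)) (f : VState pp → ℝ≥0∞) (hf : ∀ z, f z ≤ 1) :
    expect (simStep h A srv E g st (.boot b)) f ≤
      expect (simStep h A srv E g' st (.boot b)) f + pp.deg * ENNReal.ofReal δ := by
  rw [simStep, simStep, expect_map, expect_map]
  refine expect_shiftMask h (-m) (fun k => by simpa using hm k) (fun _ => hf _)
    fun a ha => congrArg f ?_
  have hsh : bootShares h E (red (pp.Q (getMeta st.infos b).lvl) m) a.1 (getMeta st.infos b)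
      (getCt pp st.cts b) (hidingCt h E (g st.cts.length) a st.infos st.cts (.boot b)) =
      bootShares h E 0 (shiftMask h (-m) a).1 (getMeta st.infos b) (getCt pp st.cts b)
        (hidingCt h E (g' st.cts.length) (shiftMask h (-m) a) st.infos st.cts (.boot b)) := by
    funext i
    by_cases hi : i = h
    · subst hi
      simp only [bootShares, if_pos, ha]
      refine Prod.ext (red_congr fun k => ?_) ?_
      · simp only [shiftMask_apply, Function.update_self, Pi.add_apply, Pi.sub_apply, Pi.neg_apply,
          Pi.zero_apply]
        obtain ⟨y, hy⟩ := Int.modEq_iff_dvd.1 (red_modEq (pp.Q (getMeta st.infos b).lvl) m k)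
        refine Int.modEq_iff_dvd.2 ⟨y, ?_⟩
        linear_combination hy
      · simp only [hidingCt, plain, hg, hg', shiftMask_apply, Bool.false_eq_true, if_false]
    · simp only [bootShares, if_neg hi, shiftMask_apply, Function.update_of_ne hi]
  simp only [stepFn, output, Option.getD_none, hg, hg'] at hsh ⊢
  refine VState.ext rfl ?_ ?_
  · rw [hsh]
  · refine congrArg (fun l => st.view ++ l) (view_boot_congr (fun i hi => ?_) hsh)
    have hne : i ≠ h := fun hih => hA (hih ▸ hi)
    simp only [shiftMask_apply, Function.update_of_ne hne]

/-- Executions simulated from `g` and from `g'` are close if all steps are. -/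
theorem hybrid_le_of_steps {g g' : ℕ → RPoly pp × Bool} {ε : ℝ≥0∞}
    (H : ∀ (E : Env pp N) (st : VState pp) (s : Step N), P[st.cts.length]? = some s →
      st.infos = metas pp (P.take st.cts.length) → ∀ f : VState pp → ℝ≥0∞, (∀ z, f z ≤ 1) →
      expect (simStep h A srv E g st s) f ≤ expect (simStep h A srv E g' st s) f + ε)
    (hF : ∀ w w' z, F w w' z ≤ 1) :
    hybrid h A srv P F g ≤ hybrid h A srv P F g' + P.length * ε := by
  refine expect_le_expect_add _ fun w => expect_le_expect_add _ fun w' => ?_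
  rw [← expect_foldlM_simStep, ← expect_foldlM_simStep]
  refine (expect_foldlM_le (simStep h A srv (keyEnv w w') g) (simStep h A srv (keyEnv w w') g') id
    (fun _ _ => True) ∅ (fun st P' => P = P.take st.cts.length ++ P' ∧ st.cts.length ≤ P.length ∧
      st.infos = metas pp (P.take st.cts.length)) ε ?_ ?_ ?_ P ⟨[], [], []⟩
    ⟨rfl, Nat.zero_le _, rfl⟩ (F w w') (hF w w')).trans (le_of_eq ?_)
  · rintro st s P' ⟨h1, h2, h3⟩ - f hf
    refine H _ st s ?_ h3 f hf
    conv_lhs => rw [h1]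
    rw [List.getElem?_append_right (by simp), List.length_take, min_eq_left h2, Nat.sub_self]
    rfl
  · rintro st s P' ⟨h1, h2, h3⟩ z hz
    obtain ⟨a, -, rfl⟩ := (PMF.mem_support_map_iff _ _ _).1 hz
    obtain ⟨h4, h5, h6⟩ := take_succ_append h1 h2
    have hlen : (stepFn h A srv (keyEnv w w') none (g st.cts.length) a st s).cts.length =
        st.cts.length + 1 := by simp [stepFn]
    rw [hlen]
    refine ⟨h4, h5, ?_⟩
    rw [h6, metas_snoc, ← h3]
    rfl
  · intro st s P' _ hn
    exact absurd trivial hn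
  · simp

theorem hybrid_simPlain_le (hA : h ∉ A) {δ : ℝ} {x : Party N → ℕ → Slots}
    (hmask : ∀ t a, P[t]? = some (Step.boot a) → ∀ k,
      |((ecd pp (getVal (vals pp x (P.take t)) a) (getMeta (metas pp (P.take t)) a).scale k : ℤ) : ℝ)|
        ≤ δ * (2 * pp.mask + 1)) (hF : ∀ w w' z, F w w' z ≤ 1) :
    hybrid h A srv P F (simPlain A srv true x P) ≤
      hybrid h A srv P F (simPlain A srv false x P) + P.length * (pp.deg * ENNReal.ofReal δ) := by
  refine hybrid_le_of_steps (fun E st s hs hinfos f hf => ?_) hF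
  have hsame : (∀ b, s ≠ .boot b) →
      (simPlain A srv true x P st.cts.length : RPoly pp × Bool) =
        simPlain A srv false x P st.cts.length := fun hb => by
    simp only [simPlain, hs]
    cases s with
    | boot b => exact absurd rfl (hb b)
    | _ => rfl
  cases s with
  | boot b =>
    refine expect_simStep_mask hA E st b _ (hmask _ b hs) ?_ ?_ f hf
    · simp only [simPlain, realPlain, hs, if_true, hinfos]
    · simp [simPlain, hs]
  | _ =>
    refine le_add_right (le_of_eq ?_)
    rw [simStep, simStep, hsame (by intro b hb; cases hb)]

/-- The real execution is close to the execution simulated from exact plaintexts, for fresh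
keys. -/
theorem expect_realRun_le (hA : h ∉ A) {hp : Hyper} {δ : ℝ} {x : Party N → ℕ → Slots}
    (hF : ∀ w w' z, F w w' z ≤ 1) :
    expect (realRun pp N hp x) (fun z => F z.1 z.2.1 (viewState A srv z.2.2)) ≤
      hybrid h A srv (trainingSteps N hp) F (realPlain x (trainingSteps N hp))
        + ((trainingSteps N hp).length * (pp.deg * ENNReal.ofReal δ)
          + ENNReal.ofReal (failProb pp N hp δ x)) := by
  have hreal : ∀ G : KeyRand pp N × KeyRand pp 1 × State pp N → ℝ≥0∞,
      expect (realRun pp N hp x) G =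
        expect (PMF.uniformOfFintype (KeyRand pp N)) fun w =>
          expect (PMF.uniformOfFintype (KeyRand pp 1)) fun w' =>
            expect (exec w (pubKey w').enc x (trainingSteps N hp)) fun st => G (w, w', st) := by
    intro G
    refine (expect_bind _ _ _).trans (congrArg _ (funext fun w => ?_))
    refine (expect_bind _ _ _).trans (congrArg _ (funext fun w' => ?_))
    refine (expect_bind _ _ _).trans (congrArg _ (funext fun st => ?_))
    exact expect_pure _ _
  rw [failProb, ENNReal.ofReal_toReal (ne_top_of_le_ne_top ENNReal.one_ne_top
    (toOuterMeasure_le_one _ _)), ← expect_indicator, hreal, hreal]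
  set η : ℝ≥0∞ := (trainingSteps N hp).length * (pp.deg * ENNReal.ofReal δ) with hη
  have key : ∀ w w', expect (exec w (pubKey w').enc x (trainingSteps N hp))
        (fun st => F w w' (viewState A srv st)) ≤
      (expect (PMF.uniformOfFintype (RunCoins pp N (trainingSteps N hp).length)) fun ω =>
        F w w' (detRun h A srv (keyEnv w w') (fun _ => none) (realPlain x (trainingSteps N hp))
          (extend ω) (trainingSteps N hp)))
      + expect (exec w (pubKey w').enc x (trainingSteps N hp)) (fun st =>
          Set.indicator {z : KeyRand pp N × KeyRand pp 1 × State pp N |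
            ¬ Accurate δ (trainingSteps N hp) x (secKey z.1) z.2.2.cts} (fun _ => 1) (w, w', st))
      + η := by
    intro w w'
    have h1 := expect_exec_le (srv := srv) hA (δ := δ) (x := x) (P := trainingSteps N hp) w w'
      (F w w') (hF w w')
    rw [expect_foldlM_simStep, ← expect_indicator, add_right_comm] at h1
    exact h1
  calc _ ≤ expect (PMF.uniformOfFintype (KeyRand pp N)) (fun w =>
          expect (PMF.uniformOfFintype (KeyRand pp 1)) fun w' => _ + _ + η) :=
        expect_mono _ fun w => expect_mono _ fun w' => key w w'
    _ = _ := by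
        simp only [expect_add, expect_const, hybrid]
        ring

end Hybrid

/-! ### Cost of an execution -/

section RunCost

variable {pp : Params} {N : ℕ} {X : Type} {b : Budget} {A : Set (X → ℤ)} {h : Fin N}

/-- The quantities that make up the key material, except the secret key share of user `h`. -/
structure EnvCx (b : Budget) (A : Set (X → ℤ)) (h : Fin N) (E : X → Env pp N) : Prop where
  key : KeyCx b A 0 fun x => (E x).key
  sk : ∀ i ≠ h, ∀ Q, b.IsModulus Q → Pm b A 2 Q fun x => (E x).sk i
  srvKey : EachCoord (Cx b A 0) fun x => (E x).srvKey

theorem KeyCx.mono {A B : Set (X → ℤ)} {e : ℕ} {K : X → PubKey pp} (hK : KeyCx b A e K)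
    (hAB : A ⊆ B) : KeyCx b B e K :=
  ⟨hK.enc.imp fun _ hf => hf.mono le_rfl hAB, hK.rlk.imp fun _ hf => hf.mono le_rfl hAB,
    hK.rot.imp fun _ hf => hf.mono le_rfl hAB⟩

theorem EnvCx.mono {A B : Set (X → ℤ)} {E : X → Env pp N} (hE : EnvCx b A h E) (hAB : A ⊆ B) :
    EnvCx b B h E :=
  ⟨hE.key.mono hAB, fun i hi Q hQ k => (hE.sk i hi Q hQ k).mono le_rfl hAB,
    hE.srvKey.imp fun _ hf => hf.mono le_rfl hAB⟩

/-- The quantities that are needed to execute step `t`, besides key material. -/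
structure StepCx (b : Budget) (A : Set (X → ℤ)) {t : ℕ} (ov : X → Option (Ct pp))
    (g : X → RPoly pp × Bool) (a : X → StepCoins pp N t) : Prop where
  ov : (∀ x, ov x = none) ∨ ∃ c : X → Ct pp, (∀ x, ov x = some (c x)) ∧ EachCoord (Cx b A 0) c
  plain : EachCoord (Cx b A 0) fun x => (g x).1
  flag : ∃ β, ∀ x, (g x).2 = β
  coins : EachCoord (Cx b A 0) a

theorem StepCx.mono {A B : Set (X → ℤ)} {t : ℕ} {ov : X → Option (Ct pp)}
    {g : X → RPoly pp × Bool} {a : X → StepCoins pp N t} (hs : StepCx b A ov g a) (hAB : A ⊆ B) :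
    StepCx b B ov g a := by
  refine ⟨hs.ov.imp_right ?_, hs.plain.imp fun _ hf => hf.mono le_rfl hAB, hs.flag,
    hs.coins.imp fun _ hf => hf.mono le_rfl hAB⟩
  rintro ⟨c, h1, h2⟩
  exact ⟨c, h1, h2.imp fun _ hf => hf.mono le_rfl hAB⟩

/-- The quantities that make up the state of an execution. -/
structure StateCx (b : Budget) (A : Set (X → ℤ)) (l : ℕ) (ms : List Meta) (st : X → VState pp) :
    Prop where
  infos : ∀ x, (st x).infos = ms
  cts : ∀ a, EachCoord (Cx b A 0) fun x => getCt pp (st x).cts a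
  view : Listed (· ∈ A) l fun x => (st x).view

variable (hb : Fits b pp N) {E : X → Env pp N} {ms : List Meta} {cts : X → List (Ct pp)} {t : ℕ}
  {g : X → RPoly pp × Bool} {a : X → StepCoins pp N t}

include hb

theorem otherShares_cx (hE : EnvCx b A h E) {c : X → Ct pp} (hc : EachCoord (Cx b A 0) c) {Q : ℕ}
    (hQ : b.IsModulus Q) : Pm b A 10 Q fun x => otherShares h (E x).sk (c x) := by
  refine Pm.sum (e := 8) _ ?_ (fun i hi => ?_) hQ
  · exact (Finset.card_le_univ _).trans (by simpa using hb.users)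
  · exact ((Pm.of_eachCoord hc.snd hQ).up (e' := 2)).pmul (hE.sk i (Finset.ne_of_mem_erase hi) Q hQ)
      hQ hb.deg

theorem plain_cx (hE : EnvCx b A h E) (hms : ∀ d ∈ ms, d.lvl ≤ pp.levels)
    (hcts : ∀ a, EachCoord (Cx b A 0) fun x => getCt pp (cts x) a)
    (hg : EachCoord (Cx b A 0) fun x => (g x).1) (hflag : ∃ β, ∀ x, (g x).2 = β)
    (ha : EachCoord (Cx b A 0) a) (s : Step N) :
    EachCoord (Cx b A 13) fun x => plain h (E x) (g x) (a x).1 ms (cts x) s := by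
  have hzero : EachCoord (Cx b A 13) fun _ : X => (0 : RPoly pp) :=
    eachCoord_poly.2 fun k => Cx.const 0 (Nat.zero_le _)
  obtain ⟨β, hβ⟩ := hflag
  cases s with
  | input p j => exact ((Pm.of_eachCoord hg hb.isModulus_Qmax).up (e' := 13)).red
  | op o => exact hzero
  | send c => exact hzero
  | boot c =>
    have hM : b.IsModulus (2 * 2 ^ pp.prec * pp.Qmax) :=
      ⟨Nat.mul_pos (by positivity) Params.Qmax_pos, hb.Qmax⟩
    simp only [plain, hβ]
    cases β with
    | false => exact hzero
    | true => exact ((rescale_cx hb _ (Pm.bdd (ha.fst.apply h).fst hM)).up (e' := 13)).red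
  | keySwitch c =>
    have hQ := hb.isModulus (getMeta_lvl_le hms c)
    simp only [plain, hβ]
    cases β with
    | false => exact hzero
    | true =>
      exact ((((Pm.of_eachCoord hg hQ).sub (Pm.of_eachCoord (hcts c).fst hQ) hQ).up.sub
        (otherShares_cx hb hE (hcts c) hQ) hQ).add
          (Pm.bdd (ha.fst.apply h).snd.fst hQ).up hQ).up.red

theorem hidingCt_cx (hE : EnvCx b A h E) (hms : ∀ d ∈ ms, d.lvl ≤ pp.levels)
    (hcts : ∀ a, EachCoord (Cx b A 0) fun x => getCt pp (cts x) a)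
    (hg : EachCoord (Cx b A 0) fun x => (g x).1) (hflag : ∃ β, ∀ x, (g x).2 = β)
    (ha : EachCoord (Cx b A 0) a) (s : Step N) :
    EachCoord (Cx b A 24) fun x => hidingCt h (E x) (g x) (a x) ms (cts x) s := by
  have hQ := hb.isModulus_Qmax
  have hkey : EachCoord (Cx b A 0) fun x => (E x).encKey s := by
    cases s <;> first | exact hE.srvKey | exact hE.key.enc
  exact enc_cx hb (e := 14) (Pm.of_eachCoord hkey.fst hQ).up (Pm.of_eachCoord hkey.snd hQ).up
    (Pm.of_eachCoord (plain_cx hb hE hms hcts hg hflag ha s) hQ)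
    (ha.snd.imp fun f hf => hf.up) hQ

theorem bootShares_cx (hE : EnvCx b A h E) {d : Meta} (hd : d.lvl ≤ pp.levels) {c c' : X → Ct pp}
    (hc : EachCoord (Cx b A 0) c) (hc' : EachCoord (Cx b A 24) c') {g : X → RPoly pp}
    (hg : EachCoord (Cx b A 0) g) (ha : EachCoord (Cx b A 0) a) :
    EachCoord (Cx b A 24) fun x => bootShares h (E x) (g x) (a x).1 d (c x) (c' x) := by
  have hQ := hb.isModulus hd
  refine eachCoord_pi.2 fun i => ?_
  by_cases hi : i = h
  · simp only [bootShares, if_pos hi]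
    refine eachCoord_prod.2 ⟨Pm.red ?_, hc'⟩
    exact ((((((Pm.of_eachCoord hg hQ).sub (Pm.of_eachCoord hc.fst hQ) hQ).up.sub
      (otherShares_cx hb hE hc hQ) hQ).sub (Pm.bdd (ha.fst.apply h).fst hQ).up hQ).add
        (Pm.bdd (ha.fst.apply h).snd.fst hQ).up hQ)).up
  · simp only [bootShares, if_neg hi]
    exact (bootShare_cx hb hE.key hd hc (hE.sk i hi _ hQ) (ha.fst.apply i)).imp
      fun f hf => hf.up

theorem switchShares_cx (hE : EnvCx b A h E) {d : Meta} (hd : d.lvl ≤ pp.levels) {c c' : X → Ct pp}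
    (hc : EachCoord (Cx b A 0) c) (hc' : EachCoord (Cx b A 24) c') (ha : EachCoord (Cx b A 0) a) :
    EachCoord (Cx b A 25) fun x => switchShares h (E x) (a x).1 d (c x) (c' x) := by
  have hQ := hb.isModulus hd
  refine eachCoord_pi.2 fun i => ?_
  by_cases hi : i = h
  · simp only [switchShares, if_pos hi]
    exact eachCoord_prod.2
      ⟨(Pm.of_eachCoord hc'.fst hQ).red, (Pm.of_eachCoord hc'.snd hQ).red⟩
  · simp only [switchShares, if_neg hi]
    exact (switchShare_cx hb hE.srvKey hd hc (hE.sk i hi _ hQ) (ha.fst.apply i).snd).imp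
      fun f hf => hf.up

omit hb in
theorem dim_poly (n : ℕ) : dim (Poly n) ≤ n * 1 := dim_pi fun _ => le_rfl

omit hb in
theorem dim_fin_vector (n m : ℕ) : dim (Fin n → Fin m) ≤ n * 1 := dim_pi fun _ => le_rfl

omit hb in
theorem dim_ct : dim (Ct pp) ≤ 2 * pp.deg := by
  have : dim (RPoly pp) ≤ pp.deg * 1 := dim_poly _
  rw [dim_prod]
  omega

omit hb in
theorem dim_encCoins : dim (EncCoins pp) ≤ 3 * pp.deg := by
  have h1 : dim (TerCoins pp) ≤ pp.deg * 1 := dim_fin_vector _ _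
  have h2 : dim (ErrCoins pp) ≤ pp.deg * 1 := dim_fin_vector _ _
  rw [dim_prod, dim_prod]
  omega

omit hb in
theorem dim_bootCoins (t : ℕ) : dim (BootCoins pp t) ≤ 5 * pp.deg := by
  have h1 : dim (BddCoins pp pp.mask) ≤ pp.deg * 1 := dim_fin_vector _ _
  have h2 : dim (BddCoins pp (pp.smudge t)) ≤ pp.deg * 1 := dim_fin_vector _ _
  have h3 := dim_encCoins (pp := pp)
  rw [dim_prod, dim_prod]
  omega

theorem Fits.mul_deg_le {k : ℕ} (hk : k ≤ 16) : k * pp.deg ≤ b.s ^ 3 := by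
  have h1 : (4 : ℕ) ^ 2 ≤ b.s ^ 2 := Nat.pow_le_pow_left b.four_le 2
  calc k * pp.deg ≤ b.s ^ 2 * b.s := Nat.mul_le_mul (hk.trans h1) hb.deg
    _ = b.s ^ 3 := by ring

theorem Fits.users_mul_deg_le {k : ℕ} (hk : k ≤ 16) : N * (k * pp.deg) ≤ b.s ^ 4 := by
  calc N * (k * pp.deg) ≤ b.s * b.s ^ 3 := Nat.mul_le_mul hb.users (hb.mul_deg_le hk)
    _ = b.s ^ 4 := by ring

omit hb in
theorem listed_boot_view {p : (X → ℤ) → Prop} (A : Finset (Fin N)) {α : Type} [Ser α] [Coords α]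
    [LawfulSer α] {β : Type} [Ser β] [Coords β] [LawfulSer β]
    {r : X → Fin N → α} {sh : X → Fin N → β} {k l : ℕ} (hk : dim α ≤ k) (hl : dim β ≤ l)
    (hr : ∀ i ∈ A, EachCoord p fun x => r x i) (hsh : EachCoord p sh) :
    Listed p (N * (l + k)) fun x => Ser.ser (sh x)
      ++ (List.finRange N).flatMap fun i => if i ∈ A then Ser.ser (r x i) else [] := by
  have h1 := (hsh.listed).mono (dim_pi fun _ => hl)
  have h2 := Listed.flatMap (p := p) (List.finRange N)
    (L := fun i x => if i ∈ A then Ser.ser (r x i) else [])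
    fun i _ => Listed.ite (i ∈ A) (fun hi => ((hr i hi).listed).mono hk) fun _ => Listed.nil
  refine (h1.append h2).mono (le_of_eq ?_)
  rw [List.length_finRange]
  ring

theorem output_cx (C : Finset (Fin N)) (srv : Bool) (hE : EnvCx b A h E)
    (hms : ∀ d ∈ ms, d.lvl ≤ pp.levels)
    (hcts : ∀ a, EachCoord (Cx b A 0) fun x => getCt pp (cts x) a) {g : X → RPoly pp}
    (hg : EachCoord (Cx b A 0) g) (ha : EachCoord (Cx b A 0) a) {c' : X → Ct pp}
    (hc' : EachCoord (Cx b A 24) c') (s : Step N) :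
    (EachCoord (Cx b A 40) fun x => (output h C srv (E x) (g x) (a x) ms (cts x) (c' x) s).1) ∧
      Listed (Cx b A 40) (b.s ^ 4)
        fun x => (output h C srv (E x) (g x) (a x) ms (cts x) (c' x) s).2 := by
  have h3 : b.s ^ 3 ≤ b.s ^ 4 := b.pow_le_pow (by omega)
  cases s with
  | input p j =>
    have henc : Listed (Cx b A 40) (b.s ^ 4) fun x => Ser.ser (a x).2 :=
      ((ha.snd.imp fun f hf => hf.up (e' := 40)).listed).mono
        (dim_encCoins.trans ((hb.mul_deg_le (by omega)).trans h3))
    refine ⟨hc'.imp fun f hf => hf.up, ?_⟩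
    cases p with
    | none => exact Listed.ite (srv = true) (fun _ => henc) fun _ => Listed.nil
    | some i => exact Listed.ite (i ∈ C) (fun _ => henc) fun _ => Listed.nil
  | op o => exact ⟨(localOp_cx hb hE.key hms hcts o).imp fun f hf => hf.up, Listed.nil⟩
  | send c =>
    have hc := (hcts c).imp fun f hf => hf.up (e' := 40)
    exact ⟨hc, hc.listed.mono (dim_ct.trans ((hb.mul_deg_le (by omega)).trans h3))⟩
  | boot c =>
    have hd := getMeta_lvl_le hms c
    have hsh := bootShares_cx hb hE hd (hcts c) hc' hg ha
    refine ⟨(bootOut_cx hb hd (hcts c) hsh).imp fun f hf => hf.up, ?_⟩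
    refine (listed_boot_view C (dim_bootCoins t) (l := 3 * pp.deg) ?_
      (fun i _ => (ha.fst.apply i).imp fun f hf => hf.up)
      (hsh.imp fun f hf => hf.up (e' := 40))).mono ?_
    · have h1 : dim (RPoly pp) ≤ pp.deg * 1 := dim_poly _
      have h2 := dim_ct (pp := pp)
      rw [dim_prod]
      omega
    · rw [← add_mul]
      exact hb.users_mul_deg_le (by omega)
  | keySwitch c =>
    have hd := getMeta_lvl_le hms c
    have hsh := switchShares_cx hb hE hd (hcts c) hc' ha
    refine ⟨(switchOut_cx hb hd (hcts c) hsh).imp fun f hf => hf.up, ?_⟩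
    refine (listed_boot_view C (r := fun x i => ((a x).1 i).2) (k := 5 * pp.deg)
      (l := 2 * pp.deg) ?_ dim_ct
      (fun i _ => (ha.fst.apply i).snd.imp fun f hf => hf.up)
      (hsh.imp fun f hf => hf.up (e' := 40))).mono ?_
    · refine le_trans ?_ (dim_bootCoins (pp := pp) t)
      rw [dim_prod (β := SwitchCoins pp t)]
      exact Nat.le_add_left _ _
    · rw [← add_mul]
      exact hb.users_mul_deg_le (by omega)

theorem stepFn_cx (C : Finset (Fin N)) (srv : Bool) (hE : EnvCx b A h E)
    (hms : ∀ d ∈ ms, d.lvl ≤ pp.levels) {l : ℕ} {st : X → VState pp} (hst : StateCx b A l ms st)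
    {T : ℕ} (hlen : ∀ x, (st x).cts.length = T)
    {ov : X → Option (Ct pp)} (hs : StepCx b A ov g a) (s : Step N) :
    ∃ n B, n ≤ b.s ^ 45 ∧ Reach b.M A n B ∧ StateCx b B (l + b.s ^ 4) (ms ++ [stepMeta pp ms s])
      fun x => stepFn h C srv (E x) (ov x) (g x) (a x) (st x) s := by
  have hc' : EachCoord (Cx b A 24) fun x =>
      (ov x).getD (hidingCt h (E x) (g x) (a x) ms (st x).cts s) := by
    rcases hs.ov with hov | ⟨c, hov, hc⟩
    · simp only [hov, Option.getD_none]
      exact hidingCt_cx hb hE hms hst.cts hs.plain hs.flag hs.coins s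
    · simp only [hov, Option.getD_some]
      exact hc.imp fun f hf => hf.up
  obtain ⟨hout, hview⟩ := output_cx hb C srv hE hms hst.cts hs.plain hs.coins hc' s
  obtain ⟨n, B, hn, hr, hB⟩ := hout.reach
  obtain ⟨n', B', hn', hr', hB'⟩ := (hview.imp fun f hf => hf.mono le_rfl hr.subset).reach
  have hsub := hr.subset.trans hr'.subset
  refine ⟨n + n', B', ?_, hr.trans hr', ?_, ?_, ?_⟩
  · have h1 : dim (Ct pp) ≤ b.s ^ 4 := dim_ct.trans ((hb.mul_deg_le (by omega)).trans
      (b.pow_le_pow (by omega)))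
    have h2 : n ≤ b.s ^ 44 := by
      rw [show 44 = 4 + 40 from rfl, pow_add]
      exact hn.trans (Nat.mul_le_mul_right _ h1)
    have h3 : n' ≤ b.s ^ 44 := by
      rw [show 44 = 4 + 40 from rfl, pow_add]
      exact hn'
    have : 4 * b.s ^ 44 ≤ b.s ^ 45 := b.four_mul_pow_le 44
    omega
  · intro x
    simp only [stepFn, hst.infos x]
  · intro c
    simp only [stepFn, getCt, List.getD_eq_getElem?_getD]
    rcases lt_trichotomy c T with hlt | rfl | hgt
    · refine EachCoord.imp ?_ fun f hf => Cx.mono (A := A) (e := 0) hf le_rfl hsub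
      have := hst.cts c
      simp only [getCt, List.getD_eq_getElem?_getD] at this
      convert this using 3 with x
      rw [List.getElem?_append_left (by rw [hlen]; exact hlt)]
    · refine EachCoord.imp ?_ fun f (hf : f ∈ B) => Cx.of_mem (hr'.subset hf)
      convert hB using 2 with x
      rw [List.getElem?_append_right (by rw [hlen]), hlen, Nat.sub_self]
      simp only [hst.infos]
      rfl
    · refine eachCoord_prod.2 ⟨?_, ?_⟩ <;>
      · refine eachCoord_poly.2 fun k => ?_
        have : ∀ x (z : Ct pp), ((st x).cts ++ [z])[c]? = none := fun x z =>
          List.getElem?_eq_none (by simp [hlen]; omega)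
        simp only [this, Option.getD_none]
        exact Cx.const 0 (Nat.zero_le _)
  · simp only [stepFn, hst.infos]
    exact (hst.view.imp fun f hf => hsub hf).append hB'

/-- An execution is computed in polynomial time from the key material, the coins and the plaintexts
from which the secrets of honest parties are simulated. -/
theorem detRun_cx (C : Finset (Fin N)) (srv : Bool) (hE : EnvCx b A h E)
    {ov : X → ℕ → Option (Ct pp)} {g : X → ℕ → RPoly pp × Bool}
    {ω : X → ∀ t, StepCoins pp N t} (P : List (Step N))
    (hs : ∀ t < P.length, StepCx b A (fun x => ov x t) (fun x => g x t) fun x => ω x t) :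
    ∃ n B, n ≤ P.length * b.s ^ 45 ∧ Reach b.M A n B ∧
      StateCx b B (P.length * b.s ^ 4) (metas pp P)
        fun x => detRun h C srv (E x) (ov x) (g x) (ω x) P := by
  induction P using List.reverseRecOn with
  | nil =>
    refine ⟨0, A, Nat.zero_le _, .refl, fun _ => rfl, fun a => ?_, Listed.nil⟩
    refine eachCoord_prod.2 ⟨?_, ?_⟩ <;>
      exact eachCoord_poly.2 fun k => Cx.const 0 (Nat.zero_le _)
  | append_singleton P s ih =>
    obtain ⟨n, B, hn, hr, hst⟩ := ih fun t ht => hs t (by simp; omega)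
    obtain ⟨n', B', hn', hr', hst'⟩ := stepFn_cx hb C srv (hE.mono hr.subset) (metas_lvl_le P) hst
      (fun x => detRun_length _ _ _ P) ((hs P.length (by simp)).mono hr.subset) s
    refine ⟨n + n', B', ?_, hr.trans hr', ?_⟩
    · rw [List.length_append, List.length_singleton, add_mul, one_mul]
      exact add_le_add hn hn'
    · rw [List.length_append, List.length_singleton, add_mul, one_mul, metas_snoc]
      simp only [detRun_snoc]
      exact hst'

end RunCost

/-! ### Drawing the coins of the protocol -/

section Draws

/-- Coins of type `α` fit into the budget: they can be drawn by a program, at the cost of one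
instruction for each coordinate, and their coordinates are bounded. -/
structure Draws (b : Budget) (α : Type) [Fintype α] [Nonempty α] [Coords α] : Prop where
  samplable : Samplable b.W α
  bound : CoordBound b.M α

variable {b : Budget} {α β : Type} [Fintype α] [Nonempty α] [Coords α] [Fintype β] [Nonempty β]
  [Coords β]

theorem Draws.fin {m : ℕ} (h : m ≤ b.M) : Draws b (Fin (m + 1)) := ⟨.fin h, .fin h⟩

theorem Draws.prod (hα : Draws b α) (hβ : Draws b β) : Draws b (α × β) :=
  ⟨hα.samplable.prod hβ.samplable, hα.bound.prod hβ.bound⟩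

theorem Draws.pi {n : ℕ} {β : Fin n → Type} [∀ i, Fintype (β i)] [∀ i, Nonempty (β i)]
    [∀ i, Coords (β i)] (h : ∀ i, Draws b (β i)) : Draws b (∀ i, β i) :=
  ⟨.pi fun i => (h i).samplable, .pi fun i => (h i).bound⟩

theorem Draws.const (hα : Draws b α) {X : Type} {A : Set (X → ℤ)} (a : α) :
    EachCoord (Cx b A 0) fun _ : X => a :=
  fun f hf => Cx.const _ (hα.bound f hf a)

variable {pp : Params} {N : ℕ} (hb : Fits b pp N)
include hb

theorem Fits.draws_ter : Draws b (TerCoins pp) := .pi fun _ => .fin (by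
  have := hb.two_mul_Qmax_le
  have := Params.Qmax_pos (pp := pp)
  omega)

theorem Fits.draws_err : Draws b (ErrCoins pp) := .pi fun _ => .fin (by
  have := hb.errCoin
  omega)

theorem Fits.draws_uni : Draws b (UniCoins pp) := .pi fun _ => .fin (by
  have := hb.Qmax_le
  omega)

theorem Fits.draws_encCoins : Draws b (EncCoins pp) :=
  hb.draws_ter.prod (hb.draws_err.prod hb.draws_err)

theorem Fits.draws_stepCoins (t : ℕ) : Draws b (StepCoins pp N t) := by
  have hs : 2 * pp.smudge t ≤ b.M :=
    (Nat.mul_le_mul_left 2 (pp.smudge_le t)).trans hb.two_mul_Qmax_le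
  have h1 : Draws b (BddCoins pp pp.mask) := .pi fun _ => .fin hb.mask
  have h2 : Draws b (BddCoins pp (pp.smudge t)) := .pi fun _ => .fin hs
  exact (Draws.pi fun _ => h1.prod (h2.prod hb.draws_encCoins)).prod hb.draws_encCoins

theorem Fits.draws_crs : Draws b (CRS pp) :=
  hb.draws_uni.prod ((Draws.pi fun _ => hb.draws_uni).prod
    (Draws.pi fun _ => Draws.pi fun _ => hb.draws_uni))

theorem Fits.draws_keyCoins : Draws b (KeyCoins pp) :=
  hb.draws_ter.prod (hb.draws_ter.prod (hb.draws_err.prod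
    ((Draws.pi fun _ => Draws.pi fun _ => hb.draws_err).prod
      (Draws.pi fun _ => Draws.pi fun _ => hb.draws_err))))

theorem Fits.draws_keyRand (n : ℕ) : Draws b (KeyRand pp n) :=
  hb.draws_crs.prod (Draws.pi fun _ => hb.draws_keyCoins)

theorem Fits.draws_runCoins (T : ℕ) : Draws b (RunCoins pp N T) :=
  Draws.pi fun t => hb.draws_stepCoins t

/-! Dimensions of the spaces of coins. -/

theorem Fits.gadget_le {d : ℕ} (hd : d ≤ 4 * pp.deg) : pp.digits * d ≤ b.s ^ 3 := by
  calc pp.digits * d ≤ b.s * (b.s * b.s) :=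
        Nat.mul_le_mul hb.digits (hd.trans (Nat.mul_le_mul b.four_le hb.deg))
    _ = b.s ^ 3 := by ring

theorem Fits.gadget_le' {d : ℕ} (hd : d ≤ 4 * pp.deg) : pp.slots * (pp.digits * d) ≤ b.s ^ 4 := by
  calc _ ≤ b.s * b.s ^ 3 := Nat.mul_le_mul hb.slots (hb.gadget_le hd)
    _ = b.s ^ 4 := by ring

theorem Fits.dim_crs : dim (CRS pp) ≤ b.s ^ 5 := by
  have h0 : dim (UniCoins pp) ≤ pp.deg * 1 := dim_fin_vector _ _
  have h1 : dim (Fin pp.digits → UniCoins pp) ≤ _ := dim_pi fun _ => h0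
  have h2 : dim (Fin pp.slots → Fin pp.digits → UniCoins pp) ≤ _ := dim_pi fun _ => h1
  have h3 := hb.gadget_le (d := pp.deg * 1) (by omega)
  have h4 := hb.gadget_le' (d := pp.deg * 1) (by omega)
  have h5 : 4 * b.s ^ 4 ≤ b.s ^ 5 := b.four_mul_pow_le 4
  have h6 := b.pow_le_pow (show 3 ≤ 4 by omega)
  have h7 := hb.mul_deg_le (k := 1) (by omega)
  rw [dim_prod, dim_prod]
  omega

theorem Fits.dim_keyCoins : dim (KeyCoins pp) ≤ b.s ^ 5 := by
  have h0 : dim (TerCoins pp) ≤ pp.deg * 1 := dim_fin_vector _ _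
  have h0' : dim (ErrCoins pp) ≤ pp.deg * 1 := dim_fin_vector _ _
  have h1 : dim (Fin pp.digits → ErrCoins pp) ≤ _ := dim_pi fun _ => h0'
  have h2 : dim (Fin pp.slots → Fin pp.digits → ErrCoins pp) ≤ _ := dim_pi fun _ => h1
  have h2' : dim (Fin 4 → Fin pp.digits → ErrCoins pp) ≤ _ := dim_pi fun _ => h1
  have h3 := hb.gadget_le (d := pp.deg * 1) (by omega)
  have h4 := hb.gadget_le' (d := pp.deg * 1) (by omega)
  have h5 : 4 * b.s ^ 4 ≤ b.s ^ 5 := b.four_mul_pow_le 4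
  have h6 : 4 * b.s ^ 3 ≤ b.s ^ 4 := b.four_mul_pow_le 3
  have h7 := hb.mul_deg_le (k := 4) (by omega)
  rw [dim_prod, dim_prod, dim_prod, dim_prod]
  omega

theorem Fits.dim_keyRand {n : ℕ} (hn : n ≤ b.s) : dim (KeyRand pp n) ≤ b.s ^ 7 := by
  have h1 := hb.dim_crs
  have h2 : dim (Fin n → KeyCoins pp) ≤ _ := dim_pi fun _ => hb.dim_keyCoins
  have h3 : n * b.s ^ 5 ≤ b.s ^ 6 := by
    rw [pow_succ' b.s 5]
    exact Nat.mul_le_mul_right _ hn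
  have h4 : 4 * b.s ^ 6 ≤ b.s ^ 7 := b.four_mul_pow_le 6
  have h5 := b.pow_le_pow (show 5 ≤ 6 by omega)
  rw [dim_prod]
  omega

theorem Fits.dim_runCoins {T : ℕ} (hT : T ≤ b.s) : dim (RunCoins pp N T) ≤ b.s ^ 6 := by
  have h1 : ∀ t : Fin T, dim (StepCoins pp N t) ≤ b.s ^ 5 := fun t => by
    have h1 : dim (Fin N → BootCoins pp t) ≤ _ := dim_pi fun _ => dim_bootCoins _
    have h2 := hb.users_mul_deg_le (k := 5) (by omega)
    have h3 := dim_encCoins (pp := pp)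
    have h4 := hb.mul_deg_le (k := 3) (by omega)
    have h5 : 4 * b.s ^ 4 ≤ b.s ^ 5 := b.four_mul_pow_le 4
    have h6 := b.pow_le_pow (show 3 ≤ 4 by omega)
    rw [dim_prod]
    omega
  refine (dim_pi h1).trans ?_
  rw [pow_succ' b.s 5]
  exact Nat.mul_le_mul_right _ hT

end Draws

/-! ### Quantities known to the colluding parties -/

section Seen

variable {pp : Params} {N : ℕ} {X Y : Type} {p q : (X → ℤ) → Prop} {h : Fin N}

/-- The quantities in the key generation that are seen by all users but `h` satisfy `p`. -/
structure KeySeen (p : (X → ℤ) → Prop) (h : Fin N) (w : X → KeyRand pp N) : Prop where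
  crs : EachCoord p fun x => (w x).1
  enc : EachCoord p fun x i => encKeyShare (w x).1 ((w x).2 i)
  rlk₁ : EachCoord p fun x i t => rlkShare₁ (w x).1 ((w x).2 i) t
  rlk₂ : EachCoord p fun x i t => rlkShare₂ (w x) i t
  rot : EachCoord p fun x i k t => rotKeyShare (w x).1 ((w x).2 i) k t
  coins : ∀ i ≠ h, EachCoord p fun x => (w x).2 i

theorem KeySeen.imp {w : X → KeyRand pp N} (hw : KeySeen p h w) (hpq : ∀ f, p f → q f) :
    KeySeen q h w :=
  ⟨hw.crs.imp hpq, hw.enc.imp hpq, hw.rlk₁.imp hpq, hw.rlk₂.imp hpq,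
    hw.rot.imp hpq, fun i hi => (hw.coins i hi).imp hpq⟩

theorem KeySeen.comp {w : X → KeyRand pp N} {q : (Y → ℤ) → Prop} {π : Y → X}
    (hw : KeySeen (fun f => q fun y => f (π y)) h w) : KeySeen q h fun y => w (π y) :=
  ⟨hw.crs, hw.enc, hw.rlk₁, hw.rlk₂, hw.rot, hw.coins⟩

/-- The view of the key generation consists of the quantities seen. -/
theorem exists_keyView_eq (h : Fin N) : ∃ fs : List (KeyRand pp N → ℤ),
    (∀ w, keyView w (Finset.univ.erase h) = fs.map fun f => f w) ∧
      KeySeen (· ∈ fs) h fun w : KeyRand pp N => w := by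
  let c : ∀ {α : Type} [Coords α], (KeyRand pp N → α) → List (KeyRand pp N → ℤ) :=
    fun {α} _ a => (Coords.coords (α := α)).map fun f w => f (a w)
  have hc : ∀ {α : Type} [Coords α] (a : KeyRand pp N → α), EachCoord (· ∈ c a) a :=
    fun a f hf => List.mem_map.2 ⟨f, hf, rfl⟩
  have hser : ∀ {α : Type} [Coords α] [Ser α] [LawfulSer α] (a : KeyRand pp N → α) (w),
      Ser.ser (a w) = (c a).map fun f => f w := fun a w => by
    simp only [c, LawfulSer.ser_eq, List.map_map]
    rfl
  refine ⟨c (fun w => w.1) ++ c (fun w i => encKeyShare w.1 (w.2 i))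
    ++ c (fun w i t => rlkShare₁ w.1 (w.2 i) t) ++ c (fun w i t => rlkShare₂ w i t)
    ++ c (fun w i k t => rotKeyShare w.1 (w.2 i) k t)
    ++ (List.finRange N).flatMap fun i =>
      if i ∈ Finset.univ.erase h then c (fun w => w.2 i) else [], fun w => ?_, ?_⟩
  · simp only [keyView, List.map_append, List.map_flatMap]
    rw [hser (fun w : KeyRand pp N => w.1), hser fun (w : KeyRand pp N) i => encKeyShare w.1 (w.2 i),
      hser fun (w : KeyRand pp N) i t => rlkShare₁ w.1 (w.2 i) t,
      hser fun (w : KeyRand pp N) i t => rlkShare₂ w i t,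
      hser fun (w : KeyRand pp N) i k t => rotKeyShare w.1 (w.2 i) k t]
    refine congrArg _ (List.flatMap_congr fun i _ => ?_)
    split_ifs
    · exact hser (fun w : KeyRand pp N => w.2 i) w
    · rfl
  · refine ⟨(hc _).imp ?_, (hc _).imp ?_, (hc _).imp ?_, (hc _).imp ?_, (hc _).imp ?_,
      fun i hi => (hc _).imp ?_⟩ <;> intro f hf
    · simp only [List.mem_append, hf, true_or]
    · simp only [List.mem_append, hf, true_or, or_true]
    · simp only [List.mem_append, hf, true_or, or_true]
    · simp only [List.mem_append, hf, true_or, or_true]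
    · simp only [List.mem_append, hf, true_or, or_true]
    · refine List.mem_append_right _ (List.mem_flatMap.2 ⟨i, List.mem_finRange i, ?_⟩)
      rw [if_pos (by simpa using hi)]
      exact hf

variable {b : Budget} {A : Set (X → ℤ)}

/-- Keys that do not depend on the parameter. -/
theorem KeySeen.const {N' : ℕ} (hb : Fits b pp N') (w : KeyRand pp N) :
    KeySeen (Cx b A 0) h fun _ => w := by
  have hred : ∀ a : RPoly pp, EachCoord (Cx b A 0) fun _ : X => red pp.Qmax a := fun a =>
    eachCoord_poly.2 fun k => Cx.const _ (by
      have h0 : (0 : ℤ) < pp.Qmax := by exact_mod_cast Params.Qmax_pos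
      have h1 := Int.emod_nonneg (a k) h0.ne'
      have h2 := Int.emod_lt_of_pos (a k) h0
      have h3 := hb.Qmax_le
      simp only [red]
      omega)
  exact ⟨hb.draws_crs.const w.1, eachCoord_pi.2 fun i => hred _,
    eachCoord_pi.2 fun i => eachCoord_pi.2 fun t => eachCoord_prod.2 ⟨hred _, hred _⟩,
    eachCoord_pi.2 fun i => eachCoord_pi.2 fun t => eachCoord_prod.2 ⟨hred _, hred _⟩,
    eachCoord_pi.2 fun i => eachCoord_pi.2 fun k => eachCoord_pi.2 fun t => hred _,
    fun i _ => hb.draws_keyCoins.const _⟩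

theorem Fits.change_users (hb : Fits b pp N) {n : ℕ} (hn : n ≤ b.s) : Fits b pp n :=
  ⟨hb.deg, hb.digits, hb.errThr, hn, hb.Qmax, hb.base, hb.errCoin, hb.mask, hb.errOff⟩

variable (hb : Fits b pp N) {w : X → KeyRand pp N}
include hb

/-- All shares can be computed from the coins of the key generation. -/
theorem KeySeen.of_coins (hw : EachCoord (Cx b A 0) w) :
    ∃ n B, n ≤ b.s ^ 28 ∧ Reach b.M A n B ∧ KeySeen (Cx b B 0) h w := by
  let a : X → (Fin N → RPoly pp) × (Fin N → Fin pp.digits → Ct pp) ×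
      (Fin N → Fin pp.digits → Ct pp) × (Fin N → Fin pp.slots → Fin pp.digits → RPoly pp) :=
    fun x => (fun i => encKeyShare (w x).1 ((w x).2 i), fun i t => rlkShare₁ (w x).1 ((w x).2 i) t,
      fun i t => rlkShare₂ (w x) i t, fun i k t => rotKeyShare (w x).1 ((w x).2 i) k t)
  have ha : EachCoord (Cx b A 22) a := by
    refine eachCoord_prod.2 ⟨?_, eachCoord_prod.2 ⟨?_, eachCoord_prod.2 ⟨?_, ?_⟩⟩⟩
    · exact eachCoord_pi.2 fun i => (encKeyShare_cx hb hw.fst (hw.snd.apply i)).imp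
        fun f hf => hf.up
    · exact eachCoord_pi.2 fun i => (rlkShare₁_cx hb hw.fst (hw.snd.apply i)).imp
        fun f hf => hf.up
    · exact eachCoord_pi.2 fun i => rlkShare₂_cx hb hw i
    · exact eachCoord_pi.2 fun i => (rotKeyShare_cx hb hw.fst (hw.snd.apply i)).imp
        fun f hf => hf.up
  obtain ⟨n, B, hn, hr, hB⟩ := ha.reach
  have hB' := hB.imp fun f hf => Cx.of_mem (b := b) (e := 0) hf
  have hw' := hw.imp fun f hf => hf.mono le_rfl hr.subset
  refine ⟨n, B, hn.trans ?_, hr, hw'.fst, hB'.fst, hB'.snd.fst, hB'.snd.snd.fst, hB'.snd.snd.snd,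
    fun i _ => hw'.snd.apply i⟩
  have h0 : dim (RPoly pp) ≤ pp.deg * 1 := dim_poly _
  have h1 : dim (Fin N → RPoly pp) ≤ _ := dim_pi fun _ => h0
  have h2 : dim (Fin pp.digits → Ct pp) ≤ _ := dim_pi fun _ => dim_ct
  have h3 : dim (Fin N → Fin pp.digits → Ct pp) ≤ _ := dim_pi fun _ => h2
  have h4 : dim (Fin pp.digits → RPoly pp) ≤ _ := dim_pi fun _ => h0
  have h5 : dim (Fin pp.slots → Fin pp.digits → RPoly pp) ≤ _ := dim_pi fun _ => h4
  have h6 : dim (Fin N → Fin pp.slots → Fin pp.digits → RPoly pp) ≤ _ := dim_pi fun _ => h5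
  have e1 : N * (pp.deg * 1) ≤ b.s ^ 4 := by
    simpa using hb.users_mul_deg_le (k := 1) (by omega)
  have e2 : N * (pp.digits * (2 * pp.deg)) ≤ b.s ^ 4 := by
    rw [pow_succ' b.s 3]
    exact Nat.mul_le_mul hb.users (hb.gadget_le (by omega))
  have e3 : N * (pp.slots * (pp.digits * (pp.deg * 1))) ≤ b.s ^ 5 := by
    rw [pow_succ' b.s 4]
    exact Nat.mul_le_mul hb.users (hb.gadget_le' (by omega))
  have e4 : 4 * b.s ^ 4 ≤ b.s ^ 5 := b.four_mul_pow_le 4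
  have e5 : 4 * b.s ^ 5 ≤ b.s ^ 6 := b.four_mul_pow_le 5
  rw [show 28 = 6 + 22 from rfl, pow_add]
  refine Nat.mul_le_mul_right _ ?_
  rw [dim_prod, dim_prod, dim_prod]
  omega

theorem KeySeen.listed_keyView {p : (X → ℤ) → Prop} (hw : KeySeen p h w) {C : Finset (Fin N)}
    (hC : h ∉ C) : Listed p (b.s ^ 7) fun x => keyView (w x) C := by
  have h0 : dim (RPoly pp) ≤ pp.deg * 1 := dim_poly _
  have h1 : dim (Fin N → RPoly pp) ≤ _ := dim_pi fun _ => h0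
  have h2 : dim (Fin pp.digits → Ct pp) ≤ _ := dim_pi fun _ => dim_ct
  have h3 : dim (Fin N → Fin pp.digits → Ct pp) ≤ _ := dim_pi fun _ => h2
  have h4 : dim (Fin pp.digits → RPoly pp) ≤ _ := dim_pi fun _ => h0
  have h5 : dim (Fin pp.slots → Fin pp.digits → RPoly pp) ≤ _ := dim_pi fun _ => h4
  have h6 : dim (Fin N → Fin pp.slots → Fin pp.digits → RPoly pp) ≤ _ := dim_pi fun _ => h5
  have e0 := hb.dim_crs
  have e1 : N * (pp.deg * 1) ≤ b.s ^ 4 := by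
    simpa using hb.users_mul_deg_le (k := 1) (by omega)
  have e2 : N * (pp.digits * (2 * pp.deg)) ≤ b.s ^ 4 := by
    rw [pow_succ' b.s 3]
    exact Nat.mul_le_mul hb.users (hb.gadget_le (by omega))
  have e3 : N * (pp.slots * (pp.digits * (pp.deg * 1))) ≤ b.s ^ 5 := by
    rw [pow_succ' b.s 4]
    exact Nat.mul_le_mul hb.users (hb.gadget_le' (by omega))
  have e4 : 4 * b.s ^ 4 ≤ b.s ^ 5 := b.four_mul_pow_le 4
  have e5 : 4 * b.s ^ 5 ≤ b.s ^ 6 := b.four_mul_pow_le 5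
  have e6 : 4 * b.s ^ 6 ≤ b.s ^ 7 := b.four_mul_pow_le 6
  have e7 : N * b.s ^ 5 ≤ b.s ^ 6 := by
    rw [pow_succ' b.s 5]
    exact Nat.mul_le_mul_right _ hb.users
  have hc := Listed.flatMap (p := p) (l := b.s ^ 5) (List.finRange N)
    (L := fun i x => if i ∈ C then Ser.ser ((w x).2 i) else [])
    fun i _ => Listed.ite (i ∈ C)
      (fun hi => ((hw.coins i fun hih => hC (hih ▸ hi)).listed).mono hb.dim_keyCoins)
      fun _ => Listed.nil
  rw [List.length_finRange] at hc
  refine (((((hw.crs.listed.append hw.enc.listed).append hw.rlk₁.listed).append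
    hw.rlk₂.listed).append hw.rot.listed).append hc).mono ?_
  omega

/-- The public key is computed from the shares. -/
theorem KeySeen.pubKey_cx (hw : KeySeen (Cx b A 0) h w) :
    KeyCx b A 10 fun x => pubKey (w x) := by
  have hQ := hb.isModulus_Qmax
  have hcard : (Finset.univ : Finset (Fin N)).card ≤ b.s := by simpa using hb.users
  refine ⟨eachCoord_prod.2 ⟨?_, ?_⟩, eachCoord_pi.2 fun t => eachCoord_prod.2 ⟨?_, ?_⟩,
    eachCoord_pi.2 fun k => eachCoord_pi.2 fun t => eachCoord_prod.2 ⟨?_, ?_⟩⟩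
  · exact ((Pm.sum _ hcard (fun i _ => Pm.of_eachCoord (hw.enc.apply i) hQ) hQ).up
      (e' := 10)).red
  · exact eachCoord_poly.2 fun k => (eachCoord_fin.1 (hw.crs.fst.apply k)).up
  · exact ((Pm.sum _ hcard (fun i _ =>
      (Pm.of_eachCoord ((hw.rlk₂.apply i).apply t).fst hQ).add
        (Pm.of_eachCoord ((hw.rlk₂.apply i).apply t).snd hQ) hQ) hQ).up (e' := 10)).red
  · exact ((rlkSum₁_cx hb hw.rlk₁).apply t).snd.imp fun f hf => hf.up
  · exact ((Pm.sum _ hcard (fun i _ =>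
      Pm.of_eachCoord (((hw.rot.apply i).apply k).apply t) hQ) hQ).up (e' := 10)).red
  · exact eachCoord_poly.2 fun l => (eachCoord_fin.1 (((hw.crs.snd.snd.apply k).apply t).apply l)).up

/-- Key material is computed from the quantities that are seen in the key generations. -/
theorem exists_reach_envCx (hw : KeySeen (Cx b A 0) h w) {w' : X → KeyRand pp 1}
    (hw' : KeySeen (Cx b A 0) 0 w') :
    ∃ n B, n ≤ b.s ^ 17 ∧ Reach b.M A n B ∧ EnvCx b B h fun x => keyEnv (w x) (w' x) := by
  have h4 := b.four_le
  have hb' := hb.change_users (n := 1) (by omega)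
  have hK := hw.pubKey_cx hb
  have hK' := hw'.pubKey_cx hb'
  let a : X → (Ct pp × (Fin pp.digits → Ct pp) × (Fin pp.slots → Fin pp.digits → Ct pp)) × Ct pp :=
    fun x => (((pubKey (w x)).enc, (pubKey (w x)).rlk, (pubKey (w x)).rot), (pubKey (w' x)).enc)
  have ha : EachCoord (Cx b A 10) a := eachCoord_prod.2
    ⟨eachCoord_prod.2 ⟨hK.enc, eachCoord_prod.2 ⟨hK.rlk, hK.rot⟩⟩, hK'.enc⟩
  obtain ⟨n, B, hn, hr, hB⟩ := ha.reach
  have hB' := hB.imp fun f hf => Cx.of_mem (b := b) (e := 0) hf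
  refine ⟨n, B, hn.trans ?_, hr, ⟨hB'.fst.fst, hB'.fst.snd.fst, hB'.fst.snd.snd⟩,
    fun i hi Q hQ => ?_, hB'.snd⟩
  · have h1 : dim (Fin pp.digits → Ct pp) ≤ _ := dim_pi fun _ => dim_ct
    have h2 : dim (Fin pp.slots → Fin pp.digits → Ct pp) ≤ _ := dim_pi fun _ => h1
    have h3 := dim_ct (pp := pp)
    have e1 := hb.gadget_le (d := 2 * pp.deg) (by omega)
    have e2 := hb.gadget_le' (d := 2 * pp.deg) (by omega)
    have e3 : 4 * b.s ^ 4 ≤ b.s ^ 5 := b.four_mul_pow_le 4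
    have e4 : 4 * b.s ^ 3 ≤ b.s ^ 4 := b.four_mul_pow_le 3
    have e5 := hb.mul_deg_le (k := 2) (by omega)
    have e6 : b.s ^ 5 ≤ b.s ^ 7 := b.pow_le_pow (by omega)
    rw [show 17 = 7 + 10 from rfl, pow_add]
    refine Nat.mul_le_mul_right _ ?_
    rw [dim_prod (β := Ct pp), dim_prod (α := Ct pp), dim_prod (α := Fin pp.digits → Ct pp)]
    omega
  · exact keyCoins_sk_cx ((hw.coins i hi).imp fun f hf => hf.mono le_rfl hr.subset) hQ

/-- The view of the colluding parties is computed in polynomial time from the quantities that are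
seen in the key generations, the coins and the plaintexts from which the secrets of honest parties
are simulated. -/
theorem exists_reach_view {C : Finset (Fin N)} (hC : h ∉ C) (srv : Bool)
    (hw : KeySeen (Cx b A 0) h w) {w' : X → KeyRand pp 1} (hw' : KeySeen (Cx b A 0) 0 w')
    (hsrv : srv = true → EachCoord (Cx b A 0) w') {L : X → List ℤ} (hL : Listed (Cx b A 0) b.s L)
    {ov : X → ℕ → Option (Ct pp)} {g : X → ℕ → RPoly pp × Bool} {ω : X → ∀ t, StepCoins pp N t}
    {P : List (Step N)} (hP : P.length ≤ b.s)
    (hs : ∀ t < P.length, StepCx b A (fun x => ov x t) (fun x => g x t) fun x => ω x t) :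
    ∃ n B, n ≤ b.s ^ 48 ∧ Reach b.M A n B ∧ Listed (· ∈ B) (b.s ^ 8) fun x =>
      L x ++ keyView (w x) C ++ Ser.ser (pubKey (w' x)).enc
        ++ (if srv then Ser.ser (w' x) else [])
        ++ (detRun h C srv (keyEnv (w x) (w' x)) (ov x) (g x) (ω x) P).view := by
  have h4 := b.four_le
  obtain ⟨n₁, B₁, hn₁, hr₁, hE⟩ := exists_reach_envCx hb hw hw'
  obtain ⟨n₂, B₂, hn₂, hr₂, hst⟩ := detRun_cx hb C srv hE P fun t ht => (hs t ht).mono hr₁.subset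
  have hsub : A ⊆ B₂ := hr₁.subset.trans hr₂.subset
  have hup : ∀ f, Cx b A 0 f → Cx b B₂ 0 f := fun f hf => hf.mono le_rfl hsub
  have hv : Listed (Cx b B₂ 0) (b.s ^ 8) fun x =>
      L x ++ keyView (w x) C ++ Ser.ser (pubKey (w' x)).enc
        ++ (if srv then Ser.ser (w' x) else [])
        ++ (detRun h C srv (keyEnv (w x) (w' x)) (ov x) (g x) (ω x) P).view := by
    have h1 := (hw.listed_keyView hb hC).imp hup
    have h2 := ((hE.mono hr₂.subset).srvKey).listed
    have h3 : Listed (Cx b B₂ 0) (b.s ^ 7) fun x => if srv then Ser.ser (w' x) else [] :=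
      Listed.ite (srv = true) (fun hsr =>
        (((hsrv hsr).imp hup).listed).mono (hb.dim_keyRand (by omega))) fun _ => Listed.nil
    have h5 := hst.view.imp fun f hf => Cx.of_mem (b := b) (e := 0) hf
    refine (((((hL.imp hup).append h1).append h2).append h3).append h5).mono ?_
    have e1 : P.length * b.s ^ 4 ≤ b.s ^ 5 := by
      rw [pow_succ' b.s 4]
      exact Nat.mul_le_mul_right _ hP
    have e2 := b.pow_le_pow (show 5 ≤ 6 by omega)
    have e3 : 4 * b.s ^ 6 ≤ b.s ^ 7 := b.four_mul_pow_le 6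
    have e4 : 4 * b.s ^ 7 ≤ b.s ^ 8 := b.four_mul_pow_le 7
    have e5 : b.s ^ 1 ≤ b.s ^ 6 := b.pow_le_pow (by omega)
    have e6 := dim_ct.trans (hb.mul_deg_le (k := 2) (by omega))
    have e7 := b.pow_le_pow (show 3 ≤ 6 by omega)
    rw [pow_one] at e5
    omega
  obtain ⟨n₃, B₃, hn₃, hr₃, hv'⟩ := hv.reach
  refine ⟨n₁ + n₂ + n₃, B₃, ?_, (hr₁.trans hr₂).trans hr₃, hv'⟩
  have e1 : P.length * b.s ^ 45 ≤ b.s ^ 46 := by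
    rw [pow_succ' b.s 45]
    exact Nat.mul_le_mul_right _ hP
  have e2 := b.pow_le_pow (show 17 ≤ 46 by omega)
  have e3 := b.pow_le_pow (show 8 ≤ 46 by omega)
  have e4 : 4 * b.s ^ 46 ≤ b.s ^ 47 := b.four_mul_pow_le 46
  have e5 := b.pow_le_pow (show 47 ≤ 48 by omega)
  rw [pow_zero, mul_one] at hn₃
  omega

end Seen

/-! ### Reduction to the security of the cryptosystem -/

/-- In a uniform vector of pairs, the second component of one entry may be drawn anew. -/
theorem expect_uniform_update {T : ℕ} {α : Fin T → Type} {β : Type} [∀ t, Fintype (α t)]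
    [∀ t, Nonempty (α t)] [Fintype β] [Nonempty β] (j : Fin T) (G : (∀ t, α t × β) → ℝ≥0∞) :
    expect (PMF.uniformOfFintype (∀ t, α t × β)) G =
      expect (PMF.uniformOfFintype (∀ t, α t × β)) fun ω =>
        expect (PMF.uniformOfFintype β) fun r => G (Function.update ω j ((ω j).1, r)) := by
  -- Exchanging the new component with the old one is a permutation.
  let τ : (∀ t, α t × β) × β → (∀ t, α t × β) × β := fun y =>
    (Function.update y.1 j ((y.1 j).1, y.2), (y.1 j).2)
  have hτ : Function.Involutive τ := by
    rintro ⟨ω, r⟩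
    simp [τ]
  calc expect (PMF.uniformOfFintype (∀ t, α t × β)) G
      = expect (PMF.uniformOfFintype (∀ t, α t × β)) fun ω =>
          expect (PMF.uniformOfFintype β) fun _ => G ω :=
        congrArg _ (funext fun ω => (expect_const _ _).symm)
    _ = expect (PMF.uniformOfFintype ((∀ t, α t × β) × β)) fun y => G y.1 :=
        (expect_uniform_prod fun y : (∀ t, α t × β) × β => G y.1).symm
    _ = expect (PMF.uniformOfFintype ((∀ t, α t × β) × β)) fun y => G (τ y).1 :=
        (expect_uniform_equiv hτ.toPerm fun y => G y.1).symm
    _ = _ := expect_uniform_prod fun y => G (τ y).1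

section Reduction

variable {pp : Params} {N : ℕ} {h : Fin N} {C : Finset (Fin N)} {srv : Bool}

/-- New coins for the distinguished encryption of step `j`. -/
def resample (ω : ∀ t, StepCoins pp N t) (j : ℕ) (r : EncCoins pp) : ∀ t, StepCoins pp N t :=
  Function.update ω j ((ω j).1, r)

theorem expect_resample {T j : ℕ} (hj : j < T) (G : (∀ t, StepCoins pp N t) → ℝ≥0∞) :
    expect (PMF.uniformOfFintype (RunCoins pp N T)) (fun ω => G (extend ω)) =
      expect (PMF.uniformOfFintype (RunCoins pp N T)) fun ω =>
        expect (PMF.uniformOfFintype (EncCoins pp)) fun r => G (resample (extend ω) j r) := by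
  refine (expect_uniform_update (α := fun t : Fin T => Fin N → BootCoins pp t) ⟨j, hj⟩ _).trans ?_
  refine congrArg _ (funext fun ω => congrArg _ (funext fun r => congrArg G (funext fun t => ?_)))
  by_cases htj : t = j
  · subst htj
    simp only [extend, resample, dif_pos hj, Function.update_self]
  · simp only [extend, resample, Function.update_of_ne htj]
    split_ifs with ht
    · exact Function.update_of_ne (fun he => htj (Fin.mk.inj he)) _ _
    · rfl

/-- The colluding parties see of the step only the distinguished ciphertext of what depends on
whether the secrets are simulated from `g` or from `g'`. -/
def Hideable (C : Finset (Fin N)) (srv : Bool) (g g' : RPoly pp × Bool) : Step N → Prop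
  | .input p _ => ¬ Corrupt C srv p
  | .boot _ => g.1 = g'.1
  | .keySwitch _ => True
  | .op _ | .send _ => False

theorem output_congr {E : Env pp N} {t : ℕ} {g g' : RPoly pp × Bool} {s : Step N}
    (hH : Hideable C srv g g' s) (r : Fin N → BootCoins pp t) (e e' : EncCoins pp)
    (ms : List Meta) (cts : List (Ct pp)) (c : Ct pp) :
    output h C srv E g.1 (r, e) ms cts c s = output h C srv E g'.1 (r, e') ms cts c s := by
  cases s with
  | input p j =>
    refine Prod.ext rfl ?_
    cases p with
    | none => exact (if_neg hH).trans (if_neg hH).symm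
    | some i => exact (if_neg hH).trans (if_neg hH).symm
  | op o => exact hH.elim
  | send a => exact hH.elim
  | boot a =>
    have hH' : g.1 = g'.1 := hH
    rw [hH']
    rfl
  | keySwitch a => rfl

/-- The distinguished ciphertext of step `j` may be provided from outside. -/
theorem detRun_override {E : Env pp N} {P : List (Step N)} {j : ℕ} {s : Step N}
    (hs : P[j]? = some s) {g₀ g : ℕ → RPoly pp × Bool} (hg : ∀ t, t ≠ j → g t = g₀ t)
    (hH : Hideable C srv (g j) (g₀ j) s) (ω : ∀ t, StepCoins pp N t) (r : EncCoins pp) :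
    detRun h C srv E (fun _ => none) g (resample ω j r) P =
      detRun h C srv E (Function.update (fun _ => none) j
        (some (enc pp.Qmax (E.encKey s) (plain h E (g j) (ω j).1
          (detRun h C srv E (fun _ => none) g₀ ω (P.take j)).infos
          (detRun h C srv E (fun _ => none) g₀ ω (P.take j)).cts s) r))) g₀ ω P := by
  refine detRun_congr fun t ht => ?_
  by_cases htj : t = j
  · subst htj
    have hst : detRun h C srv E (fun _ => none) g (resample ω t r) (P.take t) =
        detRun h C srv E (fun _ => none) g₀ ω (P.take t) := detRun_congr fun t' ht' => by
      have : t' ≠ t := by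
        rw [List.length_take] at ht'
        omega
      simp only [hg t' this, resample, Function.update_of_ne this]
    have hPt : P[t] = s := (List.getElem?_eq_some_iff.1 hs).2
    rw [hPt, hst]
    generalize detRun h C srv E (fun _ => none) g₀ ω (P.take t) = st
    simp only [resample, Function.update_self, stepFn, Option.getD_none, Option.getD_some, hidingCt]
    rw [output_congr hH (ω t).1 r (ω t).2]
  · simp only [hg t htj, resample, Function.update_of_ne htj]

theorem expect_cpaGame {n : ℕ} (i : Fin n) (β : Bool) (C₁ C₂ : Circuit) :
    (cpaGame pp n i β C₁ C₂).toOuterMeasure {o | o.head? = some 1} =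
      expect (PMF.uniformOfFintype (KeyRand pp n)) fun z =>
        expect (C₁.run (keyView z (Finset.univ.erase i))) fun st =>
          expect (PMF.uniformOfFintype (EncCoins pp)) fun r =>
            acc C₂ (keyView z (Finset.univ.erase i) ++ st ++ Ser.ser (enc pp.Qmax (pubKey z).enc
              (fun k => st.getD ((k : ℕ) + if β then pp.deg else 0) 0) r)) := by
  refine (toOuterMeasure_bind _ _ _).trans (congrArg _ (funext fun z => ?_))
  refine (toOuterMeasure_bind _ _ _).trans (congrArg _ (funext fun st => ?_))
  exact toOuterMeasure_bind _ _ _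

theorem getD_ser_append (m₀ m₁ : RPoly pp) (β : Bool) :
    (fun k : Fin pp.deg => (Ser.ser m₀ ++ Ser.ser m₁).getD ((k : ℕ) + if β then pp.deg else 0) 0) =
      if β then m₁ else m₀ := by
  have hser : ∀ m : RPoly pp, Ser.ser m = List.ofFn m := fun m => by
    rw [List.ofFn_eq_map]
    exact List.flatMap_pure_eq_map _ _
  funext k
  rw [hser, hser, List.getD_eq_getElem?_getD]
  cases β with
  | false =>
    simp only [Bool.false_eq_true, if_false, add_zero]
    rw [List.getElem?_append_left (by simp)]
    simp
  | true =>
    simp only [if_true]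
    rw [List.getElem?_append_right (by simp)]
    simp

/-- Acceptance of `D` on a view of the colluding parties. -/
noncomputable def viewAcc (D : Circuit) (L : List ℤ) (C : Finset (Fin N)) (srv : Bool)
    (w : KeyRand pp N) (w' : KeyRand pp 1) (z : VState pp) : ℝ≥0∞ :=
  acc D (L ++ keyView w C ++ Ser.ser (pubKey w').enc ++ (if srv then Ser.ser w' else []) ++ z.view)

variable {b : Budget} (hb : Fits b pp N) (hC : h ∉ C) {L : List ℤ} {P : List (Step N)}
  {g g' : ℕ → RPoly pp × Bool}

theorem listed_const {X : Type} {A : Set (X → ℤ)} (hL : L.length ≤ b.s)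
    (hLM : ∀ z ∈ L, z.natAbs ≤ b.M) : Listed (Cx b A 0) b.s fun _ : X => L := by
  refine ⟨L.map fun z _ => z, fun x => ?_, by simpa using hL, fun f hf => ?_⟩
  · rw [List.map_map]
    exact (List.map_id L).symm
  · obtain ⟨z, hz, rfl⟩ := List.mem_map.1 hf
    exact Cx.const z (hLM z hz)

include hb

theorem StepCx.const {X : Type} {A : Set (X → ℤ)} {ov : X → Option (Ct pp)} {t : ℕ}
    {g : RPoly pp × Bool} (a : StepCoins pp N t)
    (hov : (∀ x, ov x = none) ∨ ∃ c : X → Ct pp, (∀ x, ov x = some (c x)) ∧ EachCoord (Cx b A 0) c)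
    (hg : ∀ k, (g.1 k).natAbs ≤ b.M) :
    StepCx b A ov (fun _ => g) fun _ => a :=
  ⟨hov, eachCoord_poly.2 fun k => Cx.const _ (hg k), ⟨g.2, fun _ => rfl⟩,
    (hb.draws_stepCoins t).const a⟩

include hC

/-- A distinguisher of executions that differ in the distinguished ciphertext of step `j` is an
adversary against the cryptosystem. All coins that are not part of the game are fixed. -/
theorem exists_adversary {n : ℕ} (i₀ : Fin n) (w : KeyRand pp n → KeyRand pp N)
    (w' : KeyRand pp n → KeyRand pp 1)
    (hseen : ∀ (X : Type) (A : Set (X → ℤ)) (z : X → KeyRand pp n), KeySeen (Cx b A 0) i₀ z →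
      KeySeen (Cx b A 0) h (fun x => w (z x)) ∧ KeySeen (Cx b A 0) 0 (fun x => w' (z x)) ∧
        (srv = true → EachCoord (Cx b A 0) fun x => w' (z x)))
    (hL : L.length ≤ b.s) (hLM : ∀ z ∈ L, z.natAbs ≤ b.M) (hP : P.length ≤ b.s)
    (hgM : ∀ t < P.length, ∀ k, ((g t).1 k).natAbs ≤ b.M)
    (hgM' : ∀ t < P.length, ∀ k, ((g' t).1 k).natAbs ≤ b.M)
    {j : ℕ} {s : Step N} (hs : P[j]? = some s)
    (hkey : ∀ z, (keyEnv (w z) (w' z)).encKey s = (pubKey z).enc)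
    (hg : ∀ t, t ≠ j → g' t = g t) (hH : Hideable C srv (g j) (g j) s)
    (hH' : Hideable C srv (g' j) (g j) s) (ω : ∀ t, StepCoins pp N t) (D : Circuit) :
    ∃ C₁ C₂ : Circuit, C₁.size ≤ b.s ^ 49 * b.W + (1 + D.size) ∧
      C₂.size ≤ b.s ^ 49 * b.W + (1 + D.size) ∧
      ∀ β : Bool, (cpaGame pp n i₀ β C₁ C₂).toOuterMeasure {o | o.head? = some 1} =
        expect (PMF.uniformOfFintype (KeyRand pp n)) fun z =>
          expect (PMF.uniformOfFintype (EncCoins pp)) fun r =>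
            viewAcc D L C srv (w z) (w' z) (detRun h C srv (keyEnv (w z) (w' z)) (fun _ => none)
              (if β then g' else g) (resample ω j r) P) := by
  have hj : j < P.length := (List.getElem?_eq_some_iff.1 hs).1
  have h48 : 4 * b.s ^ 48 ≤ b.s ^ 49 := b.four_mul_pow_le 48
  have hW : 1 ≤ b.W := Nat.le_add_right _ _
  obtain ⟨fs, hfs, hfsw⟩ := exists_keyView_eq (pp := pp) i₀
  -- The plaintexts of the distinguished encryption.
  let E : KeyRand pp n → Env pp N := fun z => keyEnv (w z) (w' z)
  let st : KeyRand pp n → VState pp := fun z =>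
    detRun h C srv (E z) (fun _ => none) g ω (P.take j)
  let m : Bool → KeyRand pp n → RPoly pp := fun β z =>
    plain h (E z) ((if β then g' else g) j) (ω j).1 (st z).infos (st z).cts s
  -- The first stage of the adversary runs the protocol up to step `j`.
  have hstage₁ : ∃ k B, k ≤ b.s ^ 48 ∧ Reach b.M {f | f ∈ fs} k B ∧
      Listed (· ∈ B) (b.s ^ 3) fun z => Ser.ser (m false z) ++ Ser.ser (m true z) := by
    obtain ⟨hw, hw', -⟩ := hseen _ {f | f ∈ fs} (fun z => z)
      (hfsw.imp fun f hf => Cx.of_mem hf)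
    obtain ⟨n₁, B₁, hn₁, hr₁, hE⟩ := exists_reach_envCx hb hw hw'
    obtain ⟨n₂, B₂, hn₂, hr₂, hst⟩ := detRun_cx hb C srv hE (ov := fun _ _ => none)
      (g := fun _ => g) (ω := fun _ => ω) (P.take j) fun t ht =>
        StepCx.const hb (ω t) (Or.inl fun _ => rfl) (hgM t (by rw [List.length_take] at ht; omega))
    have hm : ∀ β, EachCoord (Cx b B₂ 13) (m β) := fun β => by
      have hgβ : ∀ k, (((if β then g' else g) j).1 k).natAbs ≤ b.M := by
        cases β
        · exact hgM j hj
        · exact hgM' j hj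
      have hm : m β = fun z => plain h (E z) ((if β then g' else g) j) (ω j).1
          (metas pp (P.take j)) (st z).cts s :=
        funext fun z => congrArg (fun ms => plain h (E z) _ _ ms _ s) (hst.infos z)
      rw [hm]
      exact plain_cx hb (hE.mono hr₂.subset) (metas_lvl_le (P.take j)) hst.cts
        (g := fun _ => (if β then g' else g) j) (a := fun _ => ω j)
        (eachCoord_poly.2 fun k => Cx.const _ (hgβ k)) ⟨_, fun _ => rfl⟩
        ((hb.draws_stepCoins j).const (ω j)) s
    obtain ⟨n₃, B₃, hn₃, hr₃, hv⟩ := ((hm false).listed.append (hm true).listed).reach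
    have hd : dim (RPoly pp) + dim (RPoly pp) ≤ b.s ^ 3 := by
      have h1 : dim (RPoly pp) ≤ pp.deg * 1 := dim_poly _
      have h2 := hb.mul_deg_le (k := 2) (by omega)
      omega
    refine ⟨n₁ + n₂ + n₃, B₃, ?_, (hr₁.trans hr₂).trans hr₃, hv.mono hd⟩
    have e1 : (P.take j).length * b.s ^ 45 ≤ b.s ^ 46 := by
      rw [pow_succ' b.s 45]
      refine Nat.mul_le_mul_right _ ?_
      rw [List.length_take]
      omega
    have e2 := b.pow_le_pow (show 17 ≤ 46 by omega)
    have e3 : n₃ ≤ b.s ^ 46 := by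
      refine hn₃.trans ((Nat.mul_le_mul_right _ hd).trans ?_)
      rw [← pow_add]
      exact b.pow_le_pow (by omega)
    have e4 : 4 * b.s ^ 46 ≤ b.s ^ 47 := b.four_mul_pow_le 46
    have e5 := b.pow_le_pow (show 47 ≤ 48 by omega)
    omega
  obtain ⟨k₁, B₁, hk₁, hr₁, hv₁⟩ := hstage₁
  obtain ⟨C₁, hC₁, hrun₁⟩ := (hv₁.impl_pure.reach hr₁).circuit
  obtain ⟨gs, hgs, -, -⟩ := hv₁
  -- The second stage runs the whole protocol with the challenge in step `j`, and the distinguisher.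
  let fs₂ : List (KeyRand pp n × Ct pp → ℤ) := fs.map (fun f y => f y.1) ++ gs.map (fun f y => f y.1)
    ++ Coords.coords.map fun (f : Ct pp → ℤ) y => f y.2
  have hstage₂ : ∃ k B, k ≤ b.s ^ 48 ∧ Reach b.M {f | f ∈ fs₂} k B ∧
      Listed (· ∈ B) (b.s ^ 8) fun y : KeyRand pp n × Ct pp =>
        L ++ keyView (w y.1) C ++ Ser.ser (pubKey (w' y.1)).enc
        ++ (if srv then Ser.ser (w' y.1) else [])
        ++ (detRun h C srv (E y.1) (Function.update (fun _ => none) j (some y.2)) g ω P).view := by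
    have hin : KeySeen (Cx b {f | f ∈ fs₂} 0) i₀ fun y : KeyRand pp n × Ct pp => y.1 := by
      refine KeySeen.comp (w := fun w => w) (hfsw.imp fun f hf => Cx.of_mem ?_)
      exact List.mem_append_left _ (List.mem_append_left _ (List.mem_map.2 ⟨f, hf, rfl⟩))
    obtain ⟨hw, hw', hsrv⟩ := hseen _ _ _ hin
    refine exists_reach_view hb hC srv hw hw' hsrv (listed_const hL hLM)
      (ov := fun y => Function.update (fun _ => none) j (some y.2)) (g := fun _ => g)
      (ω := fun _ => ω) hP fun t ht => StepCx.const hb (ω t) ?_ (hgM t ht)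
    by_cases htj : t = j
    · subst htj
      refine Or.inr ⟨fun y => y.2, fun y => Function.update_self _ _ _, fun f hf => Cx.of_mem ?_⟩
      exact List.mem_append_right _ (List.mem_map.2 ⟨f, hf, rfl⟩)
    · exact Or.inl fun y => Function.update_of_ne htj _ _
  obtain ⟨k₂, B₂, hk₂, hr₂, hv₂⟩ := hstage₂
  obtain ⟨C₂, hC₂, hrun₂⟩ := ((hv₂.impl_call D).reach hr₂).circuit
  refine ⟨C₁, C₂, hC₁.trans ?_, hC₂.trans ?_, fun β => ?_⟩
  · have e1 : (k₁ + b.s ^ 3) * b.W ≤ b.s ^ 49 * b.W := by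
      refine Nat.mul_le_mul_right _ ?_
      have := b.pow_le_pow (show 3 ≤ 48 by omega)
      omega
    have e2 : b.s ^ 3 * 1 ≤ b.s ^ 3 * b.W := Nat.mul_le_mul_left _ hW
    rw [add_mul] at e1
    omega
  · have e1 : k₂ * b.W ≤ b.s ^ 49 * b.W := Nat.mul_le_mul_right _ (by omega)
    omega
  · rw [expect_cpaGame]
    refine congrArg _ (funext fun z => ?_)
    have h1 : C₁.run (keyView z (Finset.univ.erase i₀)) =
        PMF.pure (Ser.ser (m false z) ++ Ser.ser (m true z)) := by rw [hfs, hrun₁]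
    rw [h1, expect_pure]
    refine congrArg _ (funext fun r => ?_)
    rw [getD_ser_append]
    have h2 : ∀ c : Ct pp, keyView z (Finset.univ.erase i₀)
        ++ (Ser.ser (m false z) ++ Ser.ser (m true z)) ++ Ser.ser c =
          fs₂.map fun f => f (z, c) := fun c => by
      have h3 : Ser.ser (m false z) ++ Ser.ser (m true z) = gs.map fun f => f z := hgs z
      rw [h3, hfs, LawfulSer.ser_eq]
      simp only [fs₂, List.map_append, List.map_map]
      rfl
    have hgβ : ∀ t, t ≠ j → (if β then g' else g) t = g t := fun t ht => by
      cases β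
      · rfl
      · exact hg t ht
    have hHβ : Hideable C srv ((if β then g' else g) j) (g j) s := by
      cases β
      · exact hH
      · exact hH'
    rw [detRun_override hs hgβ hHβ ω r, hkey z, h2, acc, hrun₂]
    cases β <;> rfl

/-- If no adversary has an advantage above `ε`, executions that differ in the distinguished
ciphertext of step `j` are `ε`-close. -/
theorem expect_detRun_le {n : ℕ} (i₀ : Fin n) (w : KeyRand pp n → KeyRand pp N)
    (w' : KeyRand pp n → KeyRand pp 1)
    (hseen : ∀ (X : Type) (A : Set (X → ℤ)) (z : X → KeyRand pp n), KeySeen (Cx b A 0) i₀ z →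
      KeySeen (Cx b A 0) h (fun x => w (z x)) ∧ KeySeen (Cx b A 0) 0 (fun x => w' (z x)) ∧
        (srv = true → EachCoord (Cx b A 0) fun x => w' (z x)))
    (hL : L.length ≤ b.s) (hLM : ∀ z ∈ L, z.natAbs ≤ b.M) (hP : P.length ≤ b.s)
    (hgM : ∀ t < P.length, ∀ k, ((g t).1 k).natAbs ≤ b.M)
    (hgM' : ∀ t < P.length, ∀ k, ((g' t).1 k).natAbs ≤ b.M)
    {j : ℕ} {s : Step N} (hs : P[j]? = some s)
    (hkey : ∀ z, (keyEnv (w z) (w' z)).encKey s = (pubKey z).enc)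
    (hg : ∀ t, t ≠ j → g' t = g t) (hH : Hideable C srv (g j) (g j) s)
    (hH' : Hideable C srv (g' j) (g j) s) (ω : ∀ t, StepCoins pp N t) (D : Circuit) {ε : ℝ}
    (hε : ∀ C₁ C₂ : Circuit, C₁.size ≤ b.s ^ 49 * b.W + (1 + D.size) →
      C₂.size ≤ b.s ^ 49 * b.W + (1 + D.size) →
      |probOne (cpaGame pp n i₀ false C₁ C₂) - probOne (cpaGame pp n i₀ true C₁ C₂)| ≤ ε) :
    (expect (PMF.uniformOfFintype (KeyRand pp n)) fun z =>
      expect (PMF.uniformOfFintype (EncCoins pp)) fun r =>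
        viewAcc D L C srv (w z) (w' z)
          (detRun h C srv (keyEnv (w z) (w' z)) (fun _ => none) g (resample ω j r) P)) ≤
    (expect (PMF.uniformOfFintype (KeyRand pp n)) fun z =>
      expect (PMF.uniformOfFintype (EncCoins pp)) fun r =>
        viewAcc D L C srv (w z) (w' z)
          (detRun h C srv (keyEnv (w z) (w' z)) (fun _ => none) g' (resample ω j r) P))
      + ENNReal.ofReal ε := by
  obtain ⟨C₁, C₂, h1, h2, hgame⟩ :=
    exists_adversary hb hC i₀ w w' hseen hL hLM hP hgM hgM' hs hkey hg hH hH' ω D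
  have h3 := hε C₁ C₂ h1 h2
  rw [probOne_eq, probOne_eq, hgame, hgame] at h3
  exact le_add_of_abs_toReal_sub_le
    (expect_le_one _ fun _ => expect_le_one _ fun _ => acc_le_one _ _)
    (expect_le_one _ fun _ => expect_le_one _ fun _ => acc_le_one _ _) h3

end Reduction

/-! ### Replacing all hidden plaintexts -/

section Chain

variable {pp : Params} {N : ℕ} {h : Fin N} {C : Finset (Fin N)} {srv : Bool} {b : Budget}
  {L : List ℤ} {P : List (Step N)}

theorem Hideable.symm {g g' : RPoly pp × Bool} {s : Step N} (hH : Hideable C srv g g' s) :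
    Hideable C srv g' g s := by
  cases s <;> first | exact hH | exact Eq.symm hH

theorem Hideable.refl_right {g g' : RPoly pp × Bool} {s : Step N} (hH : Hideable C srv g g' s) :
    Hideable C srv g' g' s := by
  cases s <;> first | exact hH | rfl

/-- The secrets of step `s` may be simulated from `g'` instead of `g`. -/
def Hidden (C : Finset (Fin N)) (srv : Bool) (g g' : RPoly pp × Bool) (s : Step N) : Prop :=
  g = g' ∨ Hideable C srv g' g s ∧ ∀ a, s = .keySwitch a → srv = false

theorem Hidden.symm {g g' : RPoly pp × Bool} {s : Step N} (hH : Hidden C srv g g' s) :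
    Hidden C srv g' g s :=
  hH.imp Eq.symm fun h => ⟨h.1.symm, h.2⟩

/-- No adversary against `n` users has an advantage above `ε`, within the resources that an
execution of the protocol together with the distinguisher `D` needs. -/
def AdvLE (b : Budget) (D : Circuit) (pp : Params) (n : ℕ) (ε : ℝ) : Prop :=
  ∀ (i : Fin n) (C₁ C₂ : Circuit), C₁.size ≤ b.s ^ 49 * b.W + (1 + D.size) →
    C₂.size ≤ b.s ^ 49 * b.W + (1 + D.size) →
    |probOne (cpaGame pp n i false C₁ C₂) - probOne (cpaGame pp n i true C₁ C₂)| ≤ ε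

variable (hb : Fits b pp N) (hC : h ∉ C) (hL : L.length ≤ b.s) (hLM : ∀ z ∈ L, z.natAbs ≤ b.M)
  (hP : P.length ≤ b.s) {D : Circuit} {εU εS : ℝ} (hU : AdvLE b D pp N εU)
  (hS : AdvLE b D pp 1 εS)

include hb hC hL hLM hP hU hS

/-- Replacing the plaintexts of one distinguished encryption. -/
theorem hybrid_le_of_hidden {g g' : ℕ → RPoly pp × Bool}
    (hgM : ∀ t < P.length, ∀ k, ((g t).1 k).natAbs ≤ b.M)
    (hgM' : ∀ t < P.length, ∀ k, ((g' t).1 k).natAbs ≤ b.M)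
    {j : ℕ} {s : Step N} (hs : P[j]? = some s) (hg : ∀ t, t ≠ j → g' t = g t)
    (hH : Hidden C srv (g j) (g' j) s) :
    hybrid h C srv P (viewAcc D L C srv) g ≤
      hybrid h C srv P (viewAcc D L C srv) g' + (ENNReal.ofReal εU + ENNReal.ofReal εS) := by
  rcases hH with hgj | ⟨hH, hkey⟩
  · have : g' = g := funext fun t => by
      by_cases htj : t = j
      · rw [htj, hgj]
      · exact hg t htj
    rw [this]
    exact le_self_add
  have hj : j < P.length := (List.getElem?_eq_some_iff.1 hs).1
  have hresample : ∀ g : ℕ → RPoly pp × Bool, hybrid h C srv P (viewAcc D L C srv) g =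
      expect (PMF.uniformOfFintype (KeyRand pp N)) fun w =>
      expect (PMF.uniformOfFintype (KeyRand pp 1)) fun w' =>
      expect (PMF.uniformOfFintype (RunCoins pp N P.length)) fun ω =>
      expect (PMF.uniformOfFintype (EncCoins pp)) fun r => viewAcc D L C srv w w'
        (detRun h C srv (keyEnv w w') (fun _ => none) g (resample (extend ω) j r) P) := fun g =>
    congrArg _ (funext fun w => congrArg _ (funext fun w' => expect_resample hj fun ω =>
      viewAcc D L C srv w w' (detRun h C srv (keyEnv w w') (fun _ => none) g ω P)))
  rw [hresample, hresample]
  by_cases hsw : ∃ a, s = .keySwitch a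
  · -- The message of user `h` is an encryption under the key of the server.
    obtain ⟨a, rfl⟩ := hsw
    refine (expect_le_expect_add (c := ENNReal.ofReal εS) _ fun w => ?_).trans
      (add_le_add_right le_add_self _)
    rw [expect_comm, expect_comm (PMF.uniformOfFintype (KeyRand pp 1))]
    refine expect_le_expect_add _ fun ω => ?_
    exact expect_detRun_le hb hC (0 : Fin 1) (fun _ => w) (fun w' => w')
      (fun X A z hz => ⟨KeySeen.const hb w, hz, fun hsrv => by simp [hkey a rfl] at hsrv⟩)
      hL hLM hP hgM hgM' hs (fun _ => rfl) hg hH.refl_right hH (extend ω) D (hS 0)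
  · -- The distinguished ciphertext is an encryption under the key of the users.
    rw [expect_comm, expect_comm (PMF.uniformOfFintype (KeyRand pp N))]
    refine (expect_le_expect_add (c := ENNReal.ofReal εU) _ fun w' => ?_).trans
      (add_le_add_right le_self_add _)
    rw [expect_comm, expect_comm (PMF.uniformOfFintype (KeyRand pp N))]
    refine expect_le_expect_add _ fun ω => ?_
    refine expect_detRun_le hb hC h (fun w => w) (fun _ => w')
      (fun X A z hz => ⟨hz, KeySeen.const hb w', fun _ => (hb.draws_keyRand 1).const w'⟩)
      hL hLM hP hgM hgM' hs (fun _ => ?_) hg hH.refl_right hH (extend ω) D (hU h)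
    cases s with
    | keySwitch a => exact absurd ⟨a, rfl⟩ hsw
    | _ => rfl

/-- Replacing the plaintexts of the distinguished encryptions one after the other. -/
theorem hybrid_le_of_forall_hidden {g g' : ℕ → RPoly pp × Bool}
    (hgM : ∀ t < P.length, ∀ k, ((g t).1 k).natAbs ≤ b.M)
    (hgM' : ∀ t < P.length, ∀ k, ((g' t).1 k).natAbs ≤ b.M)
    (hH : ∀ j s, P[j]? = some s → Hidden C srv (g j) (g' j) s) :
    hybrid h C srv P (viewAcc D L C srv) g ≤
      hybrid h C srv P (viewAcc D L C srv) g'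
        + P.length * (ENNReal.ofReal εU + ENNReal.ofReal εS) := by
  let c : ℕ → ℕ → RPoly pp × Bool := fun j t => if t < j then g' t else g t
  have hcM : ∀ j, ∀ t < P.length, ∀ k, ((c j t).1 k).natAbs ≤ b.M := fun j t ht k => by
    simp only [c]
    split_ifs
    · exact hgM' t ht k
    · exact hgM t ht k
  have key : ∀ j ≤ P.length, hybrid h C srv P (viewAcc D L C srv) g ≤
      hybrid h C srv P (viewAcc D L C srv) (c j)
        + j * (ENNReal.ofReal εU + ENNReal.ofReal εS) := by
    intro j
    induction j with
    | zero =>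
      intro _
      refine le_add_right (le_of_eq (congrArg _ (funext fun t => ?_)))
      simp [c]
    | succ j ih =>
      intro hj
      refine (ih (by omega)).trans ?_
      have hs : P[j]? = some P[j] := List.getElem?_eq_getElem (by omega)
      have h1 := hybrid_le_of_hidden hb hC hL hLM hP hU hS (srv := srv) (hcM j) (hcM (j + 1)) hs
        (fun t ht => by
          have : t < j + 1 ↔ t < j := by omega
          simp only [c, this])
        (by
          have := hH j _ hs
          simpa [c] using this)
      refine (add_le_add_left h1 _).trans (le_of_eq ?_)
      push_cast
      ring
  refine (key P.length le_rfl).trans (add_le_add_left (le_of_eq ?_) _)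
  -- The plaintexts after the last step are irrelevant.
  unfold hybrid
  refine congrArg _ (funext fun w => congrArg _ (funext fun w' => congrArg _ (funext fun ω => ?_)))
  refine congrArg _ (detRun_congr fun t ht => ?_)
  simp only [c, if_pos ht]

omit hb hC hL hLM hP hU hS in
theorem hidden_simPlain (x : Party N → ℕ → Slots) {j : ℕ} {s : Step N} (hs : P[j]? = some s) :
    Hidden C srv (realPlain x P j : RPoly pp × Bool) (simPlain C srv true x P j) s := by
  cases s with
  | input p i =>
    simp only [simPlain, hs]
    split_ifs with hp
    · exact Or.inl rfl
    · exact Or.inr ⟨hp, fun a ha => by cases ha⟩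
  | op o => exact Or.inl (by simp only [simPlain, realPlain, hs])
  | send a => exact Or.inl (by simp only [simPlain, realPlain, hs])
  | boot a =>
    refine Or.inr ⟨?_, fun a ha => by cases ha⟩
    simp [simPlain, hs, Hideable]
  | keySwitch a =>
    cases srv with
    | true => exact Or.inl (by simp [simPlain, hs])
    | false => exact Or.inr ⟨trivial, fun _ _ => rfl⟩

end Chain

/-! ### The steps of the training protocol -/

section Emits

variable {N : ℕ} {α β : Type} {Φ : Step N → Prop}

/-- The program `m` appends at most `n` steps, all of them subject to `Φ`, and its result satisfies
`Ψ`. -/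
def Emits (Φ : Step N → Prop) (Ψ : α → Prop) (n : ℕ) (m : Build N α) : Prop :=
  ∀ P, ∃ Q, (m.run P).run.2 = P ++ Q ∧ Q.length ≤ n ∧ (∀ s ∈ Q, Φ s) ∧ Ψ (m.run P).run.1

theorem Emits.mono {Ψ Ψ' : α → Prop} {n n' : ℕ} {m : Build N α} (h : Emits Φ Ψ n m)
    (hΨ : ∀ a, Ψ a → Ψ' a) (hn : n ≤ n') : Emits Φ Ψ' n' m := fun P => by
  obtain ⟨Q, h1, h2, h3, h4⟩ := h P
  exact ⟨Q, h1, h2.trans hn, h3, hΨ _ h4⟩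

theorem Emits.le {Ψ : α → Prop} {n n' : ℕ} {m : Build N α} (h : Emits Φ Ψ n m) (hn : n ≤ n') :
    Emits Φ Ψ n' m :=
  h.mono (fun _ => id) hn

theorem Emits.pure {Ψ : α → Prop} {a : α} (ha : Ψ a) : Emits Φ Ψ 0 (pure a : Build N α) :=
  fun P => ⟨[], (List.append_nil P).symm, le_rfl, by simp, ha⟩

theorem Emits.bind {Ψ : α → Prop} {Ψ' : β → Prop} {n n' : ℕ} {m : Build N α} {f : α → Build N β}
    (hm : Emits Φ Ψ n m) (hf : ∀ a, Ψ a → Emits Φ Ψ' n' (f a)) :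
    Emits Φ Ψ' (n + n') (m >>= f) := fun P => by
  obtain ⟨Q, h1, h2, h3, h4⟩ := hm P
  obtain ⟨Q', h1', h2', h3', h4'⟩ := hf _ h4 (P ++ Q)
  have hrun : ((m >>= f).run P).run = ((f (m.run P).run.1).run (P ++ Q)).run := by
    rw [← h1]
    rfl
  refine ⟨Q ++ Q', ?_, ?_, ?_, ?_⟩
  · rw [hrun, h1', List.append_assoc]
  · rw [List.length_append]
    omega
  · intro s hs
    exact (List.mem_append.1 hs).elim (h3 s) (h3' s)
  · rw [hrun]
    exact h4'

theorem Emits.emit {s : Step N} (hs : Φ s) : Emits Φ (fun _ => True) 1 (emit s) :=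
  fun P => ⟨[s], rfl, le_rfl, by simpa using hs, trivial⟩

theorem Emits.foldlM {Ψ : α → Prop} {n : ℕ} {f : α → β → Build N α} {l : List β} {a : α}
    (hf : ∀ a, Ψ a → ∀ y ∈ l, Emits Φ Ψ n (f a y)) (ha : Ψ a) :
    Emits Φ Ψ (l.length * n) (l.foldlM f a) := by
  induction l generalizing a with
  | nil => exact (Emits.pure ha).le (Nat.zero_le _)
  | cons y l ih =>
    rw [List.foldlM_cons]
    refine Emits.le ((hf a ha y List.mem_cons_self).bind fun a' ha' =>
      ih (fun a ha y hy => hf a ha y (List.mem_cons_of_mem _ hy)) ha') (le_of_eq ?_)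
    rw [List.length_cons]
    ring

theorem Emits.mapM {Ψ : β → Prop} {n : ℕ} {f : α → Build N β} {l : List α}
    (hf : ∀ y ∈ l, Emits Φ Ψ n (f y)) :
    Emits Φ (fun r => r.length = l.length) (l.length * n) (l.mapM f) := by
  induction l with
  | nil => exact (Emits.pure (Ψ := fun r : List β => r.length = 0) rfl).le (Nat.zero_le _)
  | cons y l ih =>
    rw [List.mapM_cons]
    refine Emits.le ((hf y List.mem_cons_self).bind fun z _ =>
      (ih fun y hy => hf y (List.mem_cons_of_mem _ hy)).bind fun r hr =>
        Emits.pure (a := z :: r) (congrArg (· + 1) hr)) (le_of_eq ?_)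
    rw [List.length_cons]
    ring

end Emits

section Count

variable {N : ℕ} {hp : Hyper}

/-- The numbers of the inputs that a party uses in the training are in the range of those it
has. -/
def InputBound (hp : Hyper) : Step N → Prop
  | .input (some _) j => j < 2 * (hp.iters * hp.batch)
  | .input none j => j < hp.layers
  | _ => True

variable {u : ℕ} (hu : 4 ≤ u)

include hu

theorem four_mul_pow_le (e : ℕ) : 4 * u ^ e ≤ u ^ (e + 1) := by
  rw [pow_succ, mul_comm]
  exact Nat.mul_le_mul_left _ hu

omit hu in
theorem mul_le_pow_succ {x y e : ℕ} (hx : x ≤ u) (hy : y ≤ u ^ e) : x * y ≤ u ^ (e + 1) := by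
  rw [pow_succ']
  exact Nat.mul_le_mul hx hy

omit hu in
theorem emits_op (o : LocalOp) :
    Emits (N := N) (InputBound hp) (fun _ => True) 1 (emit (.op o)) := Emits.emit trivial

omit hu in
theorem emits_mulPtRS (a : ℕ) (v : Slots) :
    Emits (N := N) (InputBound hp) (fun _ => True) 2 (mulPtRS a v) :=
  (emits_op _).bind fun _ _ => emits_op _

omit hu in
theorem emits_mulCtRS (a c : ℕ) :
    Emits (N := N) (InputBound hp) (fun _ => True) 2 (mulCtRS a c) :=
  (emits_op _).bind fun _ _ => emits_op _

theorem emits_heLinTrans {n : ℕ} (hn : n ≤ u ^ 2) (c : ℕ) (τ : ℕ → ℕ) :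
    Emits (N := N) (InputBound hp) (fun _ => True) (u ^ 4) (heLinTrans n c τ) := by
  refine Emits.le ((emits_mulPtRS _ _).bind fun c' _ => Emits.foldlM (Ψ := fun _ => True) (n := 4)
    (fun c' _ k _ => ?_) trivial) ?_
  · split_ifs
    · exact (emits_op _).bind fun r _ => (emits_mulPtRS _ _).bind fun r _ => emits_op _
    · exact (Emits.pure trivial).le (Nat.zero_le _)
  · have h1 : 4 * u ^ 2 ≤ u ^ 3 := four_mul_pow_le hu 2
    have h2 : 4 * u ^ 3 ≤ u ^ 4 := four_mul_pow_le hu 3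
    have h3 : 1 ≤ u ^ 2 := Nat.one_le_pow _ _ (by omega)
    rw [List.length_range]
    omega

theorem emits_heTranspose (hdim : hp.dim ≤ u) (a : ℕ) :
    Emits (N := N) (InputBound hp) (fun _ => True) (u ^ 4) (heTranspose hp.dim a) :=
  emits_heLinTrans hu (by rw [sq]; exact Nat.mul_le_mul hdim hdim) _ _

theorem emits_heMatMult (hdim : hp.dim ≤ u) (a c : ℕ) :
    Emits (N := N) (InputBound hp) (fun _ => True) (u ^ 7) (heMatMult hp.dim a c) := by
  have hsq : hp.dim * hp.dim ≤ u ^ 2 := by rw [sq]; exact Nat.mul_le_mul hdim hdim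
  refine Emits.le ((emits_heLinTrans hu hsq _ _).bind fun a₀ _ =>
    (emits_heLinTrans hu hsq _ _).bind fun b₀ _ => (emits_mulCtRS _ _).bind fun ab _ =>
    Emits.foldlM (Ψ := fun _ => True) (n := u ^ 5) (fun ab _ k _ => ?_) trivial) ?_
  · refine Emits.le ((emits_heLinTrans hu hsq _ _).bind fun aₖ _ =>
      (emits_heLinTrans hu hsq _ _).bind fun bₖ _ => (emits_mulCtRS _ _).bind fun p _ =>
      emits_op _) ?_
    have h1 : 4 * u ^ 4 ≤ u ^ 5 := four_mul_pow_le hu 4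
    have h2 : 4 * u ^ 1 ≤ u ^ 2 := four_mul_pow_le hu 1
    have h3 : u ^ 2 ≤ u ^ 4 := Nat.pow_le_pow_right (by omega) (by omega)
    rw [pow_one] at h2
    omega
  · have h1 : (hp.dim - 1) * u ^ 5 ≤ u ^ 6 := mul_le_pow_succ (by omega) le_rfl
    have h2 : 4 * u ^ 6 ≤ u ^ 7 := four_mul_pow_le hu 6
    have h3 : u ^ 4 ≤ u ^ 6 := Nat.pow_le_pow_right (by omega) (by omega)
    have h4 : 4 * u ^ 3 ≤ u ^ 4 := four_mul_pow_le hu 3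
    have h5 : 1 ≤ u ^ 3 := Nat.one_le_pow _ _ (by omega)
    rw [List.length_range]
    omega

theorem emits_evalAct {f : List ActOp} (hf : f.length ≤ u) (c : ℕ) :
    Emits (N := N) (InputBound hp) (fun _ => True) (u ^ 2) (evalAct f c) := by
  refine Emits.le ((Emits.foldlM (Ψ := fun _ => True) (n := 2) (fun rs _ o _ => ?_) trivial).bind
    fun rs _ => Emits.pure trivial) ?_
  · cases o with
    | const v => exact Emits.le ((emits_op _).bind fun r _ => Emits.pure trivial) (by omega)
    | scale v a => exact (emits_mulPtRS _ _).bind fun r _ => Emits.pure trivial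
    | add a c => exact Emits.le ((emits_op _).bind fun r _ => Emits.pure trivial) (by omega)
    | sub a c => exact Emits.le ((emits_op _).bind fun r _ => Emits.pure trivial) (by omega)
    | mul a c => exact (emits_mulCtRS _ _).bind fun r _ => Emits.pure trivial
  · have := Nat.mul_le_mul hf (show 2 ≤ u by omega)
    rw [sq]
    omega

variable (hsize : hp.size + N + 4 ≤ u)
include hsize

theorem emits_feedforward (w : List ℕ) (M : ℕ) :
    Emits (N := N) (InputBound hp) (fun _ => True) (u ^ 9) (feedforward hp w M) := by
  unfold Hyper.size at hsize
  refine Emits.le (Emits.foldlM (Ψ := fun _ => True) (n := u ^ 8) (fun y _ j _ => ?_) trivial) ?_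
  · obtain ⟨Es, Ms⟩ := y
    refine Emits.le ((emits_heMatMult hu (by omega) _ _).bind fun E _ =>
      (emits_evalAct hu (by omega) _).bind fun M _ => (Emits.emit trivial).bind fun M _ =>
      (Emits.emit trivial).bind fun M _ => Emits.pure trivial) ?_
    have h1 : 4 * u ^ 7 ≤ u ^ 8 := four_mul_pow_le hu 7
    have h2 : u ^ 2 ≤ u ^ 7 := Nat.pow_le_pow_right (by omega) (by omega)
    have h3 : 4 * u ^ 1 ≤ u ^ 2 := four_mul_pow_le hu 1
    rw [pow_one] at h3
    omega
  · rw [List.length_range]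
    exact mul_le_pow_succ (by omega) le_rfl

theorem emits_backprop (w Es Ms : List ℕ) (Y : ℕ) (g : List ℕ) :
    Emits (N := N) (InputBound hp) (fun r => r.length = g.length) (u ^ 11)
      (backprop hp w Es Ms Y g) := by
  unfold Hyper.size at hsize
  refine Emits.le ((emits_op _).bind fun D _ => (emits_mulCtRS _ _).bind fun L _ =>
    (Emits.foldlM (Ψ := fun y => y.2.length = g.length) (n := u ^ 9) (fun y hy j _ => ?_)
      (a := (L, g)) rfl).bind fun y hy => ?_) (n := _ + (_ + (_ + 0))) ?_
  · obtain ⟨L, g'⟩ := y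
    have h1 : 4 * u ^ 8 ≤ u ^ 9 := four_mul_pow_le hu 8
    have h2 : 4 * u ^ 7 ≤ u ^ 8 := four_mul_pow_le hu 7
    have h3 : u ^ 4 ≤ u ^ 7 := Nat.pow_le_pow_right (by omega) (by omega)
    have h4 : u ^ 2 ≤ u ^ 7 := Nat.pow_le_pow_right (by omega) (by omega)
    have h5 : 4 * u ^ 1 ≤ u ^ 2 := four_mul_pow_le hu 1
    rw [pow_one] at h5
    have htail : ∀ L, Emits (N := N) (InputBound hp) (fun y => y.2.length = g.length) (u ^ 8) (do
        let F ← evalAct hp.dact (Es.getD j 0)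
        let L ← mulCtRS F L
        let T ← heTranspose hp.dim (Ms.getD j 0)
        let p ← heMatMult hp.dim T L
        let s ← emit (.op (.add p (g'.getD j 0)))
        pure (L, g'.set j s)) := fun L => by
      refine Emits.le ((emits_evalAct hu (by omega) _).bind fun F _ =>
        (emits_mulCtRS _ _).bind fun L _ => (emits_heTranspose hu (by omega) _).bind fun T _ =>
        (emits_heMatMult hu (by omega) _ _).bind fun p _ => (emits_op _).bind fun s _ =>
        Emits.pure ?_) ?_
      · simpa using hy
      · omega
    split_ifs
    · refine Emits.le ((emits_heTranspose hu (by omega) _).bind fun T _ =>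
        (emits_heMatMult hu (by omega) _ _).bind fun L _ => htail L) ?_
      omega
    · refine Emits.le (Emits.bind (Ψ := fun _ => True) (Emits.pure trivial) fun L _ => htail L) ?_
      omega
  · obtain ⟨L, g'⟩ := y
    exact Emits.pure hy
  · have h1 : hp.layers * u ^ 9 ≤ u ^ 10 := mul_le_pow_succ (by omega) le_rfl
    have h2 : 4 * u ^ 10 ≤ u ^ 11 := four_mul_pow_le hu 10
    have h3 : u ^ 1 ≤ u ^ 10 := Nat.pow_le_pow_right (by omega) (by omega)
    rw [pow_one] at h3
    rw [List.length_reverse, List.length_range]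
    omega

theorem emits_localGradients (i : Fin N) {k : ℕ} (hk : k < hp.iters) (w : List ℕ) :
    Emits (N := N) (InputBound hp) (fun r => r.length = hp.layers) (u ^ 14)
      (localGradients hp i k w) := by
  have hsize' := hsize
  unfold Hyper.size at hsize'
  have hmap := Emits.mapM (N := N) (Φ := InputBound hp) (l := List.range hp.layers)
    fun _ _ => emits_op (.pt fun _ => 0)
  refine Emits.le (hmap.bind fun g hg => Emits.foldlM
    (Ψ := fun r : List ℕ => r.length = hp.layers) (n := u ^ 12) (fun g hg t ht => ?_) (by simpa using hg)) ?_
  · have hkt : k * hp.batch + t < hp.iters * hp.batch := by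
      have ht' := List.mem_range.1 ht
      calc k * hp.batch + t < (k + 1) * hp.batch := by rw [add_mul, one_mul]; omega
        _ ≤ _ := Nat.mul_le_mul_right _ hk
    refine Emits.le ((Emits.emit (s := .input (some i) (2 * (k * hp.batch + t))) ?_).bind fun X _ =>
      (Emits.emit (s := .input (some i) (2 * (k * hp.batch + t) + 1)) ?_).bind fun Y _ =>
      (emits_feedforward hu hsize w X).bind fun ⟨Es, Ms⟩ _ =>
      (emits_backprop hu hsize w Es Ms Y g).mono (fun r hr => hr.trans hg) le_rfl) ?_
    · show _ < _
      omega
    · show _ < _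
      omega
    · have h1 : 4 * u ^ 11 ≤ u ^ 12 := four_mul_pow_le hu 11
      have h2 : u ^ 9 ≤ u ^ 11 := Nat.pow_le_pow_right (by omega) (by omega)
      have h3 : u ^ 1 ≤ u ^ 11 := Nat.pow_le_pow_right (by omega) (by omega)
      rw [pow_one] at h3
      omega
  · have h1 : hp.batch * u ^ 12 ≤ u ^ 13 := mul_le_pow_succ (by omega) le_rfl
    have h2 : 4 * u ^ 13 ≤ u ^ 14 := four_mul_pow_le hu 13
    have h3 : u ^ 1 ≤ u ^ 13 := Nat.pow_le_pow_right (by omega) (by omega)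
    rw [pow_one] at h3
    rw [List.length_range, List.length_range]
    omega

theorem emits_iteration {k : ℕ} (hk : k < hp.iters) (w : List ℕ) :
    Emits (N := N) (InputBound hp) (fun r => r.length = hp.layers) (u ^ 17)
      (iteration hp w k) := by
  have hsize' := hsize
  unfold Hyper.size at hsize'
  have h1 : 4 * u ^ 14 ≤ u ^ 15 := four_mul_pow_le hu 14
  have h2 : u ^ 1 ≤ u ^ 14 := Nat.pow_le_pow_right (by omega) (by omega)
  rw [pow_one] at h2
  have hmap : Emits (N := N) (InputBound hp) (fun r => r.length = (List.finRange N).length)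
      ((List.finRange N).length * u ^ 15)
      ((List.finRange N).mapM fun i => do
        let g ← localGradients hp i k w
        g.mapM fun c => emit (.send c)) := Emits.mapM (Ψ := fun _ => True) fun i _ => by
    refine Emits.le (Emits.bind (n := u ^ 14) (n' := u ^ 14)
      (emits_localGradients hu hsize i hk w) fun g hg => ?_) (by omega)
    exact (Emits.mapM (Ψ := fun _ => True) (n := 1) fun c _ => Emits.emit trivial).mono
      (fun _ _ => trivial) (by omega)
  refine Emits.le (hmap.bind fun gs hgs => (Emits.mapM (Ψ := fun _ => True)
    (n := u ^ 15) fun j _ => ?_).mono (fun r hr => by simpa using hr) le_rfl) ?_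
  · refine Emits.le ((emits_op _).bind fun z _ => (Emits.foldlM (Ψ := fun _ => True) (n := 1)
      (fun s _ g _ => emits_op _) trivial).bind fun s _ => (emits_mulPtRS _ _).bind fun v _ =>
      (emits_op _).bind fun c _ => Emits.emit trivial) ?_
    have := hgs
    rw [List.length_finRange] at this
    omega
  · have h3 : N * u ^ 15 ≤ u ^ 16 := mul_le_pow_succ (by omega) le_rfl
    have h4 : hp.layers * u ^ 15 ≤ u ^ 16 := mul_le_pow_succ (by omega) le_rfl
    have h5 : 4 * u ^ 16 ≤ u ^ 17 := four_mul_pow_le hu 16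
    rw [List.length_finRange, List.length_range]
    omega

theorem emits_training :
    Emits (N := N) (InputBound hp) (fun _ => True) (u ^ 19) (training hp) := by
  have hsize' := hsize
  unfold Hyper.size at hsize'
  have hmap : Emits (N := N) (InputBound hp) (fun r => r.length = (List.range hp.layers).length)
      ((List.range hp.layers).length * 2)
      ((List.range hp.layers).mapM fun j => do
        let c ← emit (.input none j)
        emit (.send c)) := Emits.mapM fun j hj =>
    (Emits.emit (s := .input none j) (List.mem_range.1 hj)).bind fun c _ => Emits.emit trivial
  refine Emits.le (hmap.bind fun w hw => (Emits.foldlM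
    (Ψ := fun r : List ℕ => r.length = hp.layers) (n := u ^ 17) (fun w _ k hk => emits_iteration hu hsize (List.mem_range.1 hk) w)
    (by simpa using hw)).bind fun w hw => ((Emits.mapM (Ψ := fun _ => True) (n := 1)
      fun c _ => Emits.emit trivial).mono (fun _ _ => trivial) le_rfl).le (n' := u) ?_) ?_
  · omega
  · have h1 : hp.iters * u ^ 17 ≤ u ^ 18 := mul_le_pow_succ (by omega) le_rfl
    have h2 : 4 * u ^ 18 ≤ u ^ 19 := four_mul_pow_le hu 18
    have h3 : u ^ 1 ≤ u ^ 18 := Nat.pow_le_pow_right (by omega) (by omega)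
    rw [pow_one] at h3
    rw [List.length_range, List.length_range]
    omega

omit hu hsize in
theorem length_trainingSteps_le : (trainingSteps N hp).length ≤ (hp.size + N + 4) ^ 19 := by
  obtain ⟨Q, h1, h2, -, -⟩ :=
    emits_training (N := N) (hp := hp) (u := hp.size + N + 4) (by omega) le_rfl []
  have h3 : trainingSteps N hp = Q := h1
  rwa [h3]

omit hu hsize in
theorem inputBound_of_mem {s : Step N} (hs : s ∈ trainingSteps N hp) : InputBound hp s := by
  obtain ⟨Q, h1, -, h3, -⟩ :=
    emits_training (N := N) (hp := hp) (u := hp.size + N + 4) (by omega) le_rfl []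
  have h4 : trainingSteps N hp = Q := h1
  exact h3 s (h4 ▸ hs)

end Count

/-! ### The simulator -/

section Simulator

-- The coins of the simulator are a deeply nested product type.
set_option synthInstance.maxSize 1000
set_option synthInstance.maxHeartbeats 200000

variable {pp : Params} {N : ℕ} {h : Fin N} {C : Finset (Fin N)} {srv : Bool} {hp : Hyper}

/-- The coins of the simulator, which runs the key generations and the protocol itself. -/
abbrev SimCoins (pp : Params) (N T : ℕ) :=
  KeyRand pp N × KeyRand pp 1 × RunCoins pp N T

/-- The view produced by the simulator. -/
noncomputable def simView (pp : Params) (h : Fin N) (C : Finset (Fin N)) (srv : Bool) (hp : Hyper)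
    (x : Party N → ℕ → Slots) : PMF (List ℤ) :=
  (PMF.uniformOfFintype (SimCoins pp N (trainingSteps N hp).length)).bind fun y => PMF.pure
    (corruptInputs pp N hp C srv x ++ keyView y.1 C ++ Ser.ser (pubKey y.2.1).enc
      ++ (if srv then Ser.ser y.2.1 else [])
      ++ (detRun h C srv (keyEnv y.1 y.2.1) (fun _ => none)
        (simPlain C srv false x (trainingSteps N hp)) (extend y.2.2) (trainingSteps N hp)).view)

theorem expect_simView (x : Party N → ℕ → Slots) (D : Circuit) :
    expect (simView pp h C srv hp x) (acc D) =
      hybrid (pp := pp) h C srv (trainingSteps N hp) (viewAcc D (corruptInputs pp N hp C srv x) C srv)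
        (simPlain C srv false x (trainingSteps N hp)) := by
  refine (expect_bind _ _ _).trans ?_
  refine (congrArg _ (funext fun y => expect_pure _ _)).trans ?_
  refine (expect_uniform_prod _).trans (congrArg _ (funext fun w => ?_))
  exact expect_uniform_prod _

/-- The input of the simulator consists of the encoded inputs of the colluding parties, and of the
encoded output of the server if it is among them. -/
theorem exists_simInput_eq (pp : Params) (C : Finset (Fin N)) (srv : Bool) (hp : Hyper) :
    ∃ fs : List ((Party N → ℕ → Slots) → ℤ),
      (∀ x, simInput pp N hp C srv x = fs.map fun f => f x) ∧
      (∀ p j, Corrupt C srv p → InputBound hp (.input p j) →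
        EachCoord (· ∈ fs) fun x : Party N → ℕ → Slots =>
          red pp.Qmax (ecd pp (x p j) pp.scale)) ∧
      (srv = true → ∀ t a, (trainingSteps N hp)[t]? = some (.keySwitch a) →
        EachCoord (· ∈ fs) fun x : Party N → ℕ → Slots =>
          red (pp.Q (getMeta (metas pp ((trainingSteps N hp).take t)) a).lvl)
            (ecd pp (getVal (vals pp x ((trainingSteps N hp).take t)) a)
              (getMeta (metas pp ((trainingSteps N hp).take t)) a).scale)) := by
  let c : ((Party N → ℕ → Slots) → RPoly pp) → List ((Party N → ℕ → Slots) → ℤ) :=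
    fun a => (Coords.coords (α := RPoly pp)).map fun f x => f (a x)
  have hc : ∀ a, EachCoord (· ∈ c a) a := fun a f hf => List.mem_map.2 ⟨f, hf, rfl⟩
  have hser : ∀ a x, Ser.ser (a x) = (c a).map fun f => f x := fun a x => by
    simp only [c, LawfulSer.ser_eq, List.map_map]
    rfl
  let out : ℕ → Option (Step N) → List ((Party N → ℕ → Slots) → ℤ) := fun t s => match s with
    | some (.keySwitch a) => c fun x =>
        red (pp.Q (getMeta (metas pp ((trainingSteps N hp).take t)) a).lvl)
          (ecd pp (getVal (vals pp x ((trainingSteps N hp).take t)) a)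
            (getMeta (metas pp ((trainingSteps N hp).take t)) a).scale)
    | _ => []
  refine ⟨((List.finRange N).flatMap fun i => if i ∈ C then
      (List.range (2 * (hp.iters * hp.batch))).flatMap fun j =>
        c fun x => red pp.Qmax (ecd pp (x (some i) j) pp.scale) else [])
    ++ (if srv then (List.range hp.layers).flatMap fun j =>
        c fun x => red pp.Qmax (ecd pp (x none j) pp.scale) else [])
    ++ if srv then (List.range (trainingSteps N hp).length).flatMap fun t =>
        out t (trainingSteps N hp)[t]? else [], fun x => ?_, fun p j hpc hj => ?_,
    fun hsrv t a ht => ?_⟩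
  · simp only [simInput, corruptInputs, idealOutput, List.map_append]
    refine congrArg₂ _ (congrArg₂ _ ?_ ?_) ?_
    · rw [List.map_flatMap]
      refine List.flatMap_congr fun i _ => ?_
      split_ifs
      · rw [List.map_flatMap]
        exact List.flatMap_congr fun j _ => hser (fun x => red pp.Qmax (ecd pp (x (some i) j) _)) x
      · rfl
    · split_ifs
      · rw [List.map_flatMap]
        exact List.flatMap_congr fun j _ => hser (fun x => red pp.Qmax (ecd pp (x none j) _)) x
      · rfl
    · split_ifs
      · rw [List.map_flatMap]
        refine List.flatMap_congr fun t _ => ?_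
        match (trainingSteps N hp)[t]? with
        | some (.keySwitch a) => exact hser (fun x =>
            red (pp.Q (getMeta (metas pp ((trainingSteps N hp).take t)) a).lvl)
              (ecd pp (getVal (vals pp x ((trainingSteps N hp).take t)) a)
                (getMeta (metas pp ((trainingSteps N hp).take t)) a).scale)) x
        | some (.input _ _) | some (.op _) | some (.send _) | some (.boot _) | none => rfl
      · rfl
  · refine (hc _).imp fun f hf => ?_
    cases p with
    | none =>
      refine List.mem_append_left _ (List.mem_append_right _ ?_)
      rw [if_pos (show srv = true from hpc)]
      exact List.mem_flatMap.2 ⟨j, List.mem_range.2 hj, hf⟩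
    | some i =>
      refine List.mem_append_left _ (List.mem_append_left _ (List.mem_flatMap.2
        ⟨i, List.mem_finRange i, ?_⟩))
      rw [if_pos (show i ∈ C from hpc)]
      exact List.mem_flatMap.2 ⟨j, List.mem_range.2 hj, hf⟩
  · refine (hc _).imp fun f hf => List.mem_append_right _ ?_
    rw [if_pos hsrv]
    refine List.mem_flatMap.2 ⟨t, List.mem_range.2 (List.getElem?_eq_some_iff.1 ht).1, ?_⟩
    simp only [ht, out]
    exact hf

/-- The plaintexts used by the simulator are available to it, or `0`. -/
theorem simPlain_available {q : ((Party N → ℕ → Slots) → ℤ) → Prop} (h0 : q fun _ => 0)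
    {P : List (Step N)} {t : ℕ}
    (hin : ∀ p j, P[t]? = some (.input p j) → Corrupt C srv p →
      EachCoord q fun x : Party N → ℕ → Slots => red pp.Qmax (ecd pp (x p j) pp.scale))
    (hout : srv = true → ∀ a, P[t]? = some (.keySwitch a) →
      EachCoord q fun x : Party N → ℕ → Slots =>
        red (pp.Q (getMeta (metas pp (P.take t)) a).lvl)
          (ecd pp (getVal (vals pp x (P.take t)) a) (getMeta (metas pp (P.take t)) a).scale)) :
    (EachCoord q fun x => (simPlain C srv false x P t : RPoly pp × Bool).1) ∧
      ∃ β, ∀ x, (simPlain C srv false x P t : RPoly pp × Bool).2 = β := by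
  have hzero : EachCoord q fun _ : Party N → ℕ → Slots => (0 : RPoly pp) :=
    eachCoord_poly.2 fun _ => h0
  unfold simPlain realPlain
  match hs : P[t]? with
  | some (.input p j) =>
    by_cases hp : Corrupt C srv p
    · simp only [if_pos hp]
      exact ⟨hin p j hs hp, true, fun _ => rfl⟩
    · simp only [if_neg hp]
      exact ⟨hzero, true, fun _ => rfl⟩
  | some (.keySwitch a) =>
    by_cases hsrv : srv = true
    · simp only [if_pos hsrv]
      exact ⟨hout hsrv a hs, true, fun _ => rfl⟩
    · simp only [if_neg hsrv]
      exact ⟨hzero, false, fun _ => rfl⟩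
  | some (.boot a) => exact ⟨hzero, false, fun _ => rfl⟩
  | some (.op _) | some (.send _) | none => exact ⟨hzero, false, fun _ => rfl⟩

variable {b : Budget}

theorem listed_corruptInputs {fs : List ((Party N → ℕ → Slots) → ℤ)}
    (hlen : N * (2 * (hp.iters * hp.batch) * pp.deg) + hp.layers * pp.deg ≤ b.s)
    (hin : ∀ p j, Corrupt C srv p → InputBound hp (.input p j) →
      EachCoord (· ∈ fs) fun x : Party N → ℕ → Slots => red pp.Qmax (ecd pp (x p j) pp.scale)) :
    Listed (· ∈ fs) b.s fun x => corruptInputs pp N hp C srv x := by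
  have hdim : dim (RPoly pp) ≤ pp.deg := (dim_poly _).trans (mul_one _).le
  have h1 : Listed (· ∈ fs) (N * (2 * (hp.iters * hp.batch) * pp.deg))
      fun x => (List.finRange N).flatMap fun i => if i ∈ C then
        (List.range (2 * (hp.iters * hp.batch))).flatMap fun j =>
          Ser.ser (red pp.Qmax (ecd pp (x (some i) j) pp.scale)) else [] := by
    have := Listed.flatMap (p := (· ∈ fs)) (List.finRange N)
      (l := 2 * (hp.iters * hp.batch) * pp.deg)
      (L := fun i (x : Party N → ℕ → Slots) => if i ∈ C then
        (List.range (2 * (hp.iters * hp.batch))).flatMap fun j =>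
          Ser.ser (red pp.Qmax (ecd pp (x (some i) j) pp.scale)) else [])
      fun i _ => Listed.ite _ (fun hi => ?_) fun _ => Listed.nil
    · rwa [List.length_finRange] at this
    · have := Listed.flatMap (p := (· ∈ fs)) (List.range (2 * (hp.iters * hp.batch)))
        (L := fun j (x : Party N → ℕ → Slots) =>
          Ser.ser (red pp.Qmax (ecd pp (x (some i) j) pp.scale)))
        fun j hj => ((hin (some i) j hi (List.mem_range.1 hj)).listed).mono hdim
      rwa [List.length_range] at this
  have h2 : Listed (· ∈ fs) (hp.layers * pp.deg)
      fun x : Party N → ℕ → Slots => if srv then (List.range hp.layers).flatMap fun j =>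
        Ser.ser (red pp.Qmax (ecd pp (x none j) pp.scale)) else [] :=
    Listed.ite _ (fun hsrv => by
      have := Listed.flatMap (p := (· ∈ fs)) (List.range hp.layers)
        (L := fun j (x : Party N → ℕ → Slots) =>
          Ser.ser (red pp.Qmax (ecd pp (x none j) pp.scale)))
        fun j hj => ((hin none j hsrv (List.mem_range.1 hj)).listed).mono hdim
      rwa [List.length_range] at this) fun _ => Listed.nil
  exact (h1.append h2).mono hlen

/-- The simulator is a circuit of polynomial size. -/
theorem exists_simulator (hb : Fits b pp N) (hC : h ∉ C) (hP : (trainingSteps N hp).length ≤ b.s)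
    (hlen : N * (2 * (hp.iters * hp.batch) * pp.deg) + hp.layers * pp.deg ≤ b.s) :
    ∃ S : Circuit, S.size ≤ b.s ^ 49 * b.W ∧
      ∀ x, S.run (simInput pp N hp C srv x) = simView pp h C srv hp x := by
  obtain ⟨fs, hfs, hin, hout⟩ := exists_simInput_eq pp C srv hp
  have h4 := b.four_le
  have hb₁ := hb.change_users (n := 1) (by omega)
  have hdraws : Draws b (SimCoins pp N (trainingSteps N hp).length) :=
    (hb.draws_keyRand N).prod ((hb.draws_keyRand 1).prod (hb.draws_runCoins _))
  let A : Set ((Party N → ℕ → Slots) × SimCoins pp N (trainingSteps N hp).length → ℤ) :=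
    withCoins {f | f ∈ fs} (SimCoins pp N (trainingSteps N hp).length)
  have hA : ∀ f ∈ fs, (fun y => f y.1) ∈ A := fun f hf => Or.inl ⟨f, hf, rfl⟩
  have hcoins : EachCoord (Cx b A 0) fun y : (Party N → ℕ → Slots) × SimCoins pp N (trainingSteps N hp).length => y.2 :=
    fun f hf => Cx.of_mem (Or.inr ⟨f, hf, rfl⟩)
  obtain ⟨n₁, B₁, hn₁, hr₁, hw⟩ := KeySeen.of_coins (h := h) hb hcoins.fst
  obtain ⟨n₂, B₂, hn₂, hr₂, hw'⟩ := KeySeen.of_coins (h := (0 : Fin 1)) hb₁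
    (hcoins.snd.fst.imp fun f hf => hf.mono le_rfl hr₁.subset)
  have hsub : A ⊆ B₂ := hr₁.subset.trans hr₂.subset
  have hq : ∀ f ∈ fs, Cx b B₂ 0 fun y => f y.1 := fun f hf => Cx.of_mem (hsub (hA f hf))
  obtain ⟨n₃, B₃, hn₃, hr₃, hv⟩ := exists_reach_view hb hC srv
    (hw.imp fun f hf => hf.mono le_rfl hr₂.subset) hw'
    (fun _ => hcoins.snd.fst.imp fun f hf => hf.mono le_rfl hsub)
    (L := fun y => corruptInputs pp N hp C srv y.1) (by
      obtain ⟨gs, h1, h2, h3⟩ := listed_corruptInputs hlen hin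
      refine ⟨gs.map fun f y => f y.1, fun y => by rw [h1, List.map_map]; rfl, by simpa using h2,
        fun f hf => ?_⟩
      obtain ⟨g, hg, rfl⟩ := List.mem_map.1 hf
      exact hq g (h3 g hg))
    (ov := fun _ _ => none) (g := fun y => simPlain C srv false y.1 (trainingSteps N hp))
    (ω := fun y => extend y.2.2.2) hP fun t ht => by
      obtain ⟨hplain, β, hβ⟩ := simPlain_available (pp := pp) (C := C) (srv := srv)
        (q := fun f => Cx b B₂ 0 fun y : (Party N → ℕ → Slots) × SimCoins pp N (trainingSteps N hp).length => f y.1)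
        (P := trainingSteps N hp) (t := t) (Cx.const 0 (Nat.zero_le _))
        (fun p j hs hpc => (hin p j hpc (inputBound_of_mem (List.mem_of_getElem? hs))).imp
          fun f hf => hq f hf)
        (fun hsrv a hs => (hout hsrv t a hs).imp fun f hf => hq f hf)
      refine ⟨Or.inl fun _ => rfl, hplain, ⟨β, fun y => hβ y.1⟩, ?_⟩
      simp only [extend, dif_pos ht]
      exact (hcoins.snd.snd.apply ⟨t, ht⟩).imp fun f hf => hf.mono le_rfl hsub
  obtain ⟨S, hS, hrun⟩ := (hdraws.samplable
    (hv.impl_pure.reach ((hr₁.trans hr₂).trans hr₃))).circuit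
  refine ⟨S, hS.trans ?_, fun x => ?_⟩
  · have hdim : dim (SimCoins pp N (trainingSteps N hp).length) ≤ b.s ^ 8 := by
      have h1 := hb.dim_keyRand hb.users
      have h2 := hb.dim_keyRand (n := 1) (by omega)
      have h3 := hb.dim_runCoins hP
      have h5 : 4 * b.s ^ 7 ≤ b.s ^ 8 := b.four_mul_pow_le 7
      have h6 := b.pow_le_pow (show 6 ≤ 7 by omega)
      have h7 : dim (SimCoins pp N (trainingSteps N hp).length) = dim (KeyRand pp N) +
        dim (KeyRand pp 1 × RunCoins pp N (trainingSteps N hp).length) := dim_prod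
      have h8 := dim_prod (α := KeyRand pp 1) (β := RunCoins pp N (trainingSteps N hp).length)
      omega
    have hW : 1 ≤ b.W := Nat.le_add_right _ _
    have e1 := Nat.mul_le_mul_right b.W hdim
    have e2 : b.s ^ 8 * 1 ≤ b.s ^ 8 * b.W := Nat.mul_le_mul_left _ hW
    have e3 : (b.s ^ 8 + (n₁ + n₂ + n₃) + b.s ^ 8) * b.W ≤ b.s ^ 49 * b.W := by
      refine Nat.mul_le_mul_right _ ?_
      have h1 := b.pow_le_pow (show 28 ≤ 47 by omega)
      have h2 := b.pow_le_pow (show 8 ≤ 47 by omega)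
      have h3 : 4 * b.s ^ 47 ≤ b.s ^ 48 := b.four_mul_pow_le 47
      have h5 : 4 * b.s ^ 48 ≤ b.s ^ 49 := b.four_mul_pow_le 48
      omega
    rw [add_mul, add_mul] at e3
    omega
  · rw [hfs, hrun]
    rfl

end Simulator

/-! ### Closeness of the real and the simulated view -/

section Closeness

variable {pp : Params} {N : ℕ} {h : Fin N} {C : Finset (Fin N)} {srv : Bool} {hp : Hyper}
  {b : Budget}

theorem natAbs_red_le {n Q : ℕ} (hQ : 0 < Q) (a : Poly n) (k : Fin n) :
    (red Q a k).natAbs ≤ Q := by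
  have h1 := Int.emod_nonneg (a k) (b := (Q : ℤ)) (by omega)
  have h2 := Int.emod_lt_of_pos (a k) (b := (Q : ℤ)) (by omega)
  rw [red_apply]
  omega

theorem natAbs_realPlain_le (x : Party N → ℕ → Slots) (P : List (Step N)) (t : ℕ)
    (k : Fin pp.deg) : ((realPlain x P t : RPoly pp × Bool).1 k).natAbs ≤ pp.Qmax := by
  have hred : ∀ (a : ℕ) (m : RPoly pp),
      (red (pp.Q (getMeta (metas pp (P.take t)) a).lvl) m k).natAbs ≤ pp.Qmax := fun a m => by
    have hl := getMeta_lvl_le (metas_lvl_le (pp := pp) (P.take t)) a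
    exact (natAbs_red_le (Params.Q_pos hl) m k).trans
      (Nat.le_of_dvd Params.Qmax_pos (Params.Q_dvd hl))
  unfold realPlain
  match P[t]? with
  | some (.input p j) => exact natAbs_red_le Params.Qmax_pos _ k
  | some (.boot a) => exact hred a _
  | some (.keySwitch a) => exact hred a _
  | some (.op _) | some (.send _) | none => exact Nat.zero_le _

theorem natAbs_simPlain_le (x : Party N → ℕ → Slots) (P : List (Step N)) (t : ℕ)
    (k : Fin pp.deg) :
    ((simPlain C srv true x P t : RPoly pp × Bool).1 k).natAbs ≤ pp.Qmax := by
  have hreal := natAbs_realPlain_le (pp := pp) x P t k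
  unfold simPlain
  match P[t]? with
  | some (.input p j) => dsimp only; split_ifs; exacts [hreal, Nat.zero_le _]
  | some (.boot a) => exact hreal
  | some (.keySwitch a) => dsimp only; split_ifs; exacts [hreal, Nat.zero_le _]
  | some (.op _) | some (.send _) | none => exact Nat.zero_le _

theorem natAbs_le_of_mem_corruptInputs {x : Party N → ℕ → Slots} {z : ℤ}
    (hz : z ∈ corruptInputs pp N hp C srv x) : z.natAbs ≤ pp.Qmax := by
  have hser : ∀ a : RPoly pp, z ∈ Ser.ser (red pp.Qmax a) → z.natAbs ≤ pp.Qmax := fun a ha => by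
    obtain ⟨k, -, hk⟩ := List.mem_flatMap.1 ha
    rw [List.mem_singleton.1 hk]
    exact natAbs_red_le Params.Qmax_pos a k
  rcases List.mem_append.1 hz with h1 | h1
  · obtain ⟨i, -, hi⟩ := List.mem_flatMap.1 h1
    split_ifs at hi
    · obtain ⟨j, -, hj⟩ := List.mem_flatMap.1 hi
      exact hser _ hj
    · exact absurd hi List.not_mem_nil
  · split_ifs at h1
    · obtain ⟨j, -, hj⟩ := List.mem_flatMap.1 h1
      exact hser _ hj
    · exact absurd h1 List.not_mem_nil

theorem length_corruptInputs_le
    (hlen : N * (2 * (hp.iters * hp.batch) * pp.deg) + hp.layers * pp.deg ≤ b.s)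
    (x : Party N → ℕ → Slots) : (corruptInputs pp N hp C srv x).length ≤ b.s := by
  obtain ⟨fs, -, hin, -⟩ := exists_simInput_eq pp C srv hp
  obtain ⟨gs, h1, h2, -⟩ := listed_corruptInputs hlen hin
  exact (congrArg List.length (h1 x)).trans_le ((List.length_map _).trans_le h2)

theorem expect_realView (x : Party N → ℕ → Slots) (D : Circuit) :
    expect (realView pp N hp C srv x) (acc D) = expect (realRun pp N hp x) fun z =>
      viewAcc D (corruptInputs pp N hp C srv x) C srv z.1 z.2.1 (viewState C srv z.2.2) := by
  refine (expect_bind _ _ _).trans (congrArg _ (funext fun z => ?_))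
  exact expect_pure _ _

/-- If the masks are too small for some value that is bootstrapped, no execution is accurate. -/
theorem failProb_eq_one {δ : ℝ} {x : Party N → ℕ → Slots}
    (hmask : ¬ ∀ t a, (trainingSteps N hp)[t]? = some (Step.boot a) → ∀ k,
      |((ecd pp (getVal (vals pp x ((trainingSteps N hp).take t)) a)
        (getMeta (metas pp ((trainingSteps N hp).take t)) a).scale k : ℤ) : ℝ)|
        ≤ δ * (2 * pp.mask + 1)) :
    failProb pp N hp δ x = 1 := by
  have hset : {z : KeyRand pp N × KeyRand pp 1 × State pp N |
      ¬ Accurate δ (trainingSteps N hp) x (secKey z.1) z.2.2.cts} = Set.univ :=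
    Set.eq_univ_of_forall fun z hz => hmask fun t a ht => (hz t a (Or.inl ht)).2 ht
  rw [failProb, hset, ← expect_indicator, Set.indicator_univ, expect_const, ENNReal.toReal_one]

/-- A distinguisher against which encryption is secure hardly tells the real view from the
simulated one. -/
theorem abs_acceptProb_sub_le (hb : Fits b pp N) (hC : h ∉ C)
    (hP : (trainingSteps N hp).length ≤ b.s)
    (hlen : N * (2 * (hp.iters * hp.batch) * pp.deg) + hp.layers * pp.deg ≤ b.s) {D : Circuit}
    {εU εS : ℝ} (hU0 : 0 ≤ εU) (hS0 : 0 ≤ εS) (hU : AdvLE b D pp N εU) (hS : AdvLE b D pp 1 εS)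
    (δ : ℝ) (x : Party N → ℕ → Slots) :
    |acceptProb D (realView pp N hp C srv x) - acceptProb D (simView pp h C srv hp x)| ≤
      failProb pp N hp δ x + (2 * ((trainingSteps N hp).length * (pp.deg * |δ|))
        + (trainingSteps N hp).length * (εU + εS)) := by
  have hfail : 0 ≤ failProb pp N hp δ x := ENNReal.toReal_nonneg
  set T := (trainingSteps N hp).length with hT
  have hR1 := expect_le_one (realView pp N hp C srv x) (acc_le_one D)
  have hS1 := expect_le_one (simView pp h C srv hp x) (acc_le_one D)
  rw [acceptProb_eq, acceptProb_eq]
  by_cases hmask : ∀ t a, (trainingSteps N hp)[t]? = some (Step.boot a) → ∀ k,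
      |((ecd pp (getVal (vals pp x ((trainingSteps N hp).take t)) a)
        (getMeta (metas pp ((trainingSteps N hp).take t)) a).scale k : ℤ) : ℝ)|
        ≤ δ * (2 * pp.mask + 1)
  · set F := viewAcc (pp := pp) D (corruptInputs pp N hp C srv x) C srv with hF
    have hF1 : ∀ w w' z, F w w' z ≤ 1 := fun _ _ _ => acc_le_one _ _
    have hF1' : ∀ w w' z, 1 - F w w' z ≤ 1 := fun _ _ _ => tsub_le_self
    set P := trainingSteps N hp with hPdef
    set R := expect (realView pp N hp C srv x) (acc D) with hR
    set η : ℝ≥0∞ := T * (pp.deg * ENNReal.ofReal δ) with hη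
    set φ := ENNReal.ofReal (failProb pp N hp δ x) with hφ
    set ε : ℝ≥0∞ := T * (ENNReal.ofReal εU + ENNReal.ofReal εS) with hε
    have hreal : R ≤ hybrid h C srv P F (realPlain x P) + (η + φ) := by
      rw [hR, expect_realView]
      exact expect_realRun_le hC hF1
    have hreal' : hybrid h C srv P F (realPlain x P) ≤ R + (η + φ) := by
      refine le_add_of_one_sub_le (hybrid_le_one hF1 _) ?_
      rw [hR, expect_realView, ← expect_one_sub _ fun z => hF1 _ _ _, ← hybrid_one_sub hF1]
      exact expect_realRun_le hC hF1'
    have hopen := hybrid_simPlain_le (srv := srv) hC hmask hF1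
    have hopen' := le_add_of_one_sub_le (hybrid_le_one hF1 _)
      ((hybrid_one_sub hF1 _).symm.trans_le ((hybrid_simPlain_le (srv := srv) hC hmask hF1').trans_eq
        (congrArg (· + _) (hybrid_one_sub hF1 _))))
    have hLM : ∀ z ∈ corruptInputs pp N hp C srv x, z.natAbs ≤ b.M := fun z hz =>
      (natAbs_le_of_mem_corruptInputs hz).trans hb.Qmax_le
    have hL := length_corruptInputs_le (C := C) (srv := srv) hlen x
    have hb1 : ∀ t < P.length, ∀ k, ((realPlain x P t : RPoly pp × Bool).1 k).natAbs ≤ b.M :=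
      fun t _ k => (natAbs_realPlain_le x P t k).trans hb.Qmax_le
    have hb2 : ∀ t < P.length, ∀ k,
        ((simPlain C srv true x P t : RPoly pp × Bool).1 k).natAbs ≤ b.M :=
      fun t _ k => (natAbs_simPlain_le x P t k).trans hb.Qmax_le
    have henc := hybrid_le_of_forall_hidden (srv := srv) hb hC hL hLM hP hU hS hb1 hb2
      fun j s hs => hidden_simPlain x hs
    have henc' := hybrid_le_of_forall_hidden (srv := srv) hb hC hL hLM hP hU hS hb2 hb1
      fun j s hs => (hidden_simPlain x hs).symm
    rw [expect_simView]
    have hsum : η + φ + ε + η ≤ ENNReal.ofReal (failProb pp N hp δ x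
        + (2 * (T * (pp.deg * |δ|)) + T * (εU + εS))) := by
      have hη' : η ≤ ENNReal.ofReal (T * (pp.deg * |δ|)) := by
        rw [hη, ENNReal.ofReal_mul (Nat.cast_nonneg _), ENNReal.ofReal_mul (Nat.cast_nonneg _),
          ENNReal.ofReal_natCast, ENNReal.ofReal_natCast]
        gcongr
        exact le_abs_self δ
      have hε' : ε = ENNReal.ofReal (T * (εU + εS)) := by
        rw [ENNReal.ofReal_mul (Nat.cast_nonneg _), ENNReal.ofReal_add hU0 hS0,
          ENNReal.ofReal_natCast]
      have hnn : 0 ≤ (T : ℝ) * (pp.deg * |δ|) := by positivity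
      rw [ENNReal.ofReal_add hfail (by positivity), ENNReal.ofReal_add (by positivity)
        (by positivity), two_mul, ENNReal.ofReal_add hnn hnn, ← hε']
      calc η + φ + ε + η = φ + (η + η + ε) := by ring
        _ ≤ _ := add_le_add le_rfl (add_le_add (add_le_add hη' hη') le_rfl)
    refine abs_toReal_sub_le (by positivity) hR1 (hybrid_le_one hF1 _) ?_ ?_
    · calc R ≤ hybrid h C srv P F (realPlain x P) + (η + φ) := hreal
        _ ≤ hybrid h C srv P F (simPlain C srv true x P) + ε + (η + φ) := by gcongr
        _ ≤ hybrid h C srv P F (simPlain C srv false x P) + η + ε + (η + φ) := by gcongr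
        _ = hybrid h C srv P F (simPlain C srv false x P) + (η + φ + ε + η) := by ring
        _ ≤ _ := by gcongr
    · calc hybrid h C srv P F (simPlain C srv false x P)
          ≤ hybrid h C srv P F (simPlain C srv true x P) + η := hopen'
        _ ≤ hybrid h C srv P F (realPlain x P) + ε + η := by gcongr
        _ ≤ R + (η + φ) + ε + η := by gcongr
        _ = R + (η + φ + ε + η) := by ring
        _ ≤ _ := by gcongr
  · rw [failProb_eq_one hmask]
    have hone : 1 ≤ ENNReal.ofReal (1 + (2 * (T * (pp.deg * |δ|)) + T * (εU + εS))) :=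
      ENNReal.one_le_ofReal.2 (le_add_of_nonneg_right (by positivity))
    exact abs_toReal_sub_le (by positivity) hR1 hS1 (hR1.trans (hone.trans le_add_self))
      (hS1.trans (hone.trans le_add_self))

end Closeness

/-! ### Asymptotics -/

section Asymptotics

/-- Bounds for the dimensions and the moduli that occur in a training protocol. -/
def budget (pp : Params) (N : ℕ) (hp : Hyper) : Budget where
  s := pp.size + N + (hp.size + N + 4) ^ 19
    + (N * (2 * (hp.size * hp.size) * pp.size) + hp.size * pp.size) + 4
  M := 2 ^ (pp.size + 1) ^ 2
  four_le := Nat.le_add_left _ _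

theorem le_two_pow_of_size_le {a n : ℕ} (h : Nat.size a ≤ n) : a + 1 ≤ 2 ^ n :=
  Nat.size_le.1 h

theorem fits_budget (pp : Params) (N : ℕ) (hp : Hyper) : Fits (budget pp N hp) pp N := by
  have hs : pp.deg + pp.levels + Nat.size pp.Qmax + Nat.size pp.scale + Nat.size pp.base
      + pp.digits + Nat.size pp.errCoin + pp.errThr.length + Nat.size pp.errOff.natAbs
      + Nat.size pp.mask + pp.prec = pp.size := rfl
  have hz : pp.size + N ≤ (budget pp N hp).s := by
    simp only [budget]
    omega
  have hpow : ∀ {n}, n ≤ (pp.size + 1) ^ 2 → 2 ^ n ≤ (budget pp N hp).M := fun hn =>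
    Nat.pow_le_pow_right two_pos hn
  have hsq : pp.size + 1 ≤ (pp.size + 1) ^ 2 := Nat.le_self_pow two_ne_zero _
  refine ⟨by omega, by omega, by omega, by omega, ?_, ?_, ?_, ?_, ?_⟩
  · have h1 := le_two_pow_of_size_le (le_refl (Nat.size pp.Qmax))
    calc 2 * 2 ^ pp.prec * pp.Qmax ≤ 2 * 2 ^ pp.prec * 2 ^ Nat.size pp.Qmax :=
          Nat.mul_le_mul_left _ (by omega)
      _ = 2 ^ (1 + pp.prec + Nat.size pp.Qmax) := by rw [pow_add, pow_add, pow_one]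
      _ ≤ _ := hpow (by omega)
  · have h1 := le_two_pow_of_size_le (le_refl (Nat.size pp.base))
    calc pp.base ^ (pp.digits + 1) ≤ (2 ^ Nat.size pp.base) ^ (pp.digits + 1) :=
          Nat.pow_le_pow_left (by omega) _
      _ = 2 ^ (Nat.size pp.base * (pp.digits + 1)) := (pow_mul _ _ _).symm
      _ ≤ _ := hpow (by
        rw [sq]
        exact Nat.mul_le_mul (by omega) (by omega))
  · exact (le_two_pow_of_size_le le_rfl).trans (hpow (by omega))
  · have h1 := le_two_pow_of_size_le (le_refl (Nat.size pp.mask))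
    calc 2 * pp.mask ≤ 2 ^ (Nat.size pp.mask + 1) := by omega
      _ ≤ _ := hpow (by omega)
  · exact (Nat.le_succ _).trans ((le_two_pow_of_size_le le_rfl).trans (hpow (by omega)))

theorem length_le_budget (pp : Params) (N : ℕ) (hp : Hyper) :
    (trainingSteps N hp).length ≤ (budget pp N hp).s := by
  have := length_trainingSteps_le (N := N) (hp := hp)
  simp only [budget]
  omega

theorem input_length_le_budget (pp : Params) (N : ℕ) (hp : Hyper) :
    N * (2 * (hp.iters * hp.batch) * pp.deg) + hp.layers * pp.deg ≤ (budget pp N hp).s := by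
  have h1 : hp.layers + hp.dim + hp.iters + hp.batch + hp.act.length + hp.dact.length = hp.size :=
    rfl
  have h2 : pp.deg ≤ pp.size := by
    simp only [Params.size]
    omega
  have h3 : N * (2 * (hp.iters * hp.batch) * pp.deg) ≤
      N * (2 * (hp.size * hp.size) * pp.size) :=
    Nat.mul_le_mul_left _ (Nat.mul_le_mul (Nat.mul_le_mul_left _ (Nat.mul_le_mul (by omega)
      (by omega))) h2)
  have h4 : hp.layers * pp.deg ≤ hp.size * pp.size := Nat.mul_le_mul (by omega) h2
  simp only [budget]
  omega

variable {pp : ℕ → Params} {N : ℕ → ℕ} {hp : ℕ → Hyper} (hpp : PolyBounded fun k => (pp k).size)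
  (hN : PolyBounded N) (hhp : PolyBounded fun k => (hp k).size)
include hpp hN hhp

theorem polyBounded_budget_s : PolyBounded fun k => (budget (pp k) (N k) (hp k)).s :=
  (((hpp.add hN).add (((hhp.add hN).add (.const 4)).pow 19)).add
    ((hN.mul (((PolyBounded.const 2).mul (hhp.mul hhp)).mul hpp)).add (hhp.mul hpp))).add (.const 4)

omit hN hhp in
theorem polyBounded_budget_W : PolyBounded fun k => (budget (pp k) (N k) (hp k)).W :=
  ((PolyBounded.const 2).add ((hpp.add (.const 1)).pow 2)).mono fun k => by
    simp only [Budget.W, budget, Nat.size_pow]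
    omega

theorem polyBounded_budget :
    PolyBounded fun k => (budget (pp k) (N k) (hp k)).s ^ 49 * (budget (pp k) (N k) (hp k)).W :=
  ((polyBounded_budget_s hpp hN hhp).pow 49).mul (polyBounded_budget_W hpp)

/-- Privacy against every proper subset of the users, with or without the server. -/
theorem private_of_cpaSecure {δ : ℕ → ℝ} (hδ : Negligible δ) (husers : CPASecure pp N)
    (hserver : CPASecure pp fun _ => 1) (srv : Bool) {A : ∀ k, Finset (Fin (N k))}
    (hA : ∀ k, (A k).card < N k) : Private pp N hp δ A srv := by
  have hh : ∀ k, ∃ h, h ∉ A k := fun k => by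
    by_contra! hall
    have := hA k
    rw [Finset.eq_univ_of_forall hall, Finset.card_fin] at this
    exact lt_irrefl _ this
  choose h hh using hh
  choose S hSsize hSrun using fun k =>
    exists_simulator (srv := srv) (fits_budget (pp k) (N k) (hp k)) (hh k)
      (length_le_budget _ _ _) (input_length_le_budget _ _ _)
  refine ⟨S, (polyBounded_budget hpp hN hhp).mono hSsize, fun x hx D hD => ?_⟩
  have hc := (polyBounded_budget hpp hN hhp).add ((PolyBounded.const 1).add hD)
  obtain ⟨εU, hεU, hεU0, hU⟩ := husers.uniform (fun k => (Nat.zero_le _).trans_lt (hA k)) hc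
  obtain ⟨εS, hεS, hεS0, hS⟩ := hserver.uniform (fun _ => one_pos) hc
  have hT : PolyBounded fun k => (trainingSteps (N k) (hp k)).length :=
    (polyBounded_budget_s hpp hN hhp).mono fun k => length_le_budget _ _ _
  have hdeg : PolyBounded fun k => 2 * ((trainingSteps (N k) (hp k)).length * (pp k).deg) :=
    (PolyBounded.const 2).mul (hT.mul (hpp.mono fun k => by
      simp only [Params.size]
      omega))
  refine (hx.add ((Negligible.polyBounded_mul hdeg hδ).add
    (Negligible.polyBounded_mul hT (hεU.add hεS)))).mono (fun k => abs_nonneg _) fun k => ?_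
  dsimp only
  rw [hSrun]
  refine (abs_acceptProb_sub_le (fits_budget (pp k) (N k) (hp k)) (hh k) (length_le_budget _ _ _)
    (input_length_le_budget _ _ _) (hεU0 k) (hεS0 k) (hU k) (hS k) (δ k) (x k)).trans_eq ?_
  rw [abs_of_nonneg (add_nonneg (hεU0 k) (hεS0 k))]
  push_cast
  ring

end Asymptotics

end Hercules

theorem mainTheorem3
    (pp : ℕ → Hercules.Params) (N : ℕ → ℕ) (hp : ℕ → Hercules.Hyper) (δ : ℕ → ℝ)
    (hpp : Hercules.PolyBounded fun k => (pp k).size)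
    (hN : Hercules.PolyBounded N)
    (hhp : Hercules.PolyBounded fun k => (hp k).size)
    (hδ : Hercules.Negligible δ)
    (husers : Hercules.CPASecure pp N)
    (hserver : Hercules.CPASecure pp fun _ => 1) :
    (∀ A : ∀ k, Finset (Fin (N k)), (∀ k, (A k).card < N k) →
      Hercules.Private pp N hp δ A false) ∧
    (∀ A : ∀ k, Finset (Fin (N k)), (∀ k, (A k).card < N k) →
      Hercules.Private pp N hp δ A true) := by
  exact ⟨fun _ hA => Hercules.private_of_cpaSecure hpp hN hhp hδ husers hserver false hA,
    fun _ hA => Hercules.private_of_cpaSecure hpp hN hhp hδ husers hserver true hA⟩
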